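/- Work in the relational language $\mathcal L=\{R^+,R^-,G^+,G^-\}$ of four binary relation symbols. An $\mathcal L$-structure is complete if all relations are irreflexive, every ordered pair $(a,b)$ of distinct elements satisfies exactly one of the four relations, denoted $\mathbf r(a,b)$, and $R^+(a,b)\Leftrightarrow R^-(b,a)$, $G^+(a,b)\Leftrightarrow G^-(b,a)$. A triangle is a complete structure on three points; the triangle $XYZ$ is the one on $\{a,b,c\}$ with $X(a,b)$, $Y(a,c)$, $Z(b,c)$. For a set $S$ of triangles let $\mathrm{Forb}_c(S)$ be the class of all finite complete structures into which no triangle from $S$ embeds. Let $S$ be one of the following sets (Cherlin's asymmetric examples): (#8) $\{G^+G^-G^+,\ R^+G^-G^+\}$; (#9) $\{G^+G^+G^+,\ R^+G^-G^+\}$; (#10) $\{G^+G^+G^+,\ G^+G^-G^+,\ R^+G^-G^+\}$. A class $\mathcal C$ of finite structures is a semi-free amalgamation class with set of solutions $\mathcal L'\subsetneq\mathcal L$ if it is an amalgamation (Fraïssé) class and all $A,C\in\mathcal C$ with a common embedded substructure $B\in\mathcal C$ have an amalgam $D\in\mathcal C$ over $B$ in which $A\cap C=B$ and in which any relation holding between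 some $a\in A\setminus B$ and $c\in C\setminus B$ belongs to $\mathcal L'$. Given an ordering $R_1>\dots>R_m$ of $\mathcal L'$ and $A,B,C\in\mathrm{Forb}_c(S)$ with $B\subseteq A,C$, let $A\otimes_B C$ be the complete structure on the disjoint union of $A$ and $C$ over $B$ in which, for $a\in A\setminus B$ and $c\in C\setminus B$, $\mathbf r(a,c)=R_i$ with $i$ least such that for every $b\in B$ the triangle $\mathbf r(a,b)\,R_i\,\mathbf r(b,c)$ is not isomorphic to a member of $S$. $\mathrm{Forb}_c(S)$ is a prioritised semi-free amalgamation class with respect to this ordering if it is a semi-free amalgamation class with set of solutions $\mathcal L'$ and, for all such $A,B,C$, the structure $A\otimes_B C$ is defined (an $i$ always exists) and lies in $\mathrm{Forb}_c(S)$. Then $\mathrm{Forb}_c(S)$ is a prioritised semi-free amalgamation class with $\mathcal L'=\{R^+,R^-\}$ ordered as $R^+>R^-$. In particular it has a Fraïssé limit $\mathcal M_S$ (the countable homogeneous structure whose finite substructures are, up to isomorphism, exactly the members of $\mathrm{Forb}_c(S)$), and the automorphism group $\mathrm{Aut}(\mathcal M_S)$ is simple. -/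

import Mathlib

open CategoryTheory
open scoped FirstOrder

namespace MultiTournament

/-- The four relation symbols `R⁺, R⁻, G⁺, G⁻`. -/
inductive Colour : Type
  | Rpos
  | Rneg
  | Gpos
  | Gneg

/-- The converse colour: `R⁺ ↔ R⁻` and `G⁺ ↔ G⁻`. -/
def Colour.conv : Colour → Colour
  | .Rpos => .Rneg
  | .Rneg => .Rpos
  | .Gpos => .Gneg
  | .Gneg => .Gpos

/-- The relation symbols by arity: one binary symbol for each colour and no others. -/
inductive EdgeRel : ℕ → Type
  | edge : Colour → EdgeRel 2

/-- The relational language `{R⁺, R⁻, G⁺, G⁻}`. -/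
def Lang : FirstOrder.Language.{0, 0} := ⟨fun _ => Empty, EdgeRel⟩

instance : Lang.IsRelational := fun _ => inferInstanceAs (IsEmpty Empty)

/-- `Rel k a b`: the ordered pair `(a, b)` lies in the relation `k`. In particular
`Rel .Rpos a b` says that there is a directed `R`-edge from `a` to `b`. -/
def Rel {M : Type*} [Lang.Structure M] (k : Colour) (a b : M) : Prop :=
  FirstOrder.Language.Structure.RelMap (L := Lang) (EdgeRel.edge k) ![a, b]

/-- Complete structures: the relations are irreflexive, any two distinct elements are related by
exactly one relation, and `R⁺(a, b) ↔ R⁻(b, a)`, `G⁺(a, b) ↔ G⁻(b, a)`. -/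
structure IsComplete (M : Type*) [Lang.Structure M] : Prop where
  irrefl : ∀ (k : Colour) (a : M), ¬ Rel k a a
  existsUnique : ∀ a b : M, a ≠ b → ∃! k : Colour, Rel k a b
  conv : ∀ (k : Colour) (a b : M), Rel k a b ↔ Rel k.conv b a

/-- The colours of the ordered pairs of vertices of the triangle with
`r(0,1) = p`, `r(0,2) = q`, `r(1,2) = s`. -/
def triangleColour (p q s : Colour) : Fin 3 → Fin 3 → Option Colour :=
  ![![none, some p, some q],
    ![some p.conv, none, some s],
    ![some q.conv, some s.conv, none] ]

/-- The triangle `p q s`: the complete structure on three points `a = 0`, `b = 1`, `c = 2` with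
`p(a, b)`, `q(a, c)`, `s(b, c)`. -/
def triangle (p q s : Colour) : Bundled.{0} Lang.Structure where
  α := Fin 3
  str :=
    { funMap := fun f _ => f.elim
      RelMap := fun {_} r =>
        match r with
        | EdgeRel.edge k => fun x => triangleColour p q s (x 0) (x 1) = some k }

/-- `Forb_c(S)`: the finite complete structures into which no triangle from `S` embeds. -/
def Forb (S : Set (Bundled.{0} Lang.Structure)) : Set (Bundled.{0} Lang.Structure) :=
  {M | Finite M ∧ IsComplete M ∧ ∀ T ∈ S, IsEmpty (T ↪[Lang] M)}

/-- `A, C` are amalgamated over `B` in `D` without identifying points outside `B`: the square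
commutes and the images of `A` and `C` meet exactly in the image of `B`. -/
structure IsStrongAmalgam {A B C D : Bundled.{0} Lang.Structure}
    (f : B ↪[Lang] A) (g : B ↪[Lang] C) (i : A ↪[Lang] D) (j : C ↪[Lang] D) : Prop where
  comm : i.comp f = j.comp g
  inter : Set.range i ∩ Set.range j = Set.range (i.comp f)

/-- `K` is a semi-free amalgamation class with set of solutions `L'`: it is an amalgamation class
(a Fraïssé class), `L'` is a proper subset of the relation symbols, and any amalgamation problem in
`K` has a solution in `K` without identifications such that new pairs are related only by relations
from `L'`. -/
structure IsSemiFree (K : Set (Bundled.{0} Lang.Structure)) (L' : Set Colour) : Prop where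
  isFraisse : FirstOrder.Language.IsFraisse K
  proper : L' ⊂ Set.univ
  amalgam : ∀ (A B C : Bundled.{0} Lang.Structure) (f : B ↪[Lang] A) (g : B ↪[Lang] C),
    A ∈ K → B ∈ K → C ∈ K →
    ∃ (D : Bundled.{0} Lang.Structure) (i : A ↪[Lang] D) (j : C ↪[Lang] D),
      D ∈ K ∧ IsStrongAmalgam f g i j ∧
      ∀ a ∉ Set.range f, ∀ c ∉ Set.range g, ∀ k : Colour, Rel k (i a) (j c) → k ∈ L'

/-- Colouring the pair `(a, c)` by `k` does not complete any `b ∈ B` to a forbidden triangle, i.e.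
for every `b`, the triangle `r(a,b) k r(b,c)` is not (isomorphic to) a member of `S`. -/
def Admissible (S : Set (Bundled.{0} Lang.Structure)) {A B C : Bundled.{0} Lang.Structure}
    (f : B ↪[Lang] A) (g : B ↪[Lang] C) (a : A) (c : C) (k : Colour) : Prop :=
  ∀ (b : B) (p s : Colour), Rel p a (f b) → Rel s (g b) c →
    ∀ T ∈ S, IsEmpty (T ≃[Lang] triangle p k s)

/-- `D` (with the embeddings `i, j`) is the result `A ⊗_B C` of the prioritised completion with
respect to `prio 0 > prio 1 > ⋯`: its domain is the union of `A` and `C`, disjoint over `B`, and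
each new pair `(a, c)` gets the first colour in the list that is admissible. This determines the
complete structure `D` up to isomorphism. -/
structure IsPrioritisedAmalgam (S : Set (Bundled.{0} Lang.Structure)) {m : ℕ}
    (prio : Fin m → Colour) {A B C D : Bundled.{0} Lang.Structure}
    (f : B ↪[Lang] A) (g : B ↪[Lang] C) (i : A ↪[Lang] D) (j : C ↪[Lang] D) : Prop
    extends IsStrongAmalgam f g i j where
  union : Set.range i ∪ Set.range j = Set.univ
  colour : ∀ a ∉ Set.range f, ∀ c ∉ Set.range g,
    ∃ t : Fin m, Rel (prio t) (i a) (j c) ∧ Admissible S f g a c (prio t) ∧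
      ∀ u < t, ¬ Admissible S f g a c (prio u)

/-- `Forb_c(S)` is a prioritised semi-free amalgamation class with solution set
`L' = {prio 0, prio 1, …}` ordered as `prio 0 > prio 1 > ⋯`: it is a semi-free amalgamation class
with solutions `L'`, and `A ⊗_B C ∈ Forb_c(S)` for all `A, B, C ∈ Forb_c(S)` with `B` embedded in
`A` and `C` (in particular every new pair has an admissible colour in `L'`). -/
structure IsPrioritisedSemiFree (S : Set (Bundled.{0} Lang.Structure)) {m : ℕ}
    (prio : Fin m → Colour) : Prop where
  injective : Function.Injective prio
  semiFree : IsSemiFree (Forb S) (Set.range prio)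
  amalgam : ∀ (A B C : Bundled.{0} Lang.Structure) (f : B ↪[Lang] A) (g : B ↪[Lang] C),
    A ∈ Forb S → B ∈ Forb S → C ∈ Forb S →
    ∃ (D : Bundled.{0} Lang.Structure) (i : A ↪[Lang] D) (j : C ↪[Lang] D),
      D ∈ Forb S ∧ IsPrioritisedAmalgam S prio f g i j

/-- Example #8: `G⁺G⁻G⁺`, `R⁺G⁻G⁺`. -/
def cherlin8 : Set (Bundled.{0} Lang.Structure) :=
  {triangle .Gpos .Gneg .Gpos, triangle .Rpos .Gneg .Gpos}

/-- Example #9: `G⁺G⁺G⁺`, `R⁺G⁻G⁺`. -/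
def cherlin9 : Set (Bundled.{0} Lang.Structure) :=
  {triangle .Gpos .Gpos .Gpos, triangle .Rpos .Gneg .Gpos}

/-- Example #10: `G⁺G⁺G⁺`, `G⁺G⁻G⁺`, `R⁺G⁻G⁺`. -/
def cherlin10 : Set (Bundled.{0} Lang.Structure) :=
  {triangle .Gpos .Gpos .Gpos, triangle .Gpos .Gneg .Gpos, triangle .Rpos .Gneg .Gpos}

/-- The automorphism group of a structure, under composition. -/
instance autGroup (M : Type*) [Lang.Structure M] : Group (M ≃[Lang] M) where
  mul g h := g.comp h
  one := FirstOrder.Language.Equiv.refl Lang M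
  inv g := g.symm
  mul_assoc _ _ _ := rfl
  one_mul _ := rfl
  mul_one _ := rfl
  inv_mul_cancel g := g.symm_comp_self

end MultiTournament

/-!
Each of the three sets `S` forbids certain colours of `(x, z)` at the ends of a directed `G`-path
`x → y → z`, and nothing else: `R⁺G⁻G⁺` is isomorphic to `G⁺R⁻G⁺`, and the other triangles are
of the form `G⁺kG⁺`. So a complete structure lies in `Forb S` if it is finite and obeys a path rule
`ok` (`exists_isForbRule`). The proof uses only that `R⁺` is allowed and that `k` and its converse
are never both allowed (`IsPathRule`); it works with colourings `c : M → M → Option Colour` instead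
of first-order structures.

*Amalgamation.* A new point `x` can be added to a complete structure with a prescribed type over a
set `W` of points: every other point `w` gets `R⁻` if there is a `G`-path `w → u → x` with `u ∈ W`,
and `R⁺` otherwise (`IsColouring.consistent_stdExt`). Iterating this gives a colouring of `ℕ` that
realises all consistent types over finite sets; it is the Fraïssé limit
(`isFraisseLimit_limitStructure`). By homogeneity any finite set can be moved, fixing a given finite
set `K`, into prioritised position over `K` to any other (`IsGeneric.exists_fixer_std`), and
this is how the prioritised amalgams are found inside the limit (`exists_isPrioritisedAmalgam`).

*Simplicity.* The amalgamation is not symmetric, but pairs joined by an `R`-edge of either direction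
(`Far`) impose no constraint on each other, so a set can be moved off another one without any new
`G`-edges. Let `g ≠ 1` be an automorphism. It moves some point of every type over a finite set, and
a commutator `k = g⁻¹(hgh⁻¹)` with generic `h` does so along an `R`-edge
(`IsGeneric.exists_moves_redColours`). It is to be shown that every automorphism `f` is a product of
conjugates of `k` and `k⁻¹`.

Consider products `p₄p₃p₂p₁` of four conjugates of `k`. Conjugates with prescribed values on a
finite set can be chosen so that these four partial maps form a chain of finite sets
`Y₀ → Y₁ → Y₂ → Y₃ → Y₄` with as few overlaps as possible (`IsGeneric.exists_isChain`). Let `e` be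
any automorphism that agrees with the product on `Y₀`. For a further point `x₀`, the conjugates can
be chosen so that `x₁ = p₁x₀` and `x₃ = p₄⁻¹(e x₀)` are in general position. The point `x₂`
in the middle has to realise a type coming from `x₁` and a type coming from `x₃`; they agree on
`Y₂`, and their `G`-edges lie in `Y₂`, so that they are compatible. Thus the product can be made to
agree with `e` on any finite set (`IsChain.extend_finset`): the products are dense in a
neighbourhood.

A back-and-forth between two such products, `left` and `right`, maintains the equation
`right = f * left` on a growing finite set. In turn, one side is committed to more values and put
into a position with dense products, and the other side is adapted to it, which density allows. In
the limit `f` is the quotient of two products of four conjugates of `k`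
(`IsGeneric.exists_conjProd_eq_mul`).
-/

namespace MultiTournament

/-! ### Colourings obeying a path rule -/

/-- The properties of the set of colours that a pair `(x, z)` may have when there is a directed
`G`-path `x → y → z`. The sets `cherlin8`, `cherlin9`, `cherlin10` all forbid exactly the
violations of such a rule. -/
structure IsPathRule (ok : Colour → Prop) : Prop where
  rpos : ok .Rpos
  asymm : ∀ k, ok k → ¬ ok k.conv

/-- A complete structure, given by the colours of its ordered pairs (`none` on the diagonal), all of
whose directed `G`-paths of length two obey the path rule `ok`. -/
structure IsColouring {M : Type*} (ok : Colour → Prop) (c : M → M → Option Colour) : Prop where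
  eq_none : ∀ a b, c a b = none ↔ a = b
  conv : ∀ a b, c b a = (c a b).map Colour.conv
  path : ∀ x y z k, c x y = some .Gpos → c y z = some .Gpos → c x z = some k → ok k

/-- The function `q` is a consistent one-point type over `W`: adding a point `x` with
`r(x, w) = q w` for `w ∈ W` creates no violation of the path rule `ok`. -/
def Consistent {M : Type*} (ok : Colour → Prop) (c : M → M → Option Colour) (W : Set M)
    (q : M → Colour) : Prop :=
  ∀ u ∈ W, ∀ v ∈ W,
    (q u = .Gpos → c u v = some .Gpos → ok (q v)) ∧
    (q u = .Gneg → q v = .Gpos → ∀ k, c u v = some k → ok k) ∧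
    (c u v = some .Gpos → q v = .Gneg → ok (q u).conv)

open Classical in
/-- The prioritised extension of a one-point type `q` over `W` to all points: a point `w ∉ W` gets
`R⁻` if a `G`-path `w → u → x` through some `u ∈ W` demands it, and `R⁺` otherwise. -/
noncomputable def stdExt {M : Type*} (c : M → M → Option Colour) (W : Set M) (q : M → Colour)
    (w : M) : Colour :=
  if w ∈ W then q w else if ∃ u ∈ W, c w u = some .Gpos ∧ q u = .Gneg then .Rneg else .Rpos

open Classical in
/-- The colouring obtained from `c` by changing the colours at the vertex `v` to `q`. -/
noncomputable def recolour {M : Type*} (c : M → M → Option Colour) (v : M) (q : M → Colour)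
    (a b : M) : Option Colour :=
  if a = v then (if b = v then none else some (q b))
  else if b = v then some (q a).conv else c a b

@[simp] theorem Colour.conv_conv (k : Colour) : k.conv.conv = k := by cases k <;> rfl

theorem Colour.conv_eq_iff {k l : Colour} : k.conv = l ↔ k = l.conv := by
  cases k <;> cases l <;> simp [Colour.conv]

theorem IsPathRule.not_rneg {ok : Colour → Prop} (h : IsPathRule ok) : ¬ ok .Rneg :=
  h.asymm _ h.rpos

namespace IsColouring

variable {M : Type*} {ok : Colour → Prop} {c : M → M → Option Colour}

theorem self (hc : IsColouring ok c) (a : M) : c a a = none := (hc.eq_none a a).2 rfl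

theorem exists_eq (hc : IsColouring ok c) {a b : M} (h : a ≠ b) : ∃ k, c a b = some k := by
  cases hk : c a b with
  | none => exact absurd ((hc.eq_none a b).1 hk) h
  | some k => exact ⟨k, rfl⟩

theorem ne (hc : IsColouring ok c) {a b : M} {k : Colour} (h : c a b = some k) : a ≠ b := by
  rintro rfl
  simp [hc.self] at h

theorem swap (hc : IsColouring ok c) {a b : M} {k : Colour} (h : c a b = some k) :
    c b a = some k.conv := by
  rw [hc.conv a b, h]; rfl

theorem swap_iff (hc : IsColouring ok c) {a b : M} {k : Colour} :
    c b a = some k ↔ c a b = some k.conv :=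
  ⟨fun h => hc.swap h, fun h => by simpa using hc.swap h⟩

theorem not_mem_of_type_eq (hc : IsColouring ok c) {x y : M} {K : Set M} (hx : x ∉ K)
    (h : ∀ k ∈ K, c y k = c x k) : y ∉ K := fun hy =>
  hx (by rwa [(hc.eq_none x y).1 (by rw [← h y hy, hc.self])])

/-- The type of an actual point over a set not containing it is consistent. -/
theorem consistent_of_type (hc : IsColouring ok c) {W : Set M} {q : M → Colour} (x : M)
    (h : ∀ w ∈ W, c x w = some (q w)) : Consistent ok c W q := by
  intro u hu v hv
  have h1 := h u hu
  have h2 := h v hv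
  refine ⟨fun hq hg => hc.path x u v _ (by rw [h1, hq]) hg h2, fun hq hq' k hk => ?_,
    fun hg hq => ?_⟩
  · exact hc.path u x v k (by rw [hc.swap h1, hq]; rfl) (by rw [h2, hq']) hk
  · exact hc.path u v x _ hg (by rw [hc.swap h2, hq]; rfl) (hc.swap h1)

/-- The prioritised extension of a consistent type is consistent. No conflict arises, since paths
`w → u → x` and `x → v → w` with `u, v ∈ W` would give `ok` colours to both `(u, v)`
and `(v, u)`. -/
theorem consistent_stdExt (hok : IsPathRule ok) (hc : IsColouring ok c) {W : Set M}
    {q : M → Colour} (hq : Consistent ok c W q) :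
    Consistent ok c Set.univ (stdExt c W q) := by
  have hW : ∀ w ∈ W, stdExt c W q w = q w := fun w hw => by simp [stdExt, hw]
  have hR : ∀ w, w ∉ W → stdExt c W q w = .Rpos ∨ stdExt c W q w = .Rneg := fun w hw => by
    simp only [stdExt, hw, if_false]; split_ifs <;> simp
  have hG : ∀ w k, stdExt c W q w = k → (k = .Gpos ∨ k = .Gneg) → w ∈ W := fun w k hk hk' => by
    by_contra hw
    rcases hR w hw with h | h <;> rw [h] at hk <;> subst hk <;> simp at hk'
  intro u _ v _
  refine ⟨fun h1 h2 => ?_, fun h1 h2 k hk => ?_, fun h1 h2 => ?_⟩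
  · have hu := hG u _ h1 (.inl rfl)
    by_cases hv : v ∈ W
    · rw [hW v hv]; exact (hq u hu v hv).1 (by rwa [← hW u hu]) h2
    · have : ¬ ∃ w ∈ W, c v w = some .Gpos ∧ q w = .Gneg := by
        rintro ⟨w, hw, h3, h4⟩
        rw [hW u hu] at h1
        have hne : w ≠ u := by rintro rfl; rw [h1] at h4; cases h4
        obtain ⟨k, hk⟩ := hc.exists_eq hne
        exact hok.asymm k ((hq w hw u hu).2.1 h4 h1 k hk)
          (hc.path u v w _ h2 h3 (hc.swap hk))
      simp only [stdExt, hv, if_false, this]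
      exact hok.rpos
  · have hu := hG u _ h1 (.inr rfl)
    have hv := hG v _ h2 (.inl rfl)
    rw [hW u hu] at h1
    rw [hW v hv] at h2
    exact (hq u hu v hv).2.1 h1 h2 k hk
  · have hv := hG v _ h2 (.inr rfl)
    rw [hW v hv] at h2
    by_cases hu : u ∈ W
    · rw [hW u hu]; exact (hq u hu v hv).2.2 h1 h2
    · have : ∃ w ∈ W, c u w = some .Gpos ∧ q w = .Gneg := ⟨v, hv, h1, h2⟩
      simp only [stdExt, hu, if_false, this]
      exact hok.rpos

theorem recolour (hc : IsColouring ok c) (v : M) {q : M → Colour}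
    (hq : Consistent ok c Set.univ q) : IsColouring ok (recolour c v q) := by
  have hq' := fun u w => hq u trivial w trivial
  refine ⟨fun a b => ?_, fun a b => ?_, fun x y z k => ?_⟩
  · by_cases ha : a = v <;> by_cases hb : b = v <;>
      simp [MultiTournament.recolour, ha, hb, hc.eq_none, eq_comm, Ne.symm]
  · by_cases ha : a = v <;> by_cases hb : b = v <;>
      simp [MultiTournament.recolour, ha, hb, hc.conv a b]
  · by_cases hx : x = v <;> by_cases hy : y = v <;> by_cases hz : z = v <;>
      simp only [MultiTournament.recolour, hx, hy, hz, if_true, if_false, Option.some.injEq,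
        reduceCtorEq, false_imp_iff, imp_true_iff, Colour.conv_eq_iff]
    · intro h1 h2 h3
      exact h3 ▸ (hq' y z).1 h1 h2
    · intro h1 h2 h3
      exact (hq' x z).2.1 h1 h2 k h3
    · intro h1 h2 h3
      have := (hq' x y).2.2 h1 h2
      rwa [h3, Colour.conv_conv] at this
    · exact hc.path x y z k

end IsColouring

/-! ### A countable colouring with the extension property -/

/-- Every consistent one-point type over a finite set is realised. -/
def HasExtension {M : Type*} (ok : Colour → Prop) (c : M → M → Option Colour) : Prop :=
  ∀ (W : Finset M) (q : M → Colour), Consistent ok c W q → ∃ v, ∀ w ∈ W, c v w = some (q w)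

open Classical in
/-- A colour function on `ℕ` coded by two finite sets. -/
noncomputable def codedType (P Q : Finset ℕ) (w : ℕ) : Colour :=
  if w ∈ P then (if w ∈ Q then .Rpos else .Rneg) else (if w ∈ Q then .Gpos else .Gneg)

theorem exists_codedType (W : Finset ℕ) (q : ℕ → Colour) :
    ∃ P Q, ∀ w ∈ W, codedType P Q w = q w := by
  classical
  refine ⟨W.filter fun w => q w = .Rpos ∨ q w = .Rneg,
    W.filter fun w => q w = .Rpos ∨ q w = .Gpos, fun w hw => ?_⟩
  cases h : q w <;> simp [codedType, hw, h]

/-- The enumeration of all one-point types `(W, P, Q)` over finite sets, each with infinitely many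
indices. -/
noncomputable def taskAt (n : ℕ) : Finset ℕ × Finset ℕ × Finset ℕ :=
  (Encodable.decode (Nat.unpair n).1).getD (∅, ∅, ∅)

theorem exists_taskAt (T : Finset ℕ × Finset ℕ × Finset ℕ) (m : ℕ) : ∃ n, m ≤ n ∧ taskAt n = T :=
  ⟨Nat.pair (Encodable.encode T) m, Nat.right_le_pair _ _, by simp [taskAt]⟩

open Classical in
/-- The finite stages of a universal colouring of `ℕ`. It starts with a linear order of `R`-edges;
step `n` changes the colours at the vertex `n` so as to realise the `n`-th one-point type, if this
type is consistent and lives on vertices below `n`. -/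
noncomputable def stage (ok : Colour → Prop) : ℕ → ℕ → ℕ → Option Colour
  | 0 => fun a b => if a = b then none else if a < b then some .Rpos else some .Rneg
  | n + 1 =>
    let T := taskAt n
    if Consistent ok (stage ok n) T.1 (codedType T.2.1 T.2.2) then
      recolour (stage ok n) n (stdExt (stage ok n) T.1 (codedType T.2.1 T.2.2))
    else stage ok n

theorem isColouring_stage {ok : Colour → Prop} (hok : IsPathRule ok) (n : ℕ) :
    IsColouring ok (stage ok n) := by
  induction n with
  | zero =>
    refine ⟨fun a b => ?_, fun a b => ?_, fun x y z k => ?_⟩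
    · simp only [stage]; split_ifs <;> simp_all
    · rcases lt_trichotomy a b with h | rfl | h
      · simp [stage, h, h.ne, h.ne', h.not_gt, Colour.conv]
      · simp [stage]
      · simp [stage, h, h.ne, h.ne', h.not_gt, Colour.conv]
    · simp only [stage]; split_ifs <;> simp
  | succ n ih =>
    simp only [stage]
    split_ifs with h
    · exact ih.recolour n (ih.consistent_stdExt hok h)
    · exact ih

theorem stage_eq {ok : Colour → Prop} {a b m n : ℕ} (ha : a < m) (hb : b < m) (hmn : m ≤ n) :
    stage ok n a b = stage ok m a b := by
  induction n, hmn using Nat.le_induction with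
  | base => rfl
  | succ n hmn ih =>
    rw [← ih]
    simp only [stage]
    split_ifs with h
    · simp [recolour, (ha.trans_le hmn).ne, (hb.trans_le hmn).ne]
    · rfl

/-- The limit of the stages. -/
noncomputable def limitColouring (ok : Colour → Prop) (a b : ℕ) : Option Colour :=
  stage ok (max a b + 1) a b

theorem limitColouring_eq {ok : Colour → Prop} {a b n : ℕ} (ha : a < n) (hb : b < n) :
    limitColouring ok a b = stage ok n a b :=
  (stage_eq (by omega) (by omega) (by omega)).symm

theorem isColouring_limitColouring {ok : Colour → Prop} (hok : IsPathRule ok) :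
    IsColouring ok (limitColouring ok) := by
  refine ⟨fun a b => (isColouring_stage hok _).eq_none a b, fun a b => ?_, fun x y z k => ?_⟩
  · rw [limitColouring, limitColouring, max_comm]
    exact (isColouring_stage hok _).conv a b
  · have hx : x < x + y + z + 1 := by omega
    have hy : y < x + y + z + 1 := by omega
    have hz : z < x + y + z + 1 := by omega
    rw [limitColouring_eq hx hy, limitColouring_eq hy hz, limitColouring_eq hx hz]
    exact (isColouring_stage hok _).path x y z k

theorem hasExtension_limitColouring {ok : Colour → Prop} :
    HasExtension ok (limitColouring ok) := by
  intro W q hq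
  obtain ⟨P, Q, hPQ⟩ := exists_codedType W q
  obtain ⟨n, hn, hT⟩ := exists_taskAt (W, P, Q) (W.sup id + 1)
  have hlt : ∀ w ∈ W, w < n := fun w hw => lt_of_lt_of_le
    (Nat.lt_succ_of_le (Finset.le_sup (f := id) hw)) hn
  have hcons : Consistent ok (stage ok n) W (codedType P Q) := by
    intro u hu v hv
    have := hq u hu v hv
    rwa [limitColouring_eq (hlt u hu) (hlt v hv), ← hPQ u hu, ← hPQ v hv] at this
  refine ⟨n, fun w hw => ?_⟩
  rw [limitColouring_eq (Nat.lt_succ_self n) ((hlt w hw).trans (Nat.lt_succ_self n))]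
  have hw' : w ∈ (W : Set ℕ) := hw
  simp [stage, hT, hcons, recolour, (hlt w hw).ne, stdExt, hw, hPQ w hw]

/-! ### Automorphisms of a generic colouring -/

/-- The colour-preserving permutations. -/
def colourAut {M : Type*} (c : M → M → Option Colour) : Subgroup (Equiv.Perm M) where
  carrier := {g | ∀ a b, c (g a) (g b) = c a b}
  mul_mem' hg hh a b := (hg _ _).trans (hh a b)
  one_mem' _ _ := rfl
  inv_mem' {g} hg a b := by simpa using (hg (g⁻¹ a) (g⁻¹ b)).symm

/-- The colour-preserving permutations fixing every point of `K`. -/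
def fixer {M : Type*} (c : M → M → Option Colour) (K : Finset M) : Subgroup (Equiv.Perm M) where
  carrier := {g | g ∈ colourAut c ∧ ∀ x ∈ K, g x = x}
  mul_mem' hg hh := ⟨mul_mem hg.1 hh.1, fun x hx => by
    rw [Equiv.Perm.mul_apply, hh.2 x hx, hg.2 x hx]⟩
  one_mem' := ⟨one_mem _, fun _ _ => rfl⟩
  inv_mem' hg := ⟨inv_mem hg.1, fun x hx => by rw [Equiv.Perm.inv_eq_iff_eq, hg.2 x hx]⟩

/-- A colouring obeying the path rule `ok` that has the extension property and is homogeneous: the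
colourings arising from the Fraïssé limit. -/
structure IsGeneric {M : Type*} (ok : Colour → Prop) (c : M → M → Option Colour) : Prop
    extends IsColouring ok c where
  rule : IsPathRule ok
  extension : HasExtension ok c
  homogeneous : ∀ (K : Finset M) (φ : M → M), (∀ a ∈ K, ∀ b ∈ K, c (φ a) (φ b) = c a b) →
    ∃ g ∈ colourAut c, ∀ a ∈ K, g a = φ a

/-- `Far c v w`: the points `v ≠ w` are joined by an `R`-edge. As the path rule is about `G`-edges
only, such pairs are harmless in amalgamations. -/
def Far {M : Type*} (c : M → M → Option Colour) (v w : M) : Prop :=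
  c v w = some .Rpos ∨ c v w = some .Rneg

/-- The permutation `p` moves, within every type over a finite set, some point `y` in such a way
that the colour of `(y, p y)` lies in `C`. -/
def Moves {M : Type*} (c : M → M → Option Colour) (C : Set Colour) (p : Equiv.Perm M) : Prop :=
  ∀ (K : Finset M), ∀ x ∉ K, ∃ y, (∀ k ∈ K, c y k = c x k) ∧ ∃ k ∈ C, c y (p y) = some k

section

variable {M : Type*} {ok : Colour → Prop} {c : M → M → Option Colour}

theorem fixer_anti {K L : Finset M} (h : K ⊆ L) : fixer c L ≤ fixer c K :=
  fun _ ha => ⟨ha.1, fun x hx => ha.2 x (h hx)⟩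

theorem inv_apply_of_mem_fixer {K : Finset M} {a : Equiv.Perm M} (ha : a ∈ fixer c K) {x : M}
    (hx : x ∈ K) : a⁻¹ x = x := (inv_mem ha).2 x hx

theorem conj_mem_colourAut {a p : Equiv.Perm M} (ha : a ∈ colourAut c) (hp : p ∈ colourAut c) :
    a * p * a⁻¹ ∈ colourAut c := mul_mem (mul_mem ha hp) (inv_mem ha)

/-- Conjugating over `K` does not change the part of the permutation that maps `K` to `K`. -/
theorem conj_apply_of_mem {K : Finset M} {a p : Equiv.Perm M} (ha : a ∈ fixer c K) {x : M}
    (hx : x ∈ K) (hpx : p x ∈ K) : (a * p * a⁻¹) x = p x := by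
  rw [Equiv.Perm.mul_apply, Equiv.Perm.mul_apply, inv_apply_of_mem_fixer ha hx, ha.2 _ hpx]

theorem conj_conj (a b p : Equiv.Perm M) :
    b * (a * p * a⁻¹) * b⁻¹ = (b * a) * p * (b * a)⁻¹ := by group

theorem conj_inv' (a p : Equiv.Perm M) : a * p⁻¹ * a⁻¹ = (a * p * a⁻¹)⁻¹ := by group

theorem colour_inv_apply {p : Equiv.Perm M} (hp : p ∈ colourAut c) (x y : M) :
    c x (p⁻¹ y) = c (p x) y := by
  simpa using (hp x (p⁻¹ y)).symm

namespace Far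

theorem ne (hc : IsColouring ok c) {v w : M} (h : Far c v w) : v ≠ w := by
  rcases h with h | h <;> exact hc.ne h

theorem symm (hc : IsColouring ok c) {v w : M} (h : Far c v w) : Far c w v := by
  rcases h with h | h
  · exact .inr (hc.swap h)
  · exact .inl (hc.swap h)

theorem of_eq {v w v' w' : M} (h : Far c v w) (he : c v' w' = c v w) : Far c v' w' := by
  rwa [Far, he]

theorem not_gpos {v w : M} (h : Far c v w) : c v w ≠ some .Gpos := by
  rcases h with h | h <;> simp [h]

end Far

theorem Moves.conj {C : Set Colour} {a p : Equiv.Perm M} (ha : a ∈ colourAut c)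
    (h : Moves c C p) : Moves c C (a * p * a⁻¹) := by
  classical
  intro K x hx
  obtain ⟨y, hy, k, hk, hyk⟩ := h (K.image (a⁻¹ : Equiv.Perm M)) (a⁻¹ x) (by simpa using hx)
  refine ⟨a y, fun u hu => ?_, k, hk, by simpa [ha _ _] using hyk⟩
  have := hy _ (Finset.mem_image_of_mem _ hu)
  rwa [inv_mem ha, colour_inv_apply ha] at this

theorem Moves.inv (hc : IsColouring ok c) {C : Set Colour} (hC : ∀ k ∈ C, k.conv ∈ C)
    {p : Equiv.Perm M} (hp : p ∈ colourAut c) (h : Moves c C p) : Moves c C p⁻¹ := by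
  classical
  intro K x hx
  obtain ⟨y, hy, k, hk, hyk⟩ := h (K.image (p⁻¹ : Equiv.Perm M)) (p⁻¹ x) (by simpa using hx)
  refine ⟨p y, fun u hu => ?_, k.conv, hC k hk, by simpa using hc.swap hyk⟩
  have := hy _ (Finset.mem_image_of_mem _ hu)
  rwa [inv_mem hp, colour_inv_apply hp] at this

namespace IsGeneric

variable (hM : IsGeneric ok c)
include hM

/-- A type over `K` has a realisation in prioritised position to any finite set. -/
theorem exists_type_eq_and_std (K W : Finset M) {x : M} (hx : x ∉ K) :
    ∃ y, (∀ k ∈ K, c y k = c x k) ∧ ∀ w ∈ W, w ∉ K →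
      ((∃ k ∈ K, c w k = some .Gpos ∧ c k x = some .Gpos) → c y w = some .Rneg) ∧
      ((¬ ∃ k ∈ K, c w k = some .Gpos ∧ c k x = some .Gpos) → c y w = some .Rpos) := by
  classical
  have hK : ∀ w ∈ K, c x w = some ((c x w).getD .Rpos) := fun w hw => by
    obtain ⟨k, hk⟩ := hM.exists_eq (a := x) (b := w) (by rintro rfl; exact hx hw)
    simp [hk]
  obtain ⟨y, hy⟩ := hM.extension (K ∪ W) (stdExt c K fun w => (c x w).getD .Rpos)
    fun u _ v _ => hM.consistent_stdExt hM.rule (hM.consistent_of_type (W := K) x hK)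
      u trivial v trivial
  refine ⟨y, fun k hk => ?_, fun w hw hwK => ?_⟩
  · rw [hy k (by simp [hk]), hK k hk]
    simp [stdExt, hk]
  · have : (∃ k ∈ K, c w k = some .Gpos ∧ (c x k).getD .Rpos = .Gneg) ↔
        ∃ k ∈ K, c w k = some .Gpos ∧ c k x = some .Gpos := by
      refine exists_congr fun k => and_congr_right fun hk => and_congr_right fun _ => ?_
      rw [hM.swap_iff, hK k hk]
      simp [Colour.conv]
    rw [hy w (by simp [hw])]
    simp only [stdExt, Finset.mem_coe, hwK, if_false, this]
    constructor <;> intro h <;> simp [h]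

theorem exists_type_eq_and_far (K W : Finset M) {x : M} (hx : x ∉ K) :
    ∃ y, (∀ k ∈ K, c y k = c x k) ∧ ∀ w ∈ W, w ∉ K → Far c y w := by
  obtain ⟨y, hy, hy'⟩ := hM.exists_type_eq_and_std K W hx
  refine ⟨y, hy, fun w hw hwK => ?_⟩
  by_cases h : ∃ k ∈ K, c w k = some .Gpos ∧ c k x = some .Gpos
  · exact .inr ((hy' w hw hwK).1 h)
  · exact .inl ((hy' w hw hwK).2 h)

/-- Points of the same type over `K` are conjugate over `K`. -/
theorem exists_mem_fixer (K : Finset M) {x y : M} (hx : x ∉ K) (h : ∀ k ∈ K, c y k = c x k) :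
    ∃ a ∈ fixer c K, a x = y := by
  classical
  have hne : ∀ k ∈ K, k ≠ x := fun k hk => by rintro rfl; exact hx hk
  obtain ⟨g, hg, hgK⟩ := hM.homogeneous (insert x K) (fun z => if z = x then y else z) (by
    intro a ha b hb
    rw [Finset.mem_insert] at ha hb
    rcases ha with rfl | ha <;> rcases hb with rfl | hb
    · simp [hM.self]
    · simp [hne b hb, h b hb]
    · simp only [hne a ha, if_false, if_true]
      rw [hM.conv y a, h a ha, ← hM.conv]
    · simp [hne a ha, hne b hb])
  refine ⟨g, ⟨hg, fun k hk => ?_⟩, ?_⟩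
  · simpa [hne k hk] using hgK k (by simp [hk])
  · simpa using hgK x (by simp)

/-- Amalgamation inside `M`: a finite set `U` can be moved over `K` into prioritised position to a
finite set `W`. -/
theorem exists_fixer_std (K U W : Finset M) :
    ∃ a ∈ fixer c K, ∀ u ∈ U, u ∉ K → ∀ w ∈ W, w ∉ K →
      ((∃ k ∈ K, c w k = some .Gpos ∧ c k u = some .Gpos) → c (a u) w = some .Rneg) ∧
      ((¬ ∃ k ∈ K, c w k = some .Gpos ∧ c k u = some .Gpos) → c (a u) w = some .Rpos) := by
  classical
  induction U using Finset.induction_on with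
  | empty => exact ⟨1, one_mem _, by simp⟩
  | insert v U hv ih =>
    obtain ⟨a, ha, haU⟩ := ih
    by_cases hvK : v ∈ K
    · refine ⟨a, ha, fun u hu huK => ?_⟩
      rcases Finset.mem_insert.1 hu with rfl | hu
      · exact absurd hvK huK
      · exact haU u hu huK
    have hfar : ∀ u ∈ U, u ∉ K → ∀ w ∈ W, w ∉ K → Far c (a u) w := fun u hu huK w hw hwK => by
      by_cases h : ∃ k ∈ K, c w k = some .Gpos ∧ c k u = some .Gpos
      · exact .inr ((haU u hu huK w hw hwK).1 h)
      · exact .inl ((haU u hu huK w hw hwK).2 h)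
    have hav : a v ∉ K ∪ U.image a := by
      simp only [Finset.mem_union, Finset.mem_image, EmbeddingLike.apply_eq_iff_eq,
        exists_eq_right, hv, or_false]
      exact fun h => hvK (by rwa [← a.injective ((ha.2 _ h))])
    obtain ⟨y, hy, hyW⟩ := hM.exists_type_eq_and_std _ W hav
    obtain ⟨b, hb, hbv⟩ := hM.exists_mem_fixer _ hav hy
    have hab : ∀ u ∈ U, (b * a) u = a u := fun u hu =>
      hb.2 _ (Finset.mem_union_right _ (Finset.mem_image_of_mem _ hu))
    have hW : ∀ w ∈ W, w ∉ K → w ∉ U.image a := fun w hw hwK hwU => by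
      obtain ⟨u, hu, rfl⟩ := Finset.mem_image.1 hwU
      by_cases huK : u ∈ K
      · exact hwK (by rwa [ha.2 u huK])
      · exact (hfar u hu huK _ hw hwK).ne hM.toIsColouring rfl
    refine ⟨b * a, mul_mem (fixer_anti Finset.subset_union_left hb) ha,
      fun u hu huK w hw hwK => ?_⟩
    rcases Finset.mem_insert.1 hu with rfl | hu
    · have hiff : (∃ k ∈ K ∪ U.image a, c w k = some .Gpos ∧ c k (a u) = some .Gpos) ↔
          ∃ k ∈ K, c w k = some .Gpos ∧ c k u = some .Gpos := by
        constructor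
        · rintro ⟨k, hk, h1, h2⟩
          by_cases hkK : k ∈ K
          · exact ⟨k, hkK, h1, by rw [← h2, ← ha.1 k u, ha.2 k hkK]⟩
          · obtain ⟨k', hk', rfl⟩ := Finset.mem_image.1 ((Finset.mem_union.1 hk).resolve_left hkK)
            refine absurd h1 ((hfar k' hk' (fun h => hkK ?_) w hw hwK).symm
              hM.toIsColouring).not_gpos
            rwa [ha.2 k' h]
        · rintro ⟨k, hk, h1, h2⟩
          exact ⟨k, Finset.mem_union_left _ hk, h1, by rw [← h2, ← ha.1 k u, ha.2 k hk]⟩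
      rw [Equiv.Perm.mul_apply, hbv, ← hiff]
      exact hyW w hw (by simpa [hwK] using hW w hw hwK)
    · rw [hab u hu]
      exact haU u hu huK w hw hwK

theorem exists_fixer_far (K U W : Finset M) :
    ∃ a ∈ fixer c K, ∀ u ∈ U, u ∉ K → ∀ w ∈ W, w ∉ K → Far c (a u) w := by
  obtain ⟨a, ha, h⟩ := hM.exists_fixer_std K U W
  refine ⟨a, ha, fun u hu huK w hw hwK => ?_⟩
  by_cases h' : ∃ k ∈ K, c w k = some .Gpos ∧ c k u = some .Gpos
  · exact .inr ((h u hu huK w hw hwK).1 h')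
  · exact .inl ((h u hu huK w hw hwK).2 h')

/-- The key step in building conjugates. If `p` moves some point of every type, then, after
conjugating `p` over `K`, the image `z` of a given `x ∉ K` is joined by `R`-edges to all points
of `W` for which this is conceivable, and to those `k ∈ K` whose relation to `z` is not already
determined by `K`. -/
theorem exists_conj_apply_far {C : Set Colour} {p : Equiv.Perm M}
    (hp : p ∈ colourAut c) (hpC : Moves c C p) (K W : Finset M) {x : M} (hx : x ∉ K) :
    ∃ a ∈ fixer c K, (∃ k ∈ C, c x ((a * p * a⁻¹) x) = some k) ∧ (a * p * a⁻¹) x ∉ K ∧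
      (∀ w ∈ W, w ∉ K → w ≠ x → Far c ((a * p * a⁻¹) x) w) ∧
      ∀ k ∈ K, p⁻¹ k ∉ K → Far c ((a * p * a⁻¹) x) k := by
  classical
  set K' := K.image (p⁻¹ : Equiv.Perm M) with hK'
  have hmem : ∀ z, z ∈ K' ↔ p z ∈ K := fun z => by
    rw [hK', Finset.mem_image]
    exact ⟨by rintro ⟨k, hk, rfl⟩; simpa using hk, fun h => ⟨p z, h, by simp⟩⟩
  obtain ⟨y₀, hy₀, hy₀'⟩ := hM.exists_type_eq_and_far K K' hx
  have hy₀K : y₀ ∉ K := hM.not_mem_of_type_eq (K := K) hx hy₀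
  have hy₀U : y₀ ∉ K ∪ K' := by
    intro h
    rcases Finset.mem_union.1 h with h | h
    · exact hy₀K h
    · exact (hy₀' _ h hy₀K).ne hM.toIsColouring rfl
  obtain ⟨y, hy, k, hk, hyk⟩ := hpC (K ∪ K') y₀ hy₀U
  have hyU : y ∉ K ∪ K' := hM.not_mem_of_type_eq (K := ↑(K ∪ K')) hy₀U hy
  have hyK : ∀ k ∈ K, c y k = c x k := fun k hk => by
    rw [hy k (Finset.mem_union_left _ hk), hy₀ k hk]
  -- Move `y` to `x` over `K`, and then the image of `x` away from `W` over `K ∪ {x}`.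
  obtain ⟨b, hb, hbx⟩ := hM.exists_mem_fixer K (x := y)
    (fun h => hyU (Finset.mem_union_left _ h)) (fun k hk => (hyK k hk).symm)
  have hpy : p y ∉ K := fun h => hyU (Finset.mem_union_right _ ((hmem y).2 h))
  have hbpy : b (p y) ∉ insert x K := by
    rw [Finset.mem_insert]
    rintro (h | h)
    · rw [← hbx] at h
      exact hM.ne hyk (b.injective h).symm
    · exact hpy (by rwa [← b.injective (hb.2 _ h)])
  obtain ⟨d, hd, hdW⟩ := hM.exists_fixer_far (insert x K) {b (p y)} W
  have hdK := fixer_anti (Finset.subset_insert x K) hd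
  have hz : ((d * b) * p * (d * b)⁻¹) x = d (b (p y)) := by
    have h1 : d⁻¹ x = x := inv_apply_of_mem_fixer hd (Finset.mem_insert_self _ _)
    have h2 : b⁻¹ x = y := by rw [Equiv.Perm.inv_eq_iff_eq, hbx]
    simp only [mul_inv_rev, Equiv.Perm.mul_apply, h1, h2]
  have hcK : ∀ k ∈ K, c (d (b (p y))) k = c y (p⁻¹ k) := fun k hk => by
    rw [colour_inv_apply hp, ← hb.1 (p y) k, hb.2 k hk, ← hd.1 (b (p y)) k, hdK.2 k hk]
  refine ⟨d * b, mul_mem hdK hb, ?_, ?_, ?_, ?_⟩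
  · refine ⟨k, hk, ?_⟩
    have h1 := hb.1 y (p y)
    have h2 := hd.1 x (b (p y))
    rw [hd.2 x (Finset.mem_insert_self _ _)] at h2
    rw [hbx] at h1
    rw [hz, h2, h1, hyk]
  · rw [hz]
    intro h
    have h1 := d.injective (hdK.2 _ h)
    rw [h1] at h
    exact hbpy (Finset.mem_insert_of_mem h)
  · intro w hw hwK hwx
    rw [hz]
    exact hdW _ (Finset.mem_singleton_self _) hbpy w hw (by simp [hwK, hwx])
  · intro k hk hk'
    rw [hz]
    have h1 : p⁻¹ k ∈ K' := Finset.mem_image_of_mem _ hk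
    exact (hy₀' _ h1 hk').of_eq ((hcK k hk).trans (hy _ (Finset.mem_union_right _ h1)))

/-- A colour-preserving permutation other than the identity fixes no type over a finite set
pointwise. -/
theorem moves_univ {g : Equiv.Perm M} (hg : g ∈ colourAut c) (hg1 : g ≠ 1) :
    Moves c Set.univ g := by
  classical
  intro K x hx
  obtain ⟨u, hu⟩ : ∃ u, g u ≠ u := by
    by_contra! h
    exact hg1 (Equiv.ext h)
  -- A moved point `v` such that `v` and `g v` are joined to `K` by `R`-edges only.
  obtain ⟨v, hv⟩ := hM.extension (insert u (insert (g u) (K ∪ K.image (g⁻¹ : Equiv.Perm M))))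
    (fun w => if w = g u then .Rneg else .Rpos) (by
      intro a _ b _
      refine ⟨fun h => ?_, fun h => ?_, fun _ h => ?_⟩ <;> dsimp only at h <;> split_ifs at h)
  have hvK : ∀ k ∈ K, Far c v k := fun k hk => by
    have := hv k (by simp [hk])
    split_ifs at this
    · exact .inr this
    · exact .inl this
  have hgvK : ∀ k ∈ K, Far c (g v) k := fun k hk => by
    have := hv (g⁻¹ k) (Finset.mem_insert_of_mem (Finset.mem_insert_of_mem
      (Finset.mem_union_right _ (Finset.mem_image_of_mem _ hk))))
    rw [colour_inv_apply hg] at this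
    split_ifs at this
    · exact .inr this
    · exact .inl this
  have hvu : c v u = some .Rpos := by simpa [hu.symm] using hv u (by simp)
  have hvgu : c v (g u) = some .Rneg := by simpa using hv (g u) (by simp)
  have hgv : g v ≠ v := fun h => by
    have := hg v u
    rw [h, hvu, hvgu] at this
    cases this
  have hvnot : v ∉ K := fun h => (hvK v h).ne hM.toIsColouring rfl
  have hgvnot : g v ∉ K := fun h => (hgvK _ h).ne hM.toIsColouring rfl
  have hK : ∀ w ∈ K, c x w = some ((c x w).getD .Rpos) := fun w hw => by
    obtain ⟨k, hk⟩ := hM.exists_eq (a := x) (b := w) (by rintro rfl; exact hx hw)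
    simp [hk]
  have hcons := hM.consistent_of_type (W := K) x hK
  -- A point of the given type whose edges to `v` and `g v` have opposite directions is moved.
  let q : M → Colour := fun w => if w = v then .Rpos else if w = g v then .Rneg else
    (c x w).getD .Rpos
  have hqK : ∀ w ∈ K, q w = (c x w).getD .Rpos := fun w hw => by
    have h1 : w ≠ v := by rintro rfl; exact hvnot hw
    have h2 : w ≠ g v := by rintro rfl; exact hgvnot hw
    simp [q, h1, h2]
  have hmemK : ∀ w ∈ insert v (insert (g v) K), (q w = .Gpos ∨ q w = .Gneg) → w ∈ K := by
    intro w hw hq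
    rcases Finset.mem_insert.1 hw with rfl | hw
    · simp [q] at hq
    rcases Finset.mem_insert.1 hw with rfl | hw
    · simp [q, hgv] at hq
    exact hw
  have hmemK' : ∀ w ∈ insert v (insert (g v) K), ∀ k ∈ K,
      (c w k = some .Gpos ∨ c k w = some .Gpos) → w ∈ K := by
    intro w hw k hk hq
    rcases Finset.mem_insert.1 hw with rfl | hw
    · exact absurd hq (not_or.2 ⟨(hvK k hk).not_gpos,
        ((hvK k hk).symm hM.toIsColouring).not_gpos⟩)
    rcases Finset.mem_insert.1 hw with rfl | hw
    · exact absurd hq (not_or.2 ⟨(hgvK k hk).not_gpos,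
        ((hgvK k hk).symm hM.toIsColouring).not_gpos⟩)
    exact hw
  obtain ⟨y, hy⟩ := hM.extension (insert v (insert (g v) K)) q (by
    intro a ha b hb
    refine ⟨fun h1 h2 => ?_, fun h1 h2 => ?_, fun h1 h2 => ?_⟩
    · have haK := hmemK a ha (.inl h1)
      have hbK := hmemK' b hb a haK (.inr h2)
      rw [hqK a haK] at h1
      rw [hqK b hbK]
      exact (hcons a haK b hbK).1 h1 h2
    · have haK := hmemK a ha (.inr h1)
      have hbK := hmemK b hb (.inl h2)
      rw [hqK a haK] at h1
      rw [hqK b hbK] at h2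
      exact (hcons a haK b hbK).2.1 h1 h2
    · have hbK := hmemK b hb (.inr h2)
      have haK := hmemK' a ha b hbK (.inl h1)
      rw [hqK b hbK] at h2
      rw [hqK a haK]
      exact (hcons a haK b hbK).2.2 h1 h2)
  refine ⟨y, fun k hk => ?_, ?_⟩
  · rw [hy k (by simp [hk]), hqK k hk, ← hK k hk]
  · have h1 : c y v = some .Rpos := by simpa [q] using hy v (by simp)
    have h2 : c y (g v) = some .Rneg := by simpa [q, hgv] using hy (g v) (by simp)
    have : y ≠ g y := fun h => by
      have h3 := hg y v
      rw [← h, h1, h2] at h3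
      cases h3
    obtain ⟨k, hk⟩ := hM.exists_eq this
    exact ⟨k, trivial, hk⟩

end IsGeneric

end

/-! ### Limits of automorphisms and a commutator with large displacement -/

section

variable {M : Type*} {ok : Colour → Prop} {c : M → M → Option Colour}

/-- A sequence of automorphisms whose inverses stabilise on an increasing sequence of finite sets
converges, provided that these sets exhaust both the domain and the range. -/
theorem exists_limit_mem_colourAut (h : ℕ → Equiv.Perm M) (F : ℕ → Finset M)
    (hh : ∀ n, h n ∈ colourAut c) (hF : ∀ n, F n ⊆ F (n + 1))
    (hs : ∀ n, ∀ x ∈ F n, (h (n + 1))⁻¹ x = (h n)⁻¹ x)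
    (hex : ∀ x, ∃ n, x ∈ F n ∧ h n x ∈ F n) :
    ∃ l ∈ colourAut c, ∀ n, ∀ x ∈ F n, l⁻¹ x = (h n)⁻¹ x := by
  have hmono : Monotone F := monotone_nat_of_le_succ hF
  have hstab : ∀ m n, m ≤ n → ∀ x ∈ F m, (h n)⁻¹ x = (h m)⁻¹ x := fun m n hmn => by
    induction n, hmn using Nat.le_induction with
    | base => exact fun _ _ => rfl
    | succ n hmn ih => exact fun x hx => by rw [hs n x (hmono hmn hx), ih x hx]
  have hstab' : ∀ m n, m ≤ n → ∀ x, h m x ∈ F m → h n x = h m x := fun m n hmn x hx => by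
    have := hstab m n hmn _ hx
    rw [Equiv.Perm.inv_eq_iff_eq.2 (rfl : h m x = h m x)] at this
    rw [← Equiv.Perm.eq_inv_iff_eq, this]
  choose N hN using hex
  have hto : ∀ x n, N x ≤ n → h n x = h (N x) x := fun x n hn => hstab' _ _ hn x (hN x).2
  have hinv : ∀ x n, N x ≤ n → (h n)⁻¹ x = (h (N x))⁻¹ x := fun x n hn =>
    hstab _ _ hn x (hN x).1
  let l : Equiv.Perm M :=
    { toFun := fun x => h (N x) x
      invFun := fun x => (h (N x))⁻¹ x
      left_inv := fun x => by
        have h1 := hinv (h (N x) x) _ (le_max_right (N x) (N (h (N x) x)))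
        change (h (N (h (N x) x)))⁻¹ (h (N x) x) = x
        rw [← h1, Equiv.Perm.inv_eq_iff_eq]
        exact (hto x _ (le_max_left _ _)).symm
      right_inv := fun x => by
        have h1 := hto ((h (N x))⁻¹ x) _ (le_max_right (N x) (N ((h (N x))⁻¹ x)))
        change h (N ((h (N x))⁻¹ x)) ((h (N x))⁻¹ x) = x
        rw [← h1, ← Equiv.Perm.eq_inv_iff_eq]
        exact (hinv x _ (le_max_left _ _)).symm }
  refine ⟨l, fun a b => ?_, fun n x hx => ?_⟩
  · change c (h (N a) a) (h (N b) b) = _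
    rw [← hto a _ (le_max_left (N a) (N b)), ← hto b _ (le_max_right (N a) (N b))]
    exact hh _ a b
  · change (h (N x))⁻¹ x = _
    rw [← hinv x _ (le_max_right n (N x)), hstab n _ (le_max_left _ _) x hx]

/-- The colours `R⁺` and `R⁻`. -/
def redColours : Set Colour := {.Rpos, .Rneg}

theorem exists_mem_redColours_iff {v w : M} :
    (∃ k ∈ redColours, c v w = some k) ↔ Far c v w := by
  simp [redColours, Far]

theorem conv_mem_redColours : ∀ k ∈ redColours, k.conv ∈ redColours := by
  simp [redColours, Colour.conv]

/-- If a nontrivial automorphism `g` is given, then for sufficiently generic `h` the commutator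
`g⁻¹ (h g h⁻¹)` moves some point of every type along an `R`-edge. -/
theorem IsGeneric.exists_moves_redColours (hM : IsGeneric ok c) [Countable M] {g : Equiv.Perm M}
    (hg : g ∈ colourAut c) (hg1 : g ≠ 1) :
    ∃ h ∈ colourAut c, Moves c redColours (g⁻¹ * (h * g * h⁻¹)) := by
  classical
  have hne : Nonempty M := by
    by_contra hempty
    rw [not_nonempty_iff] at hempty
    exact hg1 (Subsingleton.elim _ _)
  obtain ⟨e, he⟩ := exists_surjective_nat M
  have : Nonempty (Finset M × M) := inferInstance
  obtain ⟨t, ht⟩ := exists_surjective_nat (Finset M × M)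
  -- One step meets the requirement for one type and puts one point into the domain and range.
  have step : ∀ (n : ℕ) (s : colourAut c × Finset M), ∃ s' : colourAut c × Finset M,
      s.2 ⊆ s'.2 ∧ (∀ x ∈ s.2, (s'.1 : Equiv.Perm M)⁻¹ x = (s.1 : Equiv.Perm M)⁻¹ x) ∧
      (e n ∈ s'.2 ∧ s'.1.1 (e n) ∈ s'.2) ∧
      ((t n).2 ∉ (t n).1 → ∃ y z, y ∈ s'.2 ∧ z ∈ s'.2 ∧ (s'.1.1 * g * s'.1.1⁻¹) y = z ∧
        (∀ k ∈ (t n).1, c y k = c (t n).2 k) ∧ Far c (g⁻¹ z) y) := by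
    rintro n ⟨⟨h, hh⟩, F⟩
    by_cases hx : (t n).2 ∈ (t n).1
    · exact ⟨⟨⟨h, hh⟩, F ∪ {e n, h (e n)}⟩, Finset.subset_union_left, fun _ _ => rfl,
        by simp, fun h => absurd hx h⟩
    set K := F ∪ (t n).1 with hK
    set T := K ∪ K.image (g⁻¹ : Equiv.Perm M) with hT
    have hKT : K ⊆ T := Finset.subset_union_left
    obtain ⟨x', hx', hx'T⟩ := hM.exists_type_eq_and_far (t n).1 T hx
    have hx't : x' ∉ (t n).1 := hM.not_mem_of_type_eq (K := ↑(t n).1) hx hx'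
    have hx'n : x' ∉ T := fun h' =>
      (hx'T x' h' hx't).ne hM.toIsColouring rfl
    obtain ⟨y, hy, k, -, hyk⟩ := hM.moves_univ hg hg1 T x' hx'n
    have hyT : y ∉ T := hM.not_mem_of_type_eq (K := ↑T) hx'n hy
    have hgyK : g y ∉ K := fun h' => hyT (Finset.mem_union_right _
      (Finset.mem_image.2 ⟨g y, h', by simp⟩))
    have hyt : ∀ k ∈ (t n).1, c y k = c (t n).2 k := fun k hk => by
      rw [hy k (hKT (Finset.mem_union_right _ hk)), hx' k hk]
    obtain ⟨a, ha, -, -, hW, -⟩ := hM.exists_conj_apply_far (conj_mem_colourAut hh hg)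
      ((hM.moves_univ hg hg1).conj hh) K {g y} (x := y) (fun h' => hyT (hKT h'))
    refine ⟨⟨⟨a * h, mul_mem ha.1 hh⟩,
      F ∪ {e n, (a * h) (e n), y, (a * (h * g * h⁻¹) * a⁻¹) y}⟩, Finset.subset_union_left,
      fun x hx => ?_, by simp, fun _ => ⟨y, (a * (h * g * h⁻¹) * a⁻¹) y, by simp, by simp, ?_, hyt, ?_⟩⟩
    · have := inv_apply_of_mem_fixer ha (Finset.mem_union_left (t n).1 hx)
      rw [mul_inv_rev, Equiv.Perm.mul_apply, this]
    · rw [conj_conj]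
    · refine (hW (g y) (Finset.mem_singleton_self _) hgyK (hM.ne hyk).symm).of_eq ?_
      rw [hM.conv y, colour_inv_apply hg, ← hM.conv]
  choose f hf using step
  let s : ℕ → colourAut c × Finset M := fun n => Nat.rec (1, ∅) f n
  have hs : ∀ n, s (n + 1) = f n (s n) := fun _ => rfl
  obtain ⟨l, hl, hls⟩ := exists_limit_mem_colourAut (c := c) (fun n => (s n).1)
    (fun n => (s n).2) (fun n => (s n).1.2) (fun n => by rw [hs]; exact (hf n _).1)
    (fun n => by rw [hs]; exact (hf n _).2.1) (fun x => by
      obtain ⟨n, rfl⟩ := he x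
      exact ⟨n + 1, by rw [hs]; exact (hf n _).2.2.1⟩)
  refine ⟨l, hl, fun K x hx => ?_⟩
  obtain ⟨n, hn⟩ := ht (K, x)
  have h1 := (hf n (s n)).2.2.2
  rw [hn, ← hs] at h1
  obtain ⟨y, z, hy, hz, hyz, hyK, hfar⟩ := h1 hx
  have hlz : (l * g * l⁻¹) y = z := by
    have h2 := hls (n + 1) y hy
    have h3 := hls (n + 1) z hz
    simp only [Equiv.Perm.mul_apply] at hyz ⊢
    rw [← Equiv.Perm.eq_inv_iff_eq] at hyz ⊢
    rw [h2, h3, hyz]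
  refine ⟨y, hyK, exists_mem_redColours_iff.2 ?_⟩
  rw [Equiv.Perm.mul_apply, hlz]
  exact hfar.symm hM.toIsColouring

end

/-! ### Chains of finite sets and their extension -/

/-- An automorphism that moves, within every type over a finite set, some point along
an `R`-edge. -/
structure IsMover {M : Type*} (c : M → M → Option Colour) (p : Equiv.Perm M) : Prop where
  mem : p ∈ colourAut c
  moves : Moves c redColours p

/-- `p'` is conjugate to `p` by an automorphism fixing `F` pointwise. -/
def ConjOver {M : Type*} (c : M → M → Option Colour) (F : Finset M) (p p' : Equiv.Perm M) : Prop :=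
  ∃ a ∈ fixer c F, p' = a * p * a⁻¹

/-- A chain of finite sets `Y₀ → Y₁ → Y₂ → Y₃ → Y₄`, mapped bijectively by `p₁, p₂, p₃, p₄`, each
of which contains `F`, and whose only overlaps outside `F` are, essentially, those of
adjacent members. (Overlaps of adjacent members cannot be avoided if, for example, `p₁` has
cycles of length two; the ends `Y₀` and `Y₄` may overlap arbitrarily.) -/
structure IsChain {M : Type*} (c : M → M → Option Colour) (F Y₀ Y₁ Y₂ Y₃ Y₄ : Finset M)
    (p₁ p₂ p₃ p₄ : Equiv.Perm M) : Prop where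
  mover₁ : IsMover c p₁
  mover₂ : IsMover c p₂
  mover₃ : IsMover c p₃
  mover₄ : IsMover c p₄
  sub₀ : F ⊆ Y₀
  sub₁ : F ⊆ Y₁
  sub₂ : F ⊆ Y₂
  sub₃ : F ⊆ Y₃
  sub₄ : F ⊆ Y₄
  map₁ : ∀ x, p₁ x ∈ Y₁ ↔ x ∈ Y₀
  map₂ : ∀ x, p₂ x ∈ Y₂ ↔ x ∈ Y₁
  map₃ : ∀ x, p₃ x ∈ Y₃ ↔ x ∈ Y₂
  map₄ : ∀ x, p₄ x ∈ Y₄ ↔ x ∈ Y₃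
  inter₀₂ : ∀ x ∈ Y₀, x ∈ Y₂ → x ∈ F
  inter₁₃ : ∀ x ∈ Y₁, x ∈ Y₃ → x ∈ F
  inter₂₄ : ∀ x ∈ Y₂, x ∈ Y₄ → x ∈ F
  inter₀₃ : ∀ x ∈ Y₀, x ∈ Y₃ → x ∈ Y₄
  inter₁₄ : ∀ x ∈ Y₁, x ∈ Y₄ → x ∈ Y₀

section

variable {M : Type*} {ok : Colour → Prop} {c : M → M → Option Colour}

theorem perm_apply_inv (p : Equiv.Perm M) (x : M) : p (p⁻¹ x) = x := p.apply_symm_apply x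

theorem perm_inv_apply (p : Equiv.Perm M) (x : M) : p⁻¹ (p x) = x := p.symm_apply_apply x

theorem apply_mem_iff_of_mem_fixer {K S : Finset M} {a : Equiv.Perm M} (ha : a ∈ fixer c K)
    (hS : S ⊆ K) {x : M} : a x ∈ S ↔ x ∈ S := by
  refine ⟨fun hx => ?_, fun hx => by rwa [ha.2 x (hS hx)]⟩
  rwa [a.injective (ha.2 _ (hS hx))] at hx

theorem mem_image_perm_iff [DecidableEq M] {S : Finset M} {a : Equiv.Perm M} {x : M} :
    x ∈ S.image a ↔ a⁻¹ x ∈ S := by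
  rw [Finset.mem_image]
  exact ⟨by rintro ⟨y, hy, rfl⟩; simpa using hy, fun h => ⟨_, h, by simp⟩⟩

theorem IsMover.conj {a p : Equiv.Perm M} (hp : IsMover c p) (ha : a ∈ colourAut c) :
    IsMover c (a * p * a⁻¹) :=
  ⟨conj_mem_colourAut ha hp.mem, hp.moves.conj ha⟩

theorem IsMover.inv (hc : IsColouring ok c) {p : Equiv.Perm M} (hp : IsMover c p) :
    IsMover c p⁻¹ :=
  ⟨inv_mem hp.mem, hp.moves.inv hc conv_mem_redColours hp.mem⟩

namespace ConjOver

theorem refl (F : Finset M) (p : Equiv.Perm M) : ConjOver c F p p := ⟨1, one_mem _, by simp⟩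

theorem trans {F F' : Finset M} {p p' p'' : Equiv.Perm M} (h : ConjOver c F p p')
    (h' : ConjOver c F' p' p'') (hF : F ⊆ F') : ConjOver c F p p'' := by
  obtain ⟨a, ha, rfl⟩ := h
  obtain ⟨b, hb, rfl⟩ := h'
  exact ⟨b * a, mul_mem (fixer_anti hF hb) ha, conj_conj a b p⟩

theorem mono {F K : Finset M} {p p' : Equiv.Perm M} (h : ConjOver c K p p') (hF : F ⊆ K) :
    ConjOver c F p p' := by
  obtain ⟨a, ha, rfl⟩ := h
  exact ⟨a, fixer_anti hF ha, rfl⟩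

theorem inv {F : Finset M} {p p' : Equiv.Perm M} (h : ConjOver c F p p') :
    ConjOver c F p⁻¹ p'⁻¹ := by
  obtain ⟨a, ha, rfl⟩ := h
  exact ⟨a, ha, (conj_inv' a p).symm⟩

theorem mover {F : Finset M} {p p' : Equiv.Perm M} (h : ConjOver c F p p') (hp : IsMover c p) :
    IsMover c p' := by
  obtain ⟨a, ha, rfl⟩ := h
  exact hp.conj ha.1

theorem apply_eq {F : Finset M} {p p' : Equiv.Perm M} (h : ConjOver c F p p') {x : M}
    (hx : x ∈ F) (hpx : p x ∈ F) : p' x = p x := by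
  obtain ⟨a, ha, rfl⟩ := h
  exact conj_apply_of_mem ha hx hpx

/-- Conjugating over `A ∪ B` preserves the fact that the permutation maps `A` onto `B`. -/
theorem map_iff [DecidableEq M] {A B : Finset M} {p p' : Equiv.Perm M}
    (h : ConjOver c (A ∪ B) p p') (hp : ∀ x, p x ∈ B ↔ x ∈ A) (x : M) : p' x ∈ B ↔ x ∈ A := by
  obtain ⟨a, ha, rfl⟩ := h
  rw [Equiv.Perm.mul_apply, Equiv.Perm.mul_apply,
    apply_mem_iff_of_mem_fixer ha Finset.subset_union_right, hp,
    apply_mem_iff_of_mem_fixer (inv_mem ha) Finset.subset_union_left]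

end ConjOver

theorem IsChain.inv (hc : IsColouring ok c) {F Y₀ Y₁ Y₂ Y₃ Y₄ : Finset M}
    {p₁ p₂ p₃ p₄ : Equiv.Perm M} (h : IsChain c F Y₀ Y₁ Y₂ Y₃ Y₄ p₁ p₂ p₃ p₄) :
    IsChain c F Y₄ Y₃ Y₂ Y₁ Y₀ p₄⁻¹ p₃⁻¹ p₂⁻¹ p₁⁻¹ where
  mover₁ := h.mover₄.inv hc
  mover₂ := h.mover₃.inv hc
  mover₃ := h.mover₂.inv hc
  mover₄ := h.mover₁.inv hc
  sub₀ := h.sub₄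
  sub₁ := h.sub₃
  sub₂ := h.sub₂
  sub₃ := h.sub₁
  sub₄ := h.sub₀
  map₁ x := by simpa using (h.map₄ (p₄⁻¹ x)).symm
  map₂ x := by simpa using (h.map₃ (p₃⁻¹ x)).symm
  map₃ x := by simpa using (h.map₂ (p₂⁻¹ x)).symm
  map₄ x := by simpa using (h.map₁ (p₁⁻¹ x)).symm
  inter₀₂ x h₁ h₂ := h.inter₂₄ x h₂ h₁
  inter₁₃ x h₁ h₂ := h.inter₁₃ x h₂ h₁
  inter₂₄ x h₁ h₂ := h.inter₀₂ x h₂ h₁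
  inter₀₃ x h₁ h₂ := h.inter₁₄ x h₂ h₁
  inter₁₄ x h₁ h₂ := h.inter₀₃ x h₂ h₁

/-- The inner members of a chain may be moved by an automorphism fixing both ends. -/
theorem IsChain.conj [DecidableEq M] {F Y₀ Y₁ Y₂ Y₃ Y₄ : Finset M} {p₁ p₂ p₃ p₄ : Equiv.Perm M}
    (h : IsChain c F Y₀ Y₁ Y₂ Y₃ Y₄ p₁ p₂ p₃ p₄) {a : Equiv.Perm M} (ha : a ∈ fixer c (Y₀ ∪ Y₄)) :
    IsChain c F Y₀ (Y₁.image a) (Y₂.image a) (Y₃.image a) Y₄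
      (a * p₁ * a⁻¹) (a * p₂ * a⁻¹) (a * p₃ * a⁻¹) (a * p₄ * a⁻¹) := by
  have e₀ : ∀ x, a⁻¹ x ∈ Y₀ ↔ x ∈ Y₀ := fun x =>
    apply_mem_iff_of_mem_fixer (inv_mem ha) Finset.subset_union_left
  have e₄ : ∀ x, a⁻¹ x ∈ Y₄ ↔ x ∈ Y₄ := fun x =>
    apply_mem_iff_of_mem_fixer (inv_mem ha) Finset.subset_union_right
  have f₀ : ∀ x ∈ Y₀, a⁻¹ x = x := fun x hx =>
    inv_apply_of_mem_fixer ha (Finset.mem_union_left _ hx)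
  have f₄ : ∀ x ∈ Y₄, a⁻¹ x = x := fun x hx =>
    inv_apply_of_mem_fixer ha (Finset.mem_union_right _ hx)
  have hF : ∀ x, a⁻¹ x ∈ F ↔ x ∈ F := fun x =>
    apply_mem_iff_of_mem_fixer (inv_mem ha) (h.sub₀.trans Finset.subset_union_left)
  have hmul : ∀ (p : Equiv.Perm M) x, a⁻¹ ((a * p * a⁻¹) x) = p (a⁻¹ x) := fun p x => by simp
  exact
  { mover₁ := h.mover₁.conj ha.1
    mover₂ := h.mover₂.conj ha.1
    mover₃ := h.mover₃.conj ha.1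
    mover₄ := h.mover₄.conj ha.1
    sub₀ := h.sub₀
    sub₁ := fun x hx => mem_image_perm_iff.2 (h.sub₁ ((hF x).2 hx))
    sub₂ := fun x hx => mem_image_perm_iff.2 (h.sub₂ ((hF x).2 hx))
    sub₃ := fun x hx => mem_image_perm_iff.2 (h.sub₃ ((hF x).2 hx))
    sub₄ := h.sub₄
    map₁ := fun x => by rw [mem_image_perm_iff, hmul, h.map₁, e₀]
    map₂ := fun x => by rw [mem_image_perm_iff, hmul, h.map₂, mem_image_perm_iff]
    map₃ := fun x => by rw [mem_image_perm_iff, hmul, h.map₃, mem_image_perm_iff]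
    map₄ := fun x => by rw [← e₄, hmul, h.map₄, mem_image_perm_iff]
    inter₀₂ := fun x h₁ h₂ => by
      rw [mem_image_perm_iff, f₀ x h₁] at h₂
      exact h.inter₀₂ x h₁ h₂
    inter₁₃ := fun x h₁ h₂ => by
      rw [mem_image_perm_iff] at h₁ h₂
      exact (hF x).1 (h.inter₁₃ _ h₁ h₂)
    inter₂₄ := fun x h₁ h₂ => by
      rw [mem_image_perm_iff, f₄ x h₂] at h₁
      exact h.inter₂₄ x h₁ h₂
    inter₀₃ := fun x h₁ h₂ => by
      rw [mem_image_perm_iff, f₀ x h₁] at h₂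
      exact h.inter₀₃ x h₁ h₂
    inter₁₄ := fun x h₁ h₂ => by
      rw [mem_image_perm_iff, f₄ x h₂] at h₁
      exact h.inter₁₄ x h₁ h₂ }

namespace IsGeneric

variable (hM : IsGeneric ok c)
include hM

/-- A mover `p` that maps `A` onto `B` can be conjugated over `A ∪ B` in such a way that the image
of a given point `x`, joined to `B \ A` by `R`-edges, is joined to `A \ B` and `x`
by `R`-edges. -/
theorem exists_conjOver_apply_far [DecidableEq M] {p : Equiv.Perm M} (hp : IsMover c p)
    {A B : Finset M} (hAB : ∀ x, p x ∈ B ↔ x ∈ A) {x : M} (hxA : x ∉ A) (hxB : x ∉ B)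
    (hx : ∀ b ∈ B, b ∉ A → Far c x b) :
    ∃ p', ConjOver c (A ∪ B) p p' ∧ Far c x (p' x) ∧ p' x ∉ A ∧ p' x ∉ B ∧
      (∀ u ∈ A, u ∉ B → Far c (p' x) u) ∧ ∀ u ∈ B, c (p' x) u = c x (p⁻¹ u) := by
  obtain ⟨a, ha, hC, hnot, -, hfar⟩ := hM.exists_conj_apply_far hp.mem hp.moves (A ∪ B) ∅
    (x := x) (by simp [hxA, hxB])
  have hp' : ConjOver c (A ∪ B) p (a * p * a⁻¹) := ⟨a, ha, rfl⟩
  have hcol : ∀ u ∈ A ∪ B, p⁻¹ u ∈ A ∪ B → c ((a * p * a⁻¹) x) u = c x (p⁻¹ u) := fun u hu hu' => by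
    rw [← (hp'.mover hp).mem x (p⁻¹ u), hp'.apply_eq hu' (by simpa using hu)]
    simp
  refine ⟨_, hp', exists_mem_redColours_iff.1 hC, fun h => hnot (Finset.mem_union_left _ h),
    fun h => hnot (Finset.mem_union_right _ h), fun u hu huB => ?_, fun u hu => ?_⟩
  · by_cases hu' : p⁻¹ u ∈ A ∪ B
    · have h1 : p⁻¹ u ∉ A := fun h => huB (by simpa using (hAB _).2 h)
      exact (hx _ ((Finset.mem_union.1 hu').resolve_left h1) h1).of_eq
        (hcol u (Finset.mem_union_left _ hu) hu')
    · exact hfar u (Finset.mem_union_left _ hu) hu'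
  · exact hcol u (Finset.mem_union_right _ hu)
      (Finset.mem_union_left _ ((hAB _).1 (by simpa using hu)))

/-- Two types over `A ∪ D` and `B ∪ D` that agree on `D ⊇ A ∩ B` and have only `R`-edges
outside `D` can be realised simultaneously. -/
theorem exists_common_realisation [DecidableEq M] {A B D : Finset M} (W : Finset M) {z z' : M}
    (hzA : z ∉ A) (hzD : z ∉ D) (hz'B : z' ∉ B) (hz'D : z' ∉ D)
    (hD : ∀ u ∈ D, c z u = c z' u) (hABD : ∀ u ∈ A, u ∈ B → u ∈ D)
    (hA : ∀ u ∈ A, u ∉ D → Far c z u) (hB : ∀ u ∈ B, u ∉ D → Far c z' u) :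
    ∃ w, (∀ u ∈ A ∪ D, c w u = c z u) ∧ (∀ u ∈ B ∪ D, c w u = c z' u) ∧
      ∀ v ∈ W, v ∉ A ∪ B ∪ D → Far c w v := by
  let q : M → Colour := fun u => if u ∈ A ∪ D then (c z u).getD .Rpos else (c z' u).getD .Rpos
  have hqA : ∀ u ∈ A ∪ D, c z u = some (q u) := fun u hu => by
    obtain ⟨k, hk⟩ := hM.exists_eq (a := z) (b := u) (by
      rintro rfl
      rcases Finset.mem_union.1 hu with h | h
      · exact hzA h
      · exact hzD h)
    simp only [q, if_pos hu, hk, Option.getD_some]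
  have hqB : ∀ u ∈ B ∪ D, c z' u = some (q u) := fun u hu => by
    by_cases huA : u ∈ A ∪ D
    · rw [← hqA u huA]
      refine (hD u ?_).symm
      rcases Finset.mem_union.1 huA with h | h
      · rcases Finset.mem_union.1 hu with h' | h'
        · exact hABD u h h'
        · exact h'
      · exact h
    · obtain ⟨k, hk⟩ := hM.exists_eq (a := z') (b := u) (by
        rintro rfl
        rcases Finset.mem_union.1 hu with h | h
        · exact hz'B h
        · exact hz'D h)
      simp only [q, if_neg huA, hk, Option.getD_some]
  -- Points of `A \ D` and of `B \ D` have `R`-edges only, and so no `G`-path joins the two parts.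
  have hmem : ∀ u ∈ A ∪ B ∪ D, (q u = .Gpos ∨ q u = .Gneg) → u ∈ D := by
    intro u hu hq
    by_contra huD
    have key : ∀ t, Far c t u → c t u = some (q u) → False := by
      rintro t (ht | ht) h <;> rw [ht] at h <;> injection h with h <;> rw [← h] at hq <;>
        simp at hq
    rcases Finset.mem_union.1 hu with h | h
    · rcases Finset.mem_union.1 h with h | h
      · exact key z (hA u h huD) (hqA u (Finset.mem_union_left _ h))
      · exact key z' (hB u h huD) (hqB u (Finset.mem_union_left _ h))
    · exact huD h
  have hconsA := hM.consistent_of_type (W := ↑(A ∪ D)) z hqA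
  have hconsB := hM.consistent_of_type (W := ↑(B ∪ D)) z' hqB
  have hside : ∀ u ∈ A ∪ B ∪ D, u ∈ A ∪ D ∨ u ∈ B ∪ D := fun u hu => by
    simp only [Finset.mem_union] at hu ⊢; tauto
  have hcons : Consistent ok c (A ∪ B ∪ D : Finset M) q := by
    intro u hu v hv
    refine ⟨fun h1 h2 => ?_, fun h1 h2 => ?_, fun h1 h2 => ?_⟩
    · have hu' := hmem u hu (.inl h1)
      rcases hside v hv with hv' | hv'
      · exact (hconsA u (Finset.mem_union_right _ hu') v hv').1 h1 h2
      · exact (hconsB u (Finset.mem_union_right _ hu') v hv').1 h1 h2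
    · have hu' := hmem u hu (.inr h1)
      have hv' := hmem v hv (.inl h2)
      exact (hconsA u (Finset.mem_union_right _ hu') v (Finset.mem_union_right _ hv')).2.1 h1 h2
    · have hv' := hmem v hv (.inr h2)
      rcases hside u hu with hu' | hu'
      · exact (hconsA u hu' v (Finset.mem_union_right _ hv')).2.2 h1 h2
      · exact (hconsB u hu' v (Finset.mem_union_right _ hv')).2.2 h1 h2
  obtain ⟨w₀, hw₀⟩ := hM.extension _ q hcons
  have hw₀' : w₀ ∉ A ∪ B ∪ D := fun h => by
    have := hw₀ _ h
    rw [hM.self] at this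
    cases this
  obtain ⟨w, hw, hwW⟩ := hM.exists_type_eq_and_far (A ∪ B ∪ D) W hw₀'
  refine ⟨w, fun u hu => ?_, fun u hu => ?_, hwW⟩
  · have hu' : u ∈ A ∪ B ∪ D := by simp only [Finset.mem_union] at hu ⊢; tauto
    rw [hw u hu', hw₀ u hu', hqA u hu]
  · have hu' : u ∈ A ∪ B ∪ D := by simp only [Finset.mem_union] at hu ⊢; tauto
    rw [hw u hu', hw₀ u hu', hqB u hu]

end IsGeneric

end

section

variable {M : Type*} {ok : Colour → Prop} {c : M → M → Option Colour}

theorem map_insert_iff [DecidableEq M] {A B : Finset M} {p : Equiv.Perm M} {x y : M}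
    (hp : ∀ z, p z ∈ B ↔ z ∈ A) (hx : p x = y) (z : M) : p z ∈ insert y B ↔ z ∈ insert x A := by
  rw [Finset.mem_insert, Finset.mem_insert, hp, ← hx, EmbeddingLike.apply_eq_iff_eq]

set_option maxHeartbeats 1000000 in
/-- A chain can be extended by a point `x₀` and its prescribed image `x₄`, provided that the inner
members are off these points. The inner points `x₁` and `x₃` are obtained by choosing suitable
conjugates of `p₁` and `p₄`; then `x₂` has to realise a type coming from `x₁` through `p₂` and a
type coming from `x₃` through `p₃`, and these have a common realisation. -/
theorem IsChain.extend_of_avoids [DecidableEq M] (hM : IsGeneric ok c)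
    {F Y₀ Y₁ Y₂ Y₃ Y₄ : Finset M}
    {p₁ p₂ p₃ p₄ e : Equiv.Perm M} (h : IsChain c F Y₀ Y₁ Y₂ Y₃ Y₄ p₁ p₂ p₃ p₄)
    (he : e ∈ colourAut c) (hag : ∀ x ∈ Y₀, p₄ (p₃ (p₂ (p₁ x))) = e x) {x₀ x₄ : M}
    (hx₄ : e x₀ = x₄) (hx₀Y : x₀ ∉ Y₀) (hx₄Y : x₄ ∉ Y₄)
    (hav : ∀ u, u = x₀ ∨ u = x₄ → u ∈ Y₁ ∨ u ∈ Y₂ ∨ u ∈ Y₃ → u ∈ Y₀ ∨ u ∈ Y₄) :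
    ∃ x₁ x₂ x₃ p₁' p₂' p₃' p₄',
      IsChain c F (insert x₀ Y₀) (insert x₁ Y₁) (insert x₂ Y₂) (insert x₃ Y₃) (insert x₄ Y₄)
        p₁' p₂' p₃' p₄' ∧
      (ConjOver c F p₁ p₁' ∧ ConjOver c F p₂ p₂' ∧ ConjOver c F p₃ p₃' ∧ ConjOver c F p₄ p₄') ∧
      ∀ x ∈ insert x₀ Y₀, p₄' (p₃' (p₂' (p₁' x))) = e x := by
  have hc := hM.toIsColouring
  have hirr : ∀ {v : M}, ¬ Far c v v := fun hv => hv.ne hc rfl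
  have hinv := h.inv hc
  have hx₀₁ : x₀ ∉ Y₁ := fun hx => (hav x₀ (.inl rfl) (.inl hx)).elim hx₀Y
    fun hx' => hx₀Y (h.inter₁₄ _ hx hx')
  have hx₀₂ : x₀ ∉ Y₂ := fun hx => (hav x₀ (.inl rfl) (.inr (.inl hx))).elim hx₀Y
    fun hx' => hx₀Y (h.sub₀ (h.inter₂₄ _ hx hx'))
  have hx₀₃ : x₀ ∈ Y₃ → x₀ ∈ Y₄ := fun hx =>
    (hav x₀ (.inl rfl) (.inr (.inr hx))).resolve_left hx₀Y
  have hx₄₃ : x₄ ∉ Y₃ := fun hx => (hav x₄ (.inr rfl) (.inr (.inr hx))).elim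
    (fun hx' => hx₄Y (h.inter₀₃ _ hx' hx)) hx₄Y
  have hx₄₂ : x₄ ∉ Y₂ := fun hx => (hav x₄ (.inr rfl) (.inr (.inl hx))).elim
    (fun hx' => hx₄Y (h.sub₄ (h.inter₀₂ _ hx' hx))) hx₄Y
  have hx₄₁ : x₄ ∈ Y₁ → x₄ ∈ Y₀ := fun hx =>
    (hav x₄ (.inr rfl) (.inl hx)).resolve_right hx₄Y
  -- The points `x₁ = p₁' x₀` and `x₃ = q₄ x₄`, where `q₄` will be the inverse of `p₄'`. They are
  -- new, and joined by `R`-edges to the points of `Y₂` outside `Y₁` and `Y₃`, respectively.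
  obtain ⟨a₁, ha₁, hx₁C, hx₁K, hx₁W, -⟩ := hM.exists_conj_apply_far h.mover₁.mem h.mover₁.moves
    (Y₀ ∪ Y₁) (Y₂ ∪ Y₃ ∪ Y₄ ∪ {x₄}) (x := x₀) (by simp [hx₀Y, hx₀₁])
  have hp₁' : ConjOver c (Y₀ ∪ Y₁) p₁ (a₁ * p₁ * a₁⁻¹) := ⟨a₁, ha₁, rfl⟩
  revert hp₁' hx₁C hx₁K hx₁W
  generalize a₁ * p₁ * a₁⁻¹ = p₁'
  intro hx₁C hx₁K hx₁W hp₁'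
  obtain ⟨x₁, hx₁⟩ : ∃ x₁, p₁' x₀ = x₁ := ⟨_, rfl⟩
  rw [hx₁] at hx₁C hx₁K hx₁W
  have hx₀₁ne : x₀ ≠ x₁ := (exists_mem_redColours_iff.1 hx₁C).ne hc
  simp only [Finset.mem_union, Finset.mem_singleton, not_or] at hx₁K hx₁W
  have hx₁₂ : x₁ ∉ Y₂ := fun hx => hirr (hx₁W x₁ (.inl (.inl (.inl hx))) hx₁K hx₀₁ne.symm)
  have hx₁₃ : x₁ ∉ Y₃ := fun hx => hirr (hx₁W x₁ (.inl (.inl (.inr hx))) hx₁K hx₀₁ne.symm)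
  have hx₁₄ : x₁ ∉ Y₄ := fun hx => hirr (hx₁W x₁ (.inl (.inr hx)) hx₁K hx₀₁ne.symm)
  have hx₁x₄ : x₁ ≠ x₄ := fun hx => hirr (hx₁W x₁ (.inr hx) hx₁K hx₀₁ne.symm)
  have hx₁far : ∀ b ∈ Y₂, b ∉ Y₁ → Far c x₁ b := fun b hb hb' =>
    hx₁W b (.inl (.inl (.inl hb))) ⟨fun hb₀ => hb' (h.sub₁ (h.inter₀₂ _ hb₀ hb)), hb'⟩
      (by rintro rfl; exact hx₀₂ hb)
  obtain ⟨a₃, ha₃, hx₃C, hx₃K, hx₃W, -⟩ := hM.exists_conj_apply_far hinv.mover₁.mem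
    hinv.mover₁.moves (Y₄ ∪ Y₃) (Y₂ ∪ Y₁ ∪ Y₀ ∪ {x₀, x₁}) (x := x₄) (by simp [hx₄Y, hx₄₃])
  have hp₄' : ConjOver c (Y₄ ∪ Y₃) p₄⁻¹ (a₃ * p₄⁻¹ * a₃⁻¹) := ⟨a₃, ha₃, rfl⟩
  revert hp₄' hx₃C hx₃K hx₃W
  generalize a₃ * p₄⁻¹ * a₃⁻¹ = q₄
  intro hx₃C hx₃K hx₃W hp₄'
  obtain ⟨x₃, hx₃⟩ : ∃ x₃, q₄ x₄ = x₃ := ⟨_, rfl⟩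
  rw [hx₃] at hx₃C hx₃K hx₃W
  have hx₄₃ne : x₄ ≠ x₃ := (exists_mem_redColours_iff.1 hx₃C).ne hc
  simp only [Finset.mem_union, Finset.mem_singleton, Finset.mem_insert, not_or] at hx₃K hx₃W
  have hx₃₂ : x₃ ∉ Y₂ := fun hx => hirr (hx₃W x₃ (.inl (.inl (.inl hx))) hx₃K hx₄₃ne.symm)
  have hx₃₁ : x₃ ∉ Y₁ := fun hx => hirr (hx₃W x₃ (.inl (.inl (.inr hx))) hx₃K hx₄₃ne.symm)
  have hx₃₀ : x₃ ∉ Y₀ := fun hx => hirr (hx₃W x₃ (.inl (.inr hx)) hx₃K hx₄₃ne.symm)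
  have hx₃x₀ : x₃ ≠ x₀ := fun hx => hirr (hx₃W x₃ (.inr (.inl hx)) hx₃K hx₄₃ne.symm)
  have hx₃x₁ : x₃ ≠ x₁ := fun hx => hirr (hx₃W x₃ (.inr (.inr hx)) hx₃K hx₄₃ne.symm)
  have hx₃far : ∀ b ∈ Y₂, b ∉ Y₃ → Far c x₃ b := fun b hb hb' =>
    hx₃W b (.inl (.inl (.inl hb))) ⟨fun hb₄ => hb' (h.sub₃ (h.inter₂₄ _ hb hb₄)), hb'⟩
      (by rintro rfl; exact hx₄₂ hb)
  -- First candidates `p₂' x₁` and `q₃ x₃` for `x₂`, where `q₃` is a conjugate of `p₃⁻¹`.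
  obtain ⟨p₂', hp₂', hz₁, hzY₁, hzY₂, hzfar, hzcol⟩ := hM.exists_conjOver_apply_far h.mover₂
    h.map₂ hx₁K.2 hx₁₂ hx₁far
  obtain ⟨q₃, hq₃, hz'₃, hz'Y₃, hz'Y₂, hz'far, hz'col⟩ := hM.exists_conjOver_apply_far hinv.mover₂
    hinv.map₂ hx₃K.2 hx₃₂ hx₃far
  -- Transported back to `Y₀` and `Y₄`, their types over `Y₂` are those of `x₀` and `e x₀`, and
  -- `e` identifies these two types.
  have hD : ∀ u ∈ Y₂, c (p₂' x₁) u = c (q₃ x₃) u := fun u hu => by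
    rw [hzcol u hu, hz'col u hu, inv_inv]
    have h₁ : p₂⁻¹ u ∈ Y₁ := by rw [← h.map₂]; simpa using hu
    have h₀ : p₁⁻¹ (p₂⁻¹ u) ∈ Y₀ := by rw [← h.map₁]; simpa using h₁
    have h₃ : p₃ u ∈ Y₃ := (h.map₃ u).2 hu
    have h₄ : p₄ (p₃ u) ∈ Y₄ := (h.map₄ _).2 h₃
    have e₁ : p₁' (p₁⁻¹ (p₂⁻¹ u)) = p₂⁻¹ u := by
      rw [hp₁'.apply_eq (Finset.mem_union_left _ h₀)
        (Finset.mem_union_right _ (by simpa using h₁))]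
      simp
    have e₃ : q₄ (p₄ (p₃ u)) = p₃ u := by
      rw [hp₄'.apply_eq (Finset.mem_union_left _ h₄)
        (Finset.mem_union_right _ (by simpa using h₃))]
      simp
    have e₄ : e (p₁⁻¹ (p₂⁻¹ u)) = p₄ (p₃ u) := by rw [← hag _ h₀]; simp
    rw [← e₁, ← hx₁, (hp₁'.mover h.mover₁).mem, ← e₃, ← hx₃, (hp₄'.mover hinv.mover₁).mem,
      ← hx₄, ← e₄, he]
  obtain ⟨x₂, hwA, hwB, hwW⟩ := hM.exists_common_realisation (A := insert x₁ Y₁)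
    (B := insert x₃ Y₃) (D := Y₂) (insert x₀ Y₀ ∪ insert x₄ Y₄)
    (by simp [hzY₁, (hz₁.ne hc).symm]) hzY₂ (by simp [hz'Y₃, (hz'₃.ne hc).symm]) hz'Y₂ hD
    (fun u hu hu' => by
      rw [Finset.mem_insert] at hu hu'
      rcases hu with rfl | hu <;> rcases hu' with h' | hu'
      · exact absurd h'.symm hx₃x₁
      · exact absurd hu' hx₁₃
      · exact absurd (h' ▸ hu) hx₃₁
      · exact h.sub₂ (h.inter₁₃ _ hu hu'))
    (fun u hu huD => by
      rcases Finset.mem_insert.1 hu with rfl | hu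
      · exact hz₁.symm hc
      · exact hzfar u hu huD)
    (fun u hu huD => by
      rcases Finset.mem_insert.1 hu with rfl | hu
      · exact hz'₃.symm hc
      · exact hz'far u hu huD)
  have hzA : p₂' x₁ ∉ insert x₁ Y₁ ∪ Y₂ := by simp [hzY₁, hzY₂, (hz₁.ne hc).symm]
  have hz'B : q₃ x₃ ∉ insert x₃ Y₃ ∪ Y₂ := by simp [hz'Y₃, hz'Y₂, (hz'₃.ne hc).symm]
  obtain ⟨b₂, hb₂, hb₂z⟩ := hM.exists_mem_fixer _ hzA hwA
  obtain ⟨b₃, hb₃, hb₃z⟩ := hM.exists_mem_fixer _ hz'B hwB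
  have hx₂A : x₂ ∉ insert x₁ Y₁ ∪ Y₂ :=
    hM.not_mem_of_type_eq (K := ↑(insert x₁ Y₁ ∪ Y₂)) hzA hwA
  have hx₂B : x₂ ∉ insert x₃ Y₃ ∪ Y₂ :=
    hM.not_mem_of_type_eq (K := ↑(insert x₃ Y₃ ∪ Y₂)) hz'B hwB
  have hx₂W : x₂ ∉ insert x₀ Y₀ ∪ insert x₄ Y₄ := fun hx => hirr (hwW x₂ hx (by
    simp only [Finset.mem_union, Finset.mem_insert] at hx₂A hx₂B ⊢; tauto))
  simp only [Finset.mem_union, Finset.mem_insert, not_or] at hx₂A hx₂B hx₂W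
  -- Both candidates are moved to `x₂`, fixing the rest of the chain.
  have hP₁ : ConjOver c (Y₀ ∪ Y₁) p₁ p₁' := hp₁'
  have hP₂ : ConjOver c (Y₁ ∪ Y₂) p₂ (b₂ * p₂' * b₂⁻¹) := hp₂'.trans
    ⟨b₂, fixer_anti (by intro u; simp only [Finset.mem_union, Finset.mem_insert]; tauto) hb₂, rfl⟩
    (Finset.Subset.refl _)
  have hP₃ : ConjOver c (Y₂ ∪ Y₃) p₃ (b₃ * q₃ * b₃⁻¹)⁻¹ := by
    have : ConjOver c (Y₃ ∪ Y₂) p₃⁻¹ (b₃ * q₃ * b₃⁻¹) := hq₃.trans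
      ⟨b₃, fixer_anti (by intro u; simp only [Finset.mem_union, Finset.mem_insert]; tauto) hb₃, rfl⟩
      (Finset.Subset.refl _)
    simpa [Finset.union_comm] using this.inv
  have hP₄ : ConjOver c (Y₃ ∪ Y₄) p₄ q₄⁻¹ := by
    simpa [Finset.union_comm] using hp₄'.inv
  have hx₂' : (b₂ * p₂' * b₂⁻¹) x₁ = x₂ := by
    rw [Equiv.Perm.mul_apply, Equiv.Perm.mul_apply, inv_apply_of_mem_fixer hb₂ (by simp), hb₂z]
  have hx₃' : (b₃ * q₃ * b₃⁻¹)⁻¹ x₂ = x₃ := by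
    rw [Equiv.Perm.inv_eq_iff_eq, Equiv.Perm.mul_apply, Equiv.Perm.mul_apply,
      inv_apply_of_mem_fixer hb₃ (by simp), hb₃z]
  have hx₄' : q₄⁻¹ x₃ = x₄ := by rw [Equiv.Perm.inv_eq_iff_eq, hx₃]
  have hsub : ∀ {y : M} {Y : Finset M}, F ⊆ Y → F ⊆ insert y Y := fun hY =>
    hY.trans (Finset.subset_insert _ _)
  refine ⟨x₁, x₂, x₃, p₁', b₂ * p₂' * b₂⁻¹, (b₃ * q₃ * b₃⁻¹)⁻¹, q₄⁻¹, ?_, ?_, ?_⟩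
  · exact
    { mover₁ := hP₁.mover h.mover₁
      mover₂ := hP₂.mover h.mover₂
      mover₃ := hP₃.mover h.mover₃
      mover₄ := hP₄.mover h.mover₄
      sub₀ := hsub h.sub₀
      sub₁ := hsub h.sub₁
      sub₂ := hsub h.sub₂
      sub₃ := hsub h.sub₃
      sub₄ := hsub h.sub₄
      map₁ := map_insert_iff (hP₁.map_iff h.map₁) hx₁
      map₂ := map_insert_iff (hP₂.map_iff h.map₂) hx₂'
      map₃ := map_insert_iff (hP₃.map_iff h.map₃) hx₃'
      map₄ := map_insert_iff (hP₄.map_iff h.map₄) hx₄'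
      inter₀₂ := fun x hx hx' => by
        rw [Finset.mem_insert] at hx hx'
        rcases hx with rfl | hx <;> rcases hx' with rfl | hx'
        · exact absurd rfl hx₂W.1.1
        · exact absurd hx' hx₀₂
        · exact absurd hx hx₂W.1.2
        · exact h.inter₀₂ x hx hx'
      inter₁₃ := fun x hx hx' => by
        rw [Finset.mem_insert] at hx hx'
        rcases hx with rfl | hx <;> rcases hx' with rfl | hx'
        · exact absurd rfl hx₃x₁
        · exact absurd hx' hx₁₃
        · exact absurd hx hx₃₁
        · exact h.inter₁₃ x hx hx'
      inter₂₄ := fun x hx hx' => by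
        rw [Finset.mem_insert] at hx hx'
        rcases hx with rfl | hx <;> rcases hx' with rfl | hx'
        · exact absurd rfl hx₂W.2.1
        · exact absurd hx' hx₂W.2.2
        · exact absurd hx hx₄₂
        · exact h.inter₂₄ x hx hx'
      inter₀₃ := fun x hx hx' => by
        rw [Finset.mem_insert] at hx hx'
        refine Finset.mem_insert_of_mem ?_
        rcases hx with rfl | hx <;> rcases hx' with rfl | hx'
        · exact absurd rfl hx₃x₀
        · exact hx₀₃ hx'
        · exact absurd hx hx₃₀
        · exact h.inter₀₃ x hx hx'
      inter₁₄ := fun x hx hx' => by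
        rw [Finset.mem_insert] at hx hx'
        refine Finset.mem_insert_of_mem ?_
        rcases hx with rfl | hx <;> rcases hx' with rfl | hx'
        · exact absurd rfl hx₁x₄
        · exact absurd hx' hx₁₄
        · exact hx₄₁ hx
        · exact h.inter₁₄ x hx hx' }
  · exact ⟨hP₁.mono (h.sub₀.trans Finset.subset_union_left),
      hP₂.mono (h.sub₁.trans Finset.subset_union_left),
      hP₃.mono (h.sub₂.trans Finset.subset_union_left),
      hP₄.mono (h.sub₃.trans Finset.subset_union_left)⟩
  · intro x hx
    rcases Finset.mem_insert.1 hx with rfl | hx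
    · rw [hx₁, hx₂', hx₃', hx₄', hx₄]
    · have h₁ := (h.map₁ x).2 hx
      have h₂ := (h.map₂ _).2 h₁
      have h₃ := (h.map₃ _).2 h₂
      have h₄ := (h.map₄ _).2 h₃
      rw [hP₁.apply_eq (Finset.mem_union_left _ hx) (Finset.mem_union_right _ h₁),
        hP₂.apply_eq (Finset.mem_union_left _ h₁) (Finset.mem_union_right _ h₂),
        hP₃.apply_eq (Finset.mem_union_left _ h₂) (Finset.mem_union_right _ h₃),
        hP₄.apply_eq (Finset.mem_union_left _ h₃) (Finset.mem_union_right _ h₄), hag x hx]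

/-- A chain can be extended by any point `x₀`, with prescribed image `e x₀` at the other end. -/
theorem IsChain.extend [DecidableEq M] (hM : IsGeneric ok c) {F Y₀ Y₁ Y₂ Y₃ Y₄ : Finset M}
    {p₁ p₂ p₃ p₄ e : Equiv.Perm M} (h : IsChain c F Y₀ Y₁ Y₂ Y₃ Y₄ p₁ p₂ p₃ p₄)
    (he : e ∈ colourAut c) (hag : ∀ x ∈ Y₀, p₄ (p₃ (p₂ (p₁ x))) = e x) (x₀ : M) :
    ∃ Y₀' Y₁' Y₂' Y₃' Y₄' p₁' p₂' p₃' p₄', IsChain c F Y₀' Y₁' Y₂' Y₃' Y₄' p₁' p₂' p₃' p₄' ∧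
      (ConjOver c F p₁ p₁' ∧ ConjOver c F p₂ p₂' ∧ ConjOver c F p₃ p₃' ∧ ConjOver c F p₄ p₄') ∧
      insert x₀ Y₀ ⊆ Y₀' ∧ ∀ x ∈ Y₀', p₄' (p₃' (p₂' (p₁' x))) = e x := by
  by_cases hx₀ : x₀ ∈ Y₀
  · exact ⟨Y₀, Y₁, Y₂, Y₃, Y₄, p₁, p₂, p₃, p₄, h, ⟨.refl _ _, .refl _ _, .refl _ _, .refl _ _⟩,
      by simp [Finset.insert_eq_of_mem hx₀], hag⟩
  have hx₄ : e x₀ ∉ Y₄ := fun hx => by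
    have h₃ : p₄⁻¹ (e x₀) ∈ Y₃ := by rw [← h.map₄]; simpa using hx
    have h₂ : p₃⁻¹ (p₄⁻¹ (e x₀)) ∈ Y₂ := by rw [← h.map₃]; simpa using h₃
    have h₁ : p₂⁻¹ (p₃⁻¹ (p₄⁻¹ (e x₀))) ∈ Y₁ := by rw [← h.map₂]; simpa using h₂
    have h₀ : p₁⁻¹ (p₂⁻¹ (p₃⁻¹ (p₄⁻¹ (e x₀)))) ∈ Y₀ := by rw [← h.map₁]; simpa using h₁
    have := hag _ h₀
    simp only [perm_apply_inv, EmbeddingLike.apply_eq_iff_eq] at this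
    exact hx₀ (this ▸ h₀)
  -- Fixing the ends, move the inner members of the chain off `x₀` and `e x₀`.
  obtain ⟨a, ha, haW⟩ := hM.exists_fixer_far (Y₀ ∪ Y₄) (Y₁ ∪ Y₂ ∪ Y₃) {x₀, e x₀}
  have hmem : ∀ u, u = x₀ ∨ u = e x₀ →
      u ∈ Y₁.image a ∨ u ∈ Y₂.image a ∨ u ∈ Y₃.image a → u ∈ Y₀ ∨ u ∈ Y₄ := by
    intro u hu hu'
    simp only [mem_image_perm_iff] at hu'
    by_contra hnot
    rw [← Finset.mem_union] at hnot
    refine (haW (a⁻¹ u) (by simp only [Finset.mem_union]; tauto) (fun h' => hnot ?_) u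
      (by simpa using hu) hnot).ne hM.toIsColouring (by simp)
    exact (apply_mem_iff_of_mem_fixer (inv_mem ha) (Finset.Subset.refl _)).1 h'
  obtain ⟨x₁, x₂, x₃, p₁', p₂', p₃', p₄', hch, ⟨h₁, h₂, h₃, h₄⟩, hag'⟩ :=
    (h.conj ha).extend_of_avoids hM he (fun x hx => by
      have h₁ := (h.map₄ _).2 ((h.map₃ _).2 ((h.map₂ _).2 ((h.map₁ _).2 hx)))
      simp only [Equiv.Perm.mul_apply, perm_inv_apply,
        inv_apply_of_mem_fixer ha (Finset.mem_union_left _ hx)]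
      rw [ha.2 _ (Finset.mem_union_right _ h₁), hag x hx]) rfl hx₀ hx₄ hmem
  have hF : ∀ p, ConjOver c F p (a * p * a⁻¹) := fun p =>
    ⟨a, fixer_anti (h.sub₀.trans Finset.subset_union_left) ha, rfl⟩
  exact ⟨_, _, _, _, _, _, _, _, _, hch, ⟨(hF _).trans h₁ (Finset.Subset.refl _),
    (hF _).trans h₂ (Finset.Subset.refl _), (hF _).trans h₃ (Finset.Subset.refl _),
    (hF _).trans h₄ (Finset.Subset.refl _)⟩, Finset.Subset.refl _, hag'⟩

/-- A chain can be extended so that its beginning contains any given finite set. -/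
theorem IsChain.extend_finset [DecidableEq M] (hM : IsGeneric ok c) {F Y₀ Y₁ Y₂ Y₃ Y₄ : Finset M}
    {p₁ p₂ p₃ p₄ e : Equiv.Perm M} (h : IsChain c F Y₀ Y₁ Y₂ Y₃ Y₄ p₁ p₂ p₃ p₄)
    (he : e ∈ colourAut c) (hag : ∀ x ∈ Y₀, p₄ (p₃ (p₂ (p₁ x))) = e x) (E : Finset M) :
    ∃ Y₀' Y₁' Y₂' Y₃' Y₄' p₁' p₂' p₃' p₄', IsChain c F Y₀' Y₁' Y₂' Y₃' Y₄' p₁' p₂' p₃' p₄' ∧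
      (ConjOver c F p₁ p₁' ∧ ConjOver c F p₂ p₂' ∧ ConjOver c F p₃ p₃' ∧ ConjOver c F p₄ p₄') ∧
      E ⊆ Y₀' ∧ ∀ x ∈ Y₀', p₄' (p₃' (p₂' (p₁' x))) = e x := by
  induction E using Finset.induction_on with
  | empty => exact ⟨Y₀, Y₁, Y₂, Y₃, Y₄, p₁, p₂, p₃, p₄, h, ⟨.refl _ _, .refl _ _, .refl _ _,
      .refl _ _⟩, by simp, hag⟩
  | insert x E _ ih =>
    obtain ⟨_, _, _, _, _, _, _, _, _, hch, ⟨h₁, h₂, h₃, h₄⟩, hE, hag'⟩ := ih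
    obtain ⟨_, _, _, _, _, _, _, _, _, hch', ⟨h₁', h₂', h₃', h₄'⟩, hE', hag''⟩ :=
      hch.extend hM he hag' x
    exact ⟨_, _, _, _, _, _, _, _, _, hch', ⟨h₁.trans h₁' (Finset.Subset.refl _),
      h₂.trans h₂' (Finset.Subset.refl _), h₃.trans h₃' (Finset.Subset.refl _),
      h₄.trans h₄' (Finset.Subset.refl _)⟩, (Finset.insert_subset_insert x hE).trans hE', hag''⟩

end

/-! ### Existence of chains -/

section

variable {M : Type*} {ok : Colour → Prop} {c : M → M → Option Colour}

namespace IsGeneric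

variable [DecidableEq M] (hM : IsGeneric ok c)
include hM

/-- After conjugating over `F`, the images and preimages of `F` meet a finite set `W` only if
they must. -/
theorem exists_conjOver_self_avoid (p : Equiv.Perm M) (F W : Finset M) :
    ∃ p', ConjOver c F p p' ∧
      ∀ x ∈ F, (p' x ∈ W → p' x ∈ F) ∧ (p'⁻¹ x ∈ W → p'⁻¹ x ∈ F) := by
  obtain ⟨a, ha, haW⟩ := hM.exists_fixer_far F (F.image p ∪ F.image (p⁻¹ : Equiv.Perm M)) W
  have key : ∀ y ∈ F.image p ∪ F.image (p⁻¹ : Equiv.Perm M), a y ∈ W → a y ∈ F := by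
    intro y hy hyW
    by_contra hn
    exact (haW y hy (fun h => hn (by rwa [ha.2 y h])) _ hyW hn).ne hM.toIsColouring rfl
  refine ⟨a * p * a⁻¹, ⟨a, ha, rfl⟩, fun x hx => ?_⟩
  rw [← conj_inv']
  simp only [Equiv.Perm.mul_apply, inv_apply_of_mem_fixer ha hx]
  exact ⟨key _ (Finset.mem_union_left _ (Finset.mem_image_of_mem _ hx)),
    key _ (Finset.mem_union_right _ (Finset.mem_image_of_mem _ hx))⟩

/-- After conjugating over `K`, a mover maps `Y \ K` off any given finite set. -/
theorem exists_conjOver_avoid {p : Equiv.Perm M} (hp : IsMover c p) (K Y W : Finset M) :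
    ∃ p', ConjOver c K p p' ∧ ∀ y ∈ Y, y ∉ K → p' y ∉ W := by
  suffices H : ∀ T : Finset M, (∀ t ∈ T, t ∉ K) → T ⊆ Y →
      ∃ p', ConjOver c K p p' ∧ ∀ t ∈ T, p' t ∉ W ∪ Y by
    obtain ⟨p', h, h'⟩ := H (Y \ K) (by simp) Finset.sdiff_subset
    exact ⟨p', h, fun y hy hyK hW =>
      h' y (Finset.mem_sdiff.2 ⟨hy, hyK⟩) (Finset.mem_union_left _ hW)⟩
  intro T
  induction T using Finset.induction_on with
  | empty => exact fun _ _ => ⟨p, .refl _ _, by simp⟩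
  | insert v T hv ih =>
    intro hTK hTY
    obtain ⟨p', hpp', hp'⟩ := ih (fun t ht => hTK t (Finset.mem_insert_of_mem ht))
      ((Finset.subset_insert _ _).trans hTY)
    have hvK : v ∉ K ∪ T ∪ T.image p' := by
      simp only [Finset.mem_union, hv, or_false, not_or]
      refine ⟨hTK v (Finset.mem_insert_self _ _), fun h => ?_⟩
      obtain ⟨t, ht, rfl⟩ := Finset.mem_image.1 h
      exact hp' t ht (Finset.mem_union_right _ (hTY (Finset.mem_insert_self _ _)))
    have hp'm := hpp'.mover hp
    obtain ⟨a, ha, hC, hnot, hW, -⟩ := hM.exists_conj_apply_far hp'm.mem hp'm.moves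
      (K ∪ T ∪ T.image p') (W ∪ Y) hvK
    have ha' : ConjOver c (K ∪ T ∪ T.image p') p' (a * p' * a⁻¹) := ⟨a, ha, rfl⟩
    refine ⟨a * p' * a⁻¹, hpp'.trans ha' ?_ |>.mono (Finset.Subset.refl _), fun t ht => ?_⟩
    · exact Finset.subset_union_left.trans Finset.subset_union_left
    · rcases Finset.mem_insert.1 ht with rfl | ht
      · intro h
        exact (hW _ h hnot ((exists_mem_redColours_iff.1 hC).ne hM.toIsColouring).symm).ne
          hM.toIsColouring rfl
      · rw [ha'.apply_eq (by simp [ht]) (by simp [ht])]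
        exact hp' t ht

theorem exists_conjOver_inv_avoid {p : Equiv.Perm M} (hp : IsMover c p) (K Y W : Finset M) :
    ∃ p', ConjOver c K p p' ∧ ∀ y ∈ Y, y ∉ K → p'⁻¹ y ∉ W := by
  obtain ⟨q, hq, h⟩ := hM.exists_conjOver_avoid (hp.inv hM.toIsColouring) K Y W
  exact ⟨q⁻¹, by simpa using hq.inv, by simpa using h⟩

/-- Any four movers can be conjugated over `F` so that they admit a chain.

The sets `Gᵢ` of all `pᵢ x` and `pᵢ⁻¹ x` with `x ∈ F` are first made disjoint outside `F`. All
further images and preimages that the chain needs can then be chosen to be new points. -/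
theorem exists_isChain {p₁ p₂ p₃ p₄ : Equiv.Perm M} (h₁ : IsMover c p₁) (h₂ : IsMover c p₂)
    (h₃ : IsMover c p₃) (h₄ : IsMover c p₄) (F : Finset M) :
    ∃ Y₀ Y₁ Y₂ Y₃ Y₄ p₁' p₂' p₃' p₄', IsChain c F Y₀ Y₁ Y₂ Y₃ Y₄ p₁' p₂' p₃' p₄' ∧
      (ConjOver c F p₁ p₁' ∧ ConjOver c F p₂ p₂' ∧ ConjOver c F p₃ p₃' ∧ ConjOver c F p₄ p₄') := by
  have hc := hM.toIsColouring
  -- The sets `Gᵢ`, for conjugates `q₂, q₃, q₄` of `p₂, p₃, p₄`.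
  obtain ⟨q₂, hq₂, hq₂G⟩ := hM.exists_conjOver_self_avoid p₂ F
    (F.image p₁ ∪ F.image (p₁⁻¹ : Equiv.Perm M))
  obtain ⟨G₁, hG₁⟩ : ∃ G, F.image p₁ ∪ F.image (p₁⁻¹ : Equiv.Perm M) = G := ⟨_, rfl⟩
  obtain ⟨G₂, hG₂⟩ : ∃ G, F.image q₂ ∪ F.image (q₂⁻¹ : Equiv.Perm M) = G := ⟨_, rfl⟩
  obtain ⟨q₃, hq₃, hq₃G⟩ := hM.exists_conjOver_self_avoid p₃ F (G₁ ∪ G₂)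
  obtain ⟨G₃, hG₃⟩ : ∃ G, F.image q₃ ∪ F.image (q₃⁻¹ : Equiv.Perm M) = G := ⟨_, rfl⟩
  obtain ⟨q₄, hq₄, hq₄G⟩ := hM.exists_conjOver_self_avoid p₄ F (G₁ ∪ G₂ ∪ G₃)
  obtain ⟨G₄, hG₄⟩ : ∃ G, F.image q₄ ∪ F.image (q₄⁻¹ : Equiv.Perm M) = G := ⟨_, rfl⟩
  have hdisj : ∀ {q : Equiv.Perm M} {W G : Finset M},
      (∀ x ∈ F, (q x ∈ W → q x ∈ F) ∧ (q⁻¹ x ∈ W → q⁻¹ x ∈ F)) →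
      F.image q ∪ F.image (q⁻¹ : Equiv.Perm M) = G → ∀ x ∈ G, x ∈ W → x ∈ F := by
    rintro q W _ h rfl x hx hxW
    rcases Finset.mem_union.1 hx with hx | hx <;> obtain ⟨y, hy, rfl⟩ := Finset.mem_image.1 hx
    · exact (h y hy).1 hxW
    · exact (h y hy).2 hxW
  rw [hG₁] at hq₂G
  have d₁₂ : ∀ x ∈ G₁, x ∈ G₂ → x ∈ F := fun x h h' => hdisj hq₂G hG₂ x h' h
  have d₁₃ : ∀ x ∈ G₁, x ∈ G₃ → x ∈ F := fun x h h' =>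
    hdisj hq₃G hG₃ x h' (Finset.mem_union_left _ h)
  have d₂₃ : ∀ x ∈ G₂, x ∈ G₃ → x ∈ F := fun x h h' =>
    hdisj hq₃G hG₃ x h' (Finset.mem_union_right _ h)
  have d₁₄ : ∀ x ∈ G₁, x ∈ G₄ → x ∈ F := fun x h h' =>
    hdisj hq₄G hG₄ x h' (Finset.mem_union_left _ (Finset.mem_union_left _ h))
  have d₂₄ : ∀ x ∈ G₂, x ∈ G₄ → x ∈ F := fun x h h' =>
    hdisj hq₄G hG₄ x h' (Finset.mem_union_left _ (Finset.mem_union_right _ h))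
  have d₃₄ : ∀ x ∈ G₃, x ∈ G₄ → x ∈ F := fun x h h' =>
    hdisj hq₄G hG₄ x h' (Finset.mem_union_right _ h)
  clear hq₂G hq₃G hq₄G hdisj
  have g₁ : ∀ x ∈ F, p₁ x ∈ G₁ ∧ p₁⁻¹ x ∈ G₁ := fun x hx => by
    rw [← hG₁]
    exact ⟨Finset.mem_union_left _ (Finset.mem_image_of_mem _ hx),
      Finset.mem_union_right _ (Finset.mem_image_of_mem _ hx)⟩
  have g₂ : ∀ x ∈ F, q₂ x ∈ G₂ ∧ q₂⁻¹ x ∈ G₂ := fun x hx => by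
    rw [← hG₂]
    exact ⟨Finset.mem_union_left _ (Finset.mem_image_of_mem _ hx),
      Finset.mem_union_right _ (Finset.mem_image_of_mem _ hx)⟩
  have g₃ : ∀ x ∈ F, q₃ x ∈ G₃ ∧ q₃⁻¹ x ∈ G₃ := fun x hx => by
    rw [← hG₃]
    exact ⟨Finset.mem_union_left _ (Finset.mem_image_of_mem _ hx),
      Finset.mem_union_right _ (Finset.mem_image_of_mem _ hx)⟩
  have g₄ : ∀ x ∈ F, q₄ x ∈ G₄ ∧ q₄⁻¹ x ∈ G₄ := fun x hx => by
    rw [← hG₄]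
    exact ⟨Finset.mem_union_left _ (Finset.mem_image_of_mem _ hx),
      Finset.mem_union_right _ (Finset.mem_image_of_mem _ hx)⟩
  clear hG₁ hG₂ hG₃ hG₄
  have hm₂ := hq₂.mover h₂
  have hm₃ := hq₃.mover h₃
  have hm₄ := hq₄.mover h₄
  -- As `F` is contained in `Y₀` and `Y₄`, the set `Y₂` has to contain the images of `p₁ F` under the
  -- second map and of `q₄⁻¹ F` under the inverse of the third one. The sets `R₁` and `R₄` consist of
  -- those not already obtained from points of `F`, and these are chosen to be new.
  obtain ⟨r₂, hr₂, hr₂W⟩ := hM.exists_conjOver_avoid hm₂ (F ∪ G₂) (F.image p₁)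
    (F ∪ G₁ ∪ G₂ ∪ G₃ ∪ G₄)
  obtain ⟨R₁, hR₁⟩ : ∃ R, (F.image p₁ \ (F ∪ G₂)).image r₂ = R := ⟨_, rfl⟩
  obtain ⟨r₃, hr₃, hr₃W⟩ := hM.exists_conjOver_inv_avoid hm₃ (F ∪ G₃)
    (F.image (q₄⁻¹ : Equiv.Perm M)) (F ∪ G₁ ∪ G₂ ∪ G₃ ∪ G₄ ∪ R₁)
  obtain ⟨R₄, hR₄⟩ : ∃ R, (F.image (q₄⁻¹ : Equiv.Perm M) \ (F ∪ G₃)).image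
    (r₃⁻¹ : Equiv.Perm M) = R := ⟨_, rfl⟩
  have hR₁' : ∀ x ∈ R₁, ∃ t ∈ F.image p₁, r₂ t = x ∧ x ∉ F ∪ G₁ ∪ G₂ ∪ G₃ ∪ G₄ := by
    intro x hx
    rw [← hR₁] at hx
    obtain ⟨t, ht, rfl⟩ := Finset.mem_image.1 hx
    obtain ⟨ht, ht'⟩ := Finset.mem_sdiff.1 ht
    exact ⟨t, ht, rfl, hr₂W t ht ht'⟩
  have hR₄' : ∀ x ∈ R₄, ∃ t ∈ F.image (q₄⁻¹ : Equiv.Perm M), r₃⁻¹ t = x ∧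
      x ∉ F ∪ G₁ ∪ G₂ ∪ G₃ ∪ G₄ ∪ R₁ := by
    intro x hx
    rw [← hR₄] at hx
    obtain ⟨t, ht, rfl⟩ := Finset.mem_image.1 hx
    obtain ⟨ht, ht'⟩ := Finset.mem_sdiff.1 ht
    exact ⟨t, ht, rfl, hr₃W t ht ht'⟩
  have hmr₂ := hr₂.mover hm₂
  have hmr₃ := hr₃.mover hm₃
  -- The remaining preimages `R₂` under the second map and images `R₃` under the third one.
  obtain ⟨s₂, hs₂, hs₂W⟩ := hM.exists_conjOver_inv_avoid hmr₂ (F ∪ G₂ ∪ F.image p₁ ∪ R₁)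
    (F.image (q₃⁻¹ : Equiv.Perm M) ∪ R₄) (F ∪ G₁ ∪ G₂ ∪ G₃ ∪ G₄ ∪ R₁ ∪ R₄)
  obtain ⟨R₂, hR₂⟩ : ∃ R, ((F.image (q₃⁻¹ : Equiv.Perm M) ∪ R₄) \
    (F ∪ G₂ ∪ F.image p₁ ∪ R₁)).image (s₂⁻¹ : Equiv.Perm M) = R := ⟨_, rfl⟩
  obtain ⟨s₃, hs₃, hs₃W⟩ := hM.exists_conjOver_avoid hmr₃
    (F ∪ G₃ ∪ F.image (q₄⁻¹ : Equiv.Perm M) ∪ R₄) (F.image q₂ ∪ R₁)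
    (F ∪ G₁ ∪ G₂ ∪ G₃ ∪ G₄ ∪ R₁ ∪ R₄ ∪ R₂)
  obtain ⟨R₃, hR₃⟩ : ∃ R, ((F.image q₂ ∪ R₁) \
    (F ∪ G₃ ∪ F.image (q₄⁻¹ : Equiv.Perm M) ∪ R₄)).image s₃ = R := ⟨_, rfl⟩
  have hR₂' : ∀ x ∈ R₂, x ∉ F ∪ G₁ ∪ G₂ ∪ G₃ ∪ G₄ ∪ R₁ ∪ R₄ := by
    intro x hx
    rw [← hR₂] at hx
    obtain ⟨t, ht, rfl⟩ := Finset.mem_image.1 hx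
    obtain ⟨ht, ht'⟩ := Finset.mem_sdiff.1 ht
    exact hs₂W t ht ht'
  have hR₃' : ∀ x ∈ R₃, x ∉ F ∪ G₁ ∪ G₂ ∪ G₃ ∪ G₄ ∪ R₁ ∪ R₄ ∪ R₂ := by
    intro x hx
    rw [← hR₃] at hx
    obtain ⟨t, ht, rfl⟩ := Finset.mem_image.1 hx
    obtain ⟨ht, ht'⟩ := Finset.mem_sdiff.1 ht
    exact hs₃W t ht ht'
  have hms₂ := hs₂.mover hmr₂
  have hms₃ := hs₃.mover hmr₃
  have hrs₂ : ConjOver c (F ∪ G₂) q₂ s₂ := hr₂.trans (hs₂.mono (by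
    intro x; simp only [Finset.mem_union]; tauto)) (Finset.Subset.refl _)
  have hrs₃ : ConjOver c (F ∪ G₃) q₃ s₃ := hr₃.trans (hs₃.mono (by
    intro x; simp only [Finset.mem_union]; tauto)) (Finset.Subset.refl _)
  have e₂ : ∀ x ∈ F, s₂ x = q₂ x ∧ s₂⁻¹ x = q₂⁻¹ x := fun x hx =>
    ⟨hrs₂.apply_eq (Finset.mem_union_left _ hx) (Finset.mem_union_right _ (g₂ x hx).1),
      hrs₂.inv.apply_eq (Finset.mem_union_left _ hx) (Finset.mem_union_right _ (g₂ x hx).2)⟩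
  have e₃ : ∀ x ∈ F, s₃ x = q₃ x ∧ s₃⁻¹ x = q₃⁻¹ x := fun x hx =>
    ⟨hrs₃.apply_eq (Finset.mem_union_left _ hx) (Finset.mem_union_right _ (g₃ x hx).1),
      hrs₃.inv.apply_eq (Finset.mem_union_left _ hx) (Finset.mem_union_right _ (g₃ x hx).2)⟩
  have e₂' : ∀ t ∈ F.image p₁, r₂ t ∈ R₁ → s₂ t = r₂ t := fun t ht h =>
    hs₂.apply_eq (by simp only [Finset.mem_union]; tauto) (by simp only [Finset.mem_union]; tauto)
  have e₃' : ∀ t ∈ F.image (q₄⁻¹ : Equiv.Perm M), r₃⁻¹ t ∈ R₄ → s₃⁻¹ t = r₃⁻¹ t := fun t ht h =>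
    hs₃.inv.apply_eq (by simp only [Finset.mem_union]; tauto)
      (by simp only [Finset.mem_union]; tauto)
  have i₁ : ∀ x ∈ F.image p₁, x ∈ G₁ := by simpa using fun x hx => (g₁ x hx).1
  have i₂ : ∀ x ∈ F.image q₂, x ∈ G₂ := by simpa using fun x hx => (g₂ x hx).1
  have i₃ : ∀ x ∈ F.image (q₃⁻¹ : Equiv.Perm M), x ∈ G₃ := fun x hx => by
    obtain ⟨y, hy, rfl⟩ := Finset.mem_image.1 hx; exact (g₃ y hy).2
  have i₄ : ∀ x ∈ F.image (q₄⁻¹ : Equiv.Perm M), x ∈ G₄ := fun x hx => by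
    obtain ⟨y, hy, rfl⟩ := Finset.mem_image.1 hx; exact (g₄ y hy).2
  simp only [Finset.mem_union, not_or] at hR₁' hR₄' hR₂' hR₃'
  -- The three inner members of the chain.
  obtain ⟨Y₂, hY₂⟩ : ∃ Y, F ∪ F.image q₂ ∪ F.image (q₃⁻¹ : Equiv.Perm M) ∪ R₁ ∪ R₄ = Y := ⟨_, rfl⟩
  obtain ⟨Y₁, hY₁⟩ : ∃ Y, Y₂.image (s₂⁻¹ : Equiv.Perm M) = Y := ⟨_, rfl⟩
  obtain ⟨Y₃, hY₃⟩ : ∃ Y, Y₂.image s₃ = Y := ⟨_, rfl⟩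
  have hm₂Y : ∀ x, s₂ x ∈ Y₂ ↔ x ∈ Y₁ := fun x => by rw [← hY₁, mem_image_perm_iff, inv_inv]
  have hm₃Y : ∀ x, s₃ x ∈ Y₃ ↔ x ∈ Y₂ := fun x => by
    rw [← hY₃, mem_image_perm_iff, perm_inv_apply]
  have memY₂ : ∀ x, x ∈ Y₂ ↔ x ∈ F ∨ x ∈ F.image q₂ ∨ x ∈ F.image (q₃⁻¹ : Equiv.Perm M) ∨
      x ∈ R₁ ∨ x ∈ R₄ := fun x => by rw [← hY₂]; simp only [Finset.mem_union]; tauto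
  -- Where the points of the members `Yᵢ` come from.
  have b₂ : ∀ x ∈ Y₂, x ∈ F ∨ x ∈ G₂ ∨ x ∈ G₃ ∨ x ∈ R₁ ∨ x ∈ R₄ := fun x hx => by
    rcases (memY₂ x).1 hx with h | h | h | h | h
    · exact .inl h
    · exact .inr (.inl (i₂ x h))
    · exact .inr (.inr (.inl (i₃ x h)))
    · exact .inr (.inr (.inr (.inl h)))
    · exact .inr (.inr (.inr (.inr h)))
  have b₁ : ∀ x ∈ Y₁, x ∈ F ∨ x ∈ F.image p₁ ∨ x ∈ G₂ ∨ x ∈ R₂ := by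
    intro x hx
    have hfresh : ∀ u, u ∈ F.image (q₃⁻¹ : Equiv.Perm M) ∪ R₄ → u = s₂ x →
        u ∉ F ∪ G₂ ∪ F.image p₁ ∪ R₁ → x ∈ R₂ := fun u hu hux hu' => by
      rw [← hR₂]
      exact Finset.mem_image.2 ⟨u, Finset.mem_sdiff.2 ⟨hu, hu'⟩, by rw [hux, perm_inv_apply]⟩
    have hF : s₂ x ∈ F → x ∈ G₂ := fun h => by
      have := (g₂ _ h).2
      rwa [← (e₂ _ h).2, perm_inv_apply] at this
    rcases (memY₂ _).1 ((hm₂Y x).2 hx) with h | h | h | h | h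
    · exact .inr (.inr (.inl (hF h)))
    · obtain ⟨y, hy, hyx⟩ := Finset.mem_image.1 h
      rw [← (e₂ y hy).1] at hyx
      exact .inl (s₂.injective hyx ▸ hy)
    · by_cases hxF : s₂ x ∈ F
      · exact .inr (.inr (.inl (hF hxF)))
      · refine .inr (.inr (.inr (hfresh _ (Finset.mem_union_left _ h) rfl ?_)))
        simp only [Finset.mem_union, not_or]
        exact ⟨⟨⟨hxF, fun h' => hxF (d₂₃ _ h' (i₃ _ h))⟩,
          fun h' => hxF (d₁₃ _ (i₁ _ h') (i₃ _ h))⟩,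
          fun h' => by obtain ⟨_, _, _, hn⟩ := hR₁' _ h'; exact hn.1.2 (i₃ _ h)⟩
    · obtain ⟨t, ht, htx, -⟩ := hR₁' _ h
      rw [← e₂' t ht (htx ▸ h)] at htx
      exact .inr (.inl (s₂.injective htx ▸ ht))
    · refine .inr (.inr (.inr (hfresh _ (Finset.mem_union_right _ h) rfl ?_)))
      obtain ⟨_, _, _, hn⟩ := hR₄' _ h
      simp only [Finset.mem_union, not_or]
      exact ⟨⟨⟨hn.1.1.1.1.1, hn.1.1.1.2⟩, fun h' => hn.1.1.1.1.2 (i₁ _ h')⟩, hn.2⟩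
  have b₃ : ∀ x ∈ Y₃, x ∈ F ∨ x ∈ F.image (q₄⁻¹ : Equiv.Perm M) ∨ x ∈ G₃ ∨ x ∈ R₃ := by
    intro x hx
    obtain ⟨u, hu, rfl⟩ : ∃ u ∈ Y₂, s₃ u = x := by rw [← hY₃] at hx; exact Finset.mem_image.1 hx
    have hfresh : u ∈ F.image q₂ ∪ R₁ →
        u ∉ F ∪ G₃ ∪ F.image (q₄⁻¹ : Equiv.Perm M) ∪ R₄ → s₃ u ∈ R₃ := fun hu hu' => by
      rw [← hR₃]
      exact Finset.mem_image_of_mem _ (Finset.mem_sdiff.2 ⟨hu, hu'⟩)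
    have hF : u ∈ F → s₃ u ∈ G₃ := fun h => by rw [(e₃ _ h).1]; exact (g₃ _ h).1
    rcases (memY₂ _).1 hu with h | h | h | h | h
    · exact .inr (.inr (.inl (hF h)))
    · by_cases hxF : u ∈ F
      · exact .inr (.inr (.inl (hF hxF)))
      · refine .inr (.inr (.inr (hfresh (Finset.mem_union_left _ h) ?_)))
        simp only [Finset.mem_union, not_or]
        exact ⟨⟨⟨hxF, fun h' => hxF (d₂₃ _ (i₂ _ h) h')⟩,
          fun h' => hxF (d₂₄ _ (i₂ _ h) (i₄ _ h'))⟩,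
          fun h' => by obtain ⟨_, _, _, hn⟩ := hR₄' _ h'; exact hn.1.1.1.2 (i₂ _ h)⟩
    · obtain ⟨y, hy, rfl⟩ := Finset.mem_image.1 h
      rw [← (e₃ y hy).2, perm_apply_inv]
      exact .inl hy
    · refine .inr (.inr (.inr (hfresh (Finset.mem_union_right _ h) ?_)))
      obtain ⟨_, _, _, hn⟩ := hR₁' _ h
      simp only [Finset.mem_union, not_or]
      exact ⟨⟨⟨hn.1.1.1.1, hn.1.2⟩, fun h' => hn.2 (i₄ _ h')⟩,
        fun h' => by obtain ⟨_, _, _, hn'⟩ := hR₄' _ h'; exact hn'.2 h⟩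
    · obtain ⟨t, ht, rfl, -⟩ := hR₄' _ h
      rw [← e₃' t ht h, perm_apply_inv]
      exact .inr (.inl ht)
  have sub₂ : F ⊆ Y₂ := fun x hx => (memY₂ x).2 (.inl hx)
  have sub₁ : F ⊆ Y₁ := fun x hx => by
    rw [← hm₂Y, (e₂ x hx).1, memY₂]
    exact .inr (.inl (Finset.mem_image_of_mem _ hx))
  have sub₃ : F ⊆ Y₃ := fun x hx => by
    rw [← perm_apply_inv s₃ x, hm₃Y, (e₃ x hx).2, memY₂]
    exact .inr (.inr (.inl (Finset.mem_image_of_mem _ hx)))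
  have sub₁' : ∀ t ∈ F.image p₁, t ∈ Y₁ := fun t ht => by
    by_cases htF : t ∈ F
    · exact sub₁ htF
    · have : r₂ t ∈ R₁ := by
        rw [← hR₁]
        refine Finset.mem_image_of_mem _ (Finset.mem_sdiff.2 ⟨ht, ?_⟩)
        simp only [Finset.mem_union, not_or]
        exact ⟨htF, fun h => htF (d₁₂ t (i₁ t ht) h)⟩
      rw [← hm₂Y, e₂' t ht this, memY₂]
      exact .inr (.inr (.inr (.inl this)))
  have sub₃' : ∀ t ∈ F.image (q₄⁻¹ : Equiv.Perm M), t ∈ Y₃ := fun t ht => by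
    by_cases htF : t ∈ F
    · exact sub₃ htF
    · have : r₃⁻¹ t ∈ R₄ := by
        rw [← hR₄]
        refine Finset.mem_image_of_mem _ (Finset.mem_sdiff.2 ⟨ht, ?_⟩)
        simp only [Finset.mem_union, not_or]
        exact ⟨htF, fun h => htF (d₃₄ t h (i₄ t ht))⟩
      rw [← perm_apply_inv s₃ t, hm₃Y, e₃' t ht this, memY₂]
      exact .inr (.inr (.inr (.inr this)))
  -- The ends of the chain.
  obtain ⟨s₁, hs₁, hs₁W⟩ := hM.exists_conjOver_inv_avoid h₁ (F ∪ G₁) Y₁ (Y₁ ∪ Y₂ ∪ Y₃)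
  obtain ⟨s₄, hs₄, hs₄W⟩ := hM.exists_conjOver_avoid hm₄ (F ∪ G₄) Y₃ (Y₁ ∪ Y₂ ∪ Y₃)
  have b₀ : ∀ x, s₁ x ∈ Y₁ → x ∈ F ∨ x ∈ G₁ ∨ x ∉ Y₁ ∪ Y₂ ∪ Y₃ := by
    intro x hx
    by_cases hxK : s₁ x ∈ F ∪ G₁
    · by_cases hxF : s₁ x ∈ F
      · right; left
        have := (g₁ _ hxF).2
        rwa [← hs₁.inv.apply_eq (Finset.mem_union_left _ hxF) (Finset.mem_union_right _ this),
          perm_inv_apply] at this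
      · have hxG := (Finset.mem_union.1 hxK).resolve_left hxF
        rcases b₁ _ hx with h | h | h | h
        · exact absurd h hxF
        · obtain ⟨y, hy, hyx⟩ := Finset.mem_image.1 h
          rw [← hs₁.apply_eq (Finset.mem_union_left _ hy)
            (Finset.mem_union_right _ (g₁ y hy).1)] at hyx
          exact .inl (s₁.injective hyx ▸ hy)
        · exact absurd (d₁₂ _ hxG h) hxF
        · exact absurd hxG (hR₂' _ h).1.1.1.1.1.2
    · right; right
      have := hs₁W _ hx hxK
      rwa [perm_inv_apply] at this
  have b₄ : ∀ x ∈ Y₃, s₄ x ∈ F ∨ s₄ x ∈ G₄ ∨ s₄ x ∉ Y₁ ∪ Y₂ ∪ Y₃ := by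
    intro x hx
    by_cases hxK : x ∈ F ∪ G₄
    · by_cases hxF : x ∈ F
      · right; left
        have := (g₄ _ hxF).1
        rwa [← hs₄.apply_eq (Finset.mem_union_left _ hxF) (Finset.mem_union_right _ this)] at this
      · have hxG := (Finset.mem_union.1 hxK).resolve_left hxF
        rcases b₃ _ hx with h | h | h | h
        · exact absurd h hxF
        · obtain ⟨y, hy, rfl⟩ := Finset.mem_image.1 h
          rw [← hs₄.inv.apply_eq (Finset.mem_union_left _ hy)
            (Finset.mem_union_right _ (g₄ y hy).2), perm_apply_inv]
          exact .inl hy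
        · exact absurd (d₃₄ _ h hxG) hxF
        · exact absurd hxG (hR₃' _ h).1.1.1.2
    · exact .inr (.inr (hs₄W _ hx hxK))
  have b₁' : ∀ x ∈ Y₁, x ∈ F ∨ x ∈ G₁ ∨ x ∈ G₂ ∨ x ∈ R₂ := fun x hx =>
    (b₁ x hx).imp_right (Or.imp_left (i₁ x))
  have b₃' : ∀ x ∈ Y₃, x ∈ F ∨ x ∈ G₄ ∨ x ∈ G₃ ∨ x ∈ R₃ := fun x hx =>
    (b₃ x hx).imp_right (Or.imp_left (i₄ x))
  have memY₀ : ∀ x, x ∈ Y₁.image (s₁⁻¹ : Equiv.Perm M) ↔ s₁ x ∈ Y₁ := fun x => by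
    rw [mem_image_perm_iff, inv_inv]
  have sub₀ : F ⊆ Y₁.image (s₁⁻¹ : Equiv.Perm M) := fun x hx => by
    rw [memY₀, hs₁.apply_eq (Finset.mem_union_left _ hx) (Finset.mem_union_right _ (g₁ x hx).1)]
    exact sub₁' _ (Finset.mem_image_of_mem _ hx)
  have sub₄ : F ⊆ Y₃.image s₄ := fun x hx => by
    rw [mem_image_perm_iff, hs₄.inv.apply_eq (Finset.mem_union_left _ hx)
      (Finset.mem_union_right _ (g₄ x hx).2)]
    exact sub₃' _ (Finset.mem_image_of_mem _ hx)
  have hr₁ : ∀ x ∈ R₁, x ∉ G₁ ∧ x ∉ G₄ := fun x hx => by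
    obtain ⟨_, _, _, hn⟩ := hR₁' x hx; exact ⟨hn.1.1.1.2, hn.2⟩
  have hr₄ : ∀ x ∈ R₄, x ∉ G₁ ∧ x ∉ G₄ := fun x hx => by
    obtain ⟨_, _, _, hn⟩ := hR₄' x hx; exact ⟨hn.1.1.1.1.2, hn.1.2⟩
  have k₀₂ : ∀ x ∈ G₁, x ∈ Y₂ → x ∈ F := fun x h h' => by
    rcases b₂ x h' with h' | h' | h' | h' | h'
    · exact h'
    · exact d₁₂ x h h'
    · exact d₁₃ x h h'
    · exact absurd h (hr₁ x h').1
    · exact absurd h (hr₄ x h').1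
  have k₂₄ : ∀ x ∈ G₄, x ∈ Y₂ → x ∈ F := fun x h h' => by
    rcases b₂ x h' with h' | h' | h' | h' | h'
    · exact h'
    · exact d₂₄ x h' h
    · exact d₃₄ x h' h
    · exact absurd h (hr₁ x h').2
    · exact absurd h (hr₄ x h').2
  have k₀₃ : ∀ x ∈ G₁, x ∈ Y₃ → x ∈ F := fun x h h' => by
    rcases b₃' x h' with h' | h' | h' | h'
    · exact h'
    · exact d₁₄ x h h'
    · exact d₁₃ x h h'
    · exact absurd h (hR₃' x h').1.1.1.1.1.1.2
  have k₁₄ : ∀ x ∈ G₄, x ∈ Y₁ → x ∈ F := fun x h h' => by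
    rcases b₁' x h' with h' | h' | h' | h'
    · exact h'
    · exact d₁₄ x h' h
    · exact d₂₄ x h' h
    · exact absurd h (hR₂' x h').1.1.2
  have k₁₃ : ∀ x ∈ Y₁, x ∈ Y₃ → x ∈ F := fun x h h' => by
    rcases b₁' x h with h | h | h | h
    · exact h
    · exact k₀₃ x h h'
    · rcases b₃' x h' with h' | h' | h' | h'
      · exact h'
      · exact d₂₄ x h h'
      · exact d₂₃ x h h'
      · exact absurd h (hR₃' x h').1.1.1.1.1.2
    · rcases b₃' x h' with h' | h' | h' | h'
      · exact h'
      · exact absurd h' (hR₂' x h).1.1.2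
      · exact absurd h' (hR₂' x h).1.1.1.2
      · exact absurd h (hR₃' x h').2
  refine ⟨Y₁.image (s₁⁻¹ : Equiv.Perm M), Y₁, Y₂, Y₃, Y₃.image s₄, s₁, s₂, s₃, s₄, ?_,
    hs₁.mono Finset.subset_union_left,
    hq₂.trans (hrs₂.mono Finset.subset_union_left) (Finset.Subset.refl _),
    hq₃.trans (hrs₃.mono Finset.subset_union_left) (Finset.Subset.refl _),
    hq₄.trans (hs₄.mono Finset.subset_union_left) (Finset.Subset.refl _)⟩
  exact
  { mover₁ := hs₁.mover h₁
    mover₂ := hms₂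
    mover₃ := hms₃
    mover₄ := hs₄.mover hm₄
    sub₀ := sub₀
    sub₁ := sub₁
    sub₂ := sub₂
    sub₃ := sub₃
    sub₄ := sub₄
    map₁ := fun x => (memY₀ x).symm
    map₂ := hm₂Y
    map₃ := hm₃Y
    map₄ := fun x => by rw [mem_image_perm_iff, perm_inv_apply]
    inter₀₂ := fun x h h' => by
      rcases b₀ x ((memY₀ x).1 h) with h | h | h
      · exact h
      · exact k₀₂ x h h'
      · exact absurd (Finset.mem_union_left _ (Finset.mem_union_right _ h')) h
    inter₁₃ := k₁₃
    inter₂₄ := fun x h h' => by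
      obtain ⟨y, hy, rfl⟩ := Finset.mem_image.1 h'
      rcases b₄ y hy with h' | h' | h'
      · exact h'
      · exact k₂₄ _ h' h
      · exact absurd (Finset.mem_union_left _ (Finset.mem_union_right _ h)) h'
    inter₀₃ := fun x h h' => by
      rcases b₀ x ((memY₀ x).1 h) with h | h | h
      · exact sub₄ h
      · exact sub₄ (k₀₃ x h h')
      · exact absurd (Finset.mem_union_right _ h') h
    inter₁₄ := fun x h h' => by
      obtain ⟨y, hy, rfl⟩ := Finset.mem_image.1 h'
      rcases b₄ y hy with h' | h' | h'
      · exact sub₀ h'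
      · exact sub₀ (k₁₄ _ h' h)
      · exact absurd (Finset.mem_union_left _ (Finset.mem_union_left _ h)) h' }

end IsGeneric

end

/-! ### Products of conjugates of a mover -/

section

variable {M : Type*} {ok : Colour → Prop} {c : M → M → Option Colour} {k f : Equiv.Perm M}

/-- The product of the four conjugates of `k` by the members of `h`. -/
def conjProd (k : Equiv.Perm M) (h : Fin 4 → Equiv.Perm M) : Equiv.Perm M :=
  (h 3 * k * (h 3)⁻¹) * (h 2 * k * (h 2)⁻¹) * (h 1 * k * (h 1)⁻¹) * (h 0 * k * (h 0)⁻¹)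

/-- The quadruples `h, h'` of automorphisms differ by left multiplication by automorphisms
fixing `F` pointwise. This is agreement of the inverses on `F`. -/
def Agree (c : M → M → Option Colour) (F : Finset M) (h h' : Fin 4 → Equiv.Perm M) : Prop :=
  ∀ i, h' i * (h i)⁻¹ ∈ fixer c F

/-- The products `conjProd k h'`, for `h'` agreeing with `h` on `F`, are dense in the set of
automorphisms that agree with `conjProd k h` on `E`. -/
def DenseOver (c : M → M → Option Colour) (k : Equiv.Perm M) (h : Fin 4 → Equiv.Perm M)
    (F E : Finset M) : Prop :=
  ∀ e ∈ colourAut c, (∀ x ∈ E, e x = conjProd k h x) → ∀ E' : Finset M,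
    ∃ h', Agree c F h h' ∧ ∀ x ∈ E', conjProd k h' x = e x

namespace Agree

theorem refl (F : Finset M) (h : Fin 4 → Equiv.Perm M) : Agree c F h h := fun i => by
  rw [mul_inv_cancel]
  exact one_mem _

theorem symm {F : Finset M} {h h' : Fin 4 → Equiv.Perm M} (H : Agree c F h h') :
    Agree c F h' h := fun i => by
  have := inv_mem (H i)
  rwa [mul_inv_rev, inv_inv] at this

theorem trans {F : Finset M} {h h' h'' : Fin 4 → Equiv.Perm M} (H : Agree c F h h')
    (H' : Agree c F h' h'') : Agree c F h h'' := fun i => by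
  have := mul_mem (H' i) (H i)
  rwa [mul_assoc, inv_mul_cancel_left] at this

theorem mono {F F' : Finset M} {h h' : Fin 4 → Equiv.Perm M} (H : Agree c F' h h')
    (hF : F ⊆ F') : Agree c F h h' := fun i => fixer_anti hF (H i)

theorem mem {F : Finset M} {h h' : Fin 4 → Equiv.Perm M} (H : Agree c F h h')
    (hh : ∀ i, h i ∈ colourAut c) (i : Fin 4) : h' i ∈ colourAut c := by
  have := mul_mem (H i).1 (hh i)
  rwa [inv_mul_cancel_right] at this

theorem inv_apply {F : Finset M} {h h' : Fin 4 → Equiv.Perm M} (H : Agree c F h h') (i : Fin 4)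
    {x : M} (hx : x ∈ F) : (h' i)⁻¹ x = (h i)⁻¹ x := by
  have := (H.symm i).2 x hx
  rw [Equiv.Perm.mul_apply] at this
  exact Equiv.Perm.eq_inv_iff_eq.2 this

theorem apply_eq {F : Finset M} {h h' : Fin 4 → Equiv.Perm M} (H : Agree c F h h') (i : Fin 4)
    {x : M} (hx : h i x ∈ F) : h' i x = h i x := by
  have := (H i).2 _ hx
  rwa [Equiv.Perm.mul_apply, perm_inv_apply] at this

theorem of_inv_apply {F : Finset M} {h h' : Fin 4 → Equiv.Perm M} (hh : ∀ i, h i ∈ colourAut c)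
    (hh' : ∀ i, h' i ∈ colourAut c) (H : ∀ i, ∀ x ∈ F, (h' i)⁻¹ x = (h i)⁻¹ x) :
    Agree c F h h' := fun i =>
  ⟨mul_mem (hh' i) (inv_mem (hh i)), fun x hx => by
    rw [Equiv.Perm.mul_apply, ← H i x hx, perm_apply_inv]⟩

theorem conjOver {F : Finset M} {h h' : Fin 4 → Equiv.Perm M} (H : Agree c F h h') (i : Fin 4) :
    ConjOver c F (h i * k * (h i)⁻¹) (h' i * k * (h' i)⁻¹) :=
  ⟨_, H i, by group⟩

end Agree

theorem exists_agree_of_conjOver {F : Finset M} {h : Fin 4 → Equiv.Perm M}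
    {p₀ p₁ p₂ p₃ : Equiv.Perm M} (h₀ : ConjOver c F (h 0 * k * (h 0)⁻¹) p₀)
    (h₁ : ConjOver c F (h 1 * k * (h 1)⁻¹) p₁) (h₂ : ConjOver c F (h 2 * k * (h 2)⁻¹) p₂)
    (h₃ : ConjOver c F (h 3 * k * (h 3)⁻¹) p₃) :
    ∃ h', Agree c F h h' ∧ h' 0 * k * (h' 0)⁻¹ = p₀ ∧ h' 1 * k * (h' 1)⁻¹ = p₁ ∧
      h' 2 * k * (h' 2)⁻¹ = p₂ ∧ h' 3 * k * (h' 3)⁻¹ = p₃ := by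
  obtain ⟨a₀, ha₀, rfl⟩ := h₀
  obtain ⟨a₁, ha₁, rfl⟩ := h₁
  obtain ⟨a₂, ha₂, rfl⟩ := h₂
  obtain ⟨a₃, ha₃, rfl⟩ := h₃
  refine ⟨![a₀ * h 0, a₁ * h 1, a₂ * h 2, a₃ * h 3], ?_, ?_, ?_, ?_, ?_⟩
  · intro i
    fin_cases i <;> simpa
  all_goals exact conj_conj _ _ _

/-- The value of `conjProd k h` at finitely many points is determined by the inverses of `h` on a
finite set. -/
theorem exists_forall_agree_conjProd_eq (k : Equiv.Perm M) (h : Fin 4 → Equiv.Perm M)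
    (E : Finset M) : ∃ F : Finset M, ∀ h', Agree c F h h' →
      ∀ x ∈ E, conjProd k h' x = conjProd k h x := by
  classical
  set p : Fin 4 → Equiv.Perm M := fun i => h i * k * (h i)⁻¹ with hp
  set E₁ := E.image (p 0)
  set E₂ := E₁.image (p 1)
  set E₃ := E₂.image (p 2)
  set E₄ := E₃.image (p 3)
  refine ⟨E ∪ E₁ ∪ E₂ ∪ E₃ ∪ E₄, fun h' H x hx => ?_⟩
  have m₁ : p 0 x ∈ E₁ := Finset.mem_image_of_mem _ hx
  have m₂ : p 1 (p 0 x) ∈ E₂ := Finset.mem_image_of_mem _ m₁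
  have m₃ : p 2 (p 1 (p 0 x)) ∈ E₃ := Finset.mem_image_of_mem _ m₂
  have m₄ : p 3 (p 2 (p 1 (p 0 x))) ∈ E₄ := Finset.mem_image_of_mem _ m₃
  have e₀ : (h' 0 * k * (h' 0)⁻¹) x = p 0 x := (H.conjOver 0).apply_eq (by simp [hx])
    (by simp only [Finset.mem_union]; tauto)
  have e₁ : (h' 1 * k * (h' 1)⁻¹) (p 0 x) = p 1 (p 0 x) := (H.conjOver 1).apply_eq
    (by simp only [Finset.mem_union]; tauto) (by simp only [Finset.mem_union]; tauto)
  have e₂ : (h' 2 * k * (h' 2)⁻¹) (p 1 (p 0 x)) = p 2 (p 1 (p 0 x)) := (H.conjOver 2).apply_eq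
    (by simp only [Finset.mem_union]; tauto) (by simp only [Finset.mem_union]; tauto)
  have e₃ : (h' 3 * k * (h' 3)⁻¹) (p 2 (p 1 (p 0 x))) = p 3 (p 2 (p 1 (p 0 x))) :=
    (H.conjOver 3).apply_eq
      (by simp only [Finset.mem_union]; tauto) (by simp only [Finset.mem_union]; tauto)
  change (h' 3 * k * (h' 3)⁻¹) ((h' 2 * k * (h' 2)⁻¹) ((h' 1 * k * (h' 1)⁻¹)
    ((h' 0 * k * (h' 0)⁻¹) x))) = p 3 (p 2 (p 1 (p 0 x)))
  rw [e₀, e₁, e₂, e₃]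

theorem DenseOver.mono {h : Fin 4 → Equiv.Perm M} {F E E' : Finset M}
    (H : DenseOver c k h F E) (hE : E ⊆ E') : DenseOver c k h F E' :=
  fun e he hag => H e he fun x hx => hag x (hE hx)

/-- The existence of a chain starting at `E` makes products of conjugates dense. -/
theorem IsChain.denseOver (hM : IsGeneric ok c) {F Y₀ Y₁ Y₂ Y₃ Y₄ : Finset M}
    {h : Fin 4 → Equiv.Perm M}
    (H : IsChain c F Y₀ Y₁ Y₂ Y₃ Y₄ (h 0 * k * (h 0)⁻¹) (h 1 * k * (h 1)⁻¹) (h 2 * k * (h 2)⁻¹)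
      (h 3 * k * (h 3)⁻¹)) : DenseOver c k h F Y₀ := by
  classical
  intro e he hag E
  obtain ⟨Y₀', -, -, -, -, p₀, p₁, p₂, p₃, -, ⟨h₀, h₁, h₂, h₃⟩, hE, hag'⟩ :=
    H.extend_finset hM he (fun x hx => (hag x hx).symm) E
  obtain ⟨h', hh', rfl, rfl, rfl, rfl⟩ := exists_agree_of_conjOver h₀ h₁ h₂ h₃
  exact ⟨h', hh', fun x hx => hag' x (hE hx)⟩

/-- A partial solution of the equation `conjProd k right = f * conjProd k left`: it holds on the
finite set `dom`, the inverses of `left` and `right` are committed to on the finite sets `leftSet`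
and `rightSet`, and `left` can still be modified to make its product approximate any automorphism
that extends the restriction of this product to `dom`. -/
structure IsPosition (c : M → M → Option Colour) (k f : Equiv.Perm M)
    (left right : Fin 4 → Equiv.Perm M) (leftSet dom : Finset M) : Prop where
  left_mem : ∀ i, left i ∈ colourAut c
  right_mem : ∀ i, right i ∈ colourAut c
  dense : DenseOver c k left leftSet dom
  eqOn : ∀ x ∈ dom, conjProd k right x = f (conjProd k left x)

/-- `h'`, with commitments on `F'`, refines `h` with commitments on `F`, and is committed on `X` in
both directions. -/
structure Refines (c : M → M → Option Colour) (X : Finset M) (h : Fin 4 → Equiv.Perm M)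
    (F : Finset M) (h' : Fin 4 → Equiv.Perm M) (F' : Finset M) : Prop where
  agree : Agree c F h h'
  subset : F ⊆ F'
  mem : ∀ x ∈ X, x ∈ F' ∧ ∀ i, h' i x ∈ F'

namespace IsGeneric

variable (hM : IsGeneric ok c) (hk : IsMover c k)
include hM hk

theorem exists_denseOver {h : Fin 4 → Equiv.Perm M} (hh : ∀ i, h i ∈ colourAut c)
    (F : Finset M) : ∃ h', Agree c F h h' ∧ ∃ E, DenseOver c k h' F E := by
  classical
  obtain ⟨Y₀, _, _, _, _, _, _, _, _, hch, h₀, h₁, h₂, h₃⟩ := hM.exists_isChain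
    (hk.conj (hh 0)) (hk.conj (hh 1)) (hk.conj (hh 2)) (hk.conj (hh 3)) F
  obtain ⟨h', hh', rfl, rfl, rfl, rfl⟩ := exists_agree_of_conjOver h₀ h₁ h₂ h₃
  exact ⟨h', hh', Y₀, hch.denseOver hM⟩

theorem denseOver_empty : DenseOver c k 1 ∅ ∅ := by
  have h1 : ∀ i : Fin 4,
      IsMover c ((1 : Fin 4 → Equiv.Perm M) i * k * ((1 : Fin 4 → Equiv.Perm M) i)⁻¹) :=
    fun i => hk.conj (one_mem _)
  refine IsChain.denseOver (Y₁ := ∅) (Y₂ := ∅) (Y₃ := ∅) (Y₄ := ∅) hM ?_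
  constructor
  exacts [h1 0, h1 1, h1 2, h1 3, Finset.empty_subset _, Finset.empty_subset _,
    Finset.empty_subset _, Finset.empty_subset _, Finset.empty_subset _, by simp, by simp, by simp,
    by simp, by simp, by simp, by simp, by simp, by simp]

/-- One half of a step of the back-and-forth: the right-hand side is committed on a finite set
containing `X` and modified so as to have dense products, and the left-hand side is then adapted.
The two sides exchange their roles, with `f⁻¹` in place of `f`. -/
theorem exists_halfStep [DecidableEq M] (hf : f ∈ colourAut c) {l r : Fin 4 → Equiv.Perm M} {F G E : Finset M}
    (hP : IsPosition c k f l r F E) (X : Finset M) :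
    ∃ l' r' G' E', IsPosition c k f⁻¹ r' l' G' E' ∧ Agree c F l l' ∧ Refines c X r G r' G' ∧
      E ∪ X ⊆ E' ∧ ∀ r'', Agree c G' r' r'' →
        ∀ x ∈ E ∪ X, conjProd k r'' x = conjProd k r x := by
  -- Agreement on `L` preserves the equation on `E`, where `dense` needs it.
  obtain ⟨L, hL⟩ := exists_forall_agree_conjProd_eq (c := c) k r (E ∪ X)
  set G' := G ∪ L ∪ X ∪ Finset.univ.biUnion fun i => X.image (r i) with hG'
  have hL' : L ⊆ G' := fun x hx => by simp [hG', hx]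
  have hG : G ⊆ G' := fun x hx => by simp [hG', hx]
  obtain ⟨r', hr', E₁, hE₁⟩ := hM.exists_denseOver hk hP.right_mem G'
  have lock : ∀ r'', Agree c G' r' r'' → ∀ x ∈ E ∪ X, conjProd k r'' x = conjProd k r x :=
    fun r'' h => hL r'' ((hr'.trans h).mono hL')
  have hr'm := hr'.mem hP.right_mem
  have hprod : conjProd k r' ∈ colourAut c :=
    mul_mem (mul_mem (mul_mem (hk.conj (hr'm 3)).mem (hk.conj (hr'm 2)).mem)
      (hk.conj (hr'm 1)).mem) (hk.conj (hr'm 0)).mem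
  -- By density, the left-hand side can follow the right-hand side on `E₁`.
  obtain ⟨l', hl', hag⟩ := hP.dense (f⁻¹ * conjProd k r') (mul_mem (inv_mem hf) hprod)
    (fun x hx => by
      rw [Equiv.Perm.mul_apply, lock r' (.refl _ _) x (Finset.mem_union_left _ hx), hP.eqOn x hx,
        perm_inv_apply]) (E₁ ∪ (E ∪ X))
  refine ⟨l', r', G', E₁ ∪ (E ∪ X), ⟨hr'm, hl'.mem hP.left_mem,
    hE₁.mono Finset.subset_union_left, fun x hx => by rw [hag x hx, Equiv.Perm.mul_apply]⟩, hl',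
    ⟨hr'.mono hG, hG, fun x hx => ⟨by simp [hG', hx], fun i => ?_⟩⟩,
    Finset.subset_union_right, lock⟩
  have hmem : r i x ∈ G' := Finset.mem_union_right _ (Finset.mem_biUnion.2
    ⟨i, Finset.mem_univ _, Finset.mem_image_of_mem _ hx⟩)
  rwa [hr'.apply_eq i hmem]

/-- A full step of the back-and-forth. Afterwards the product of the left-hand side is committed on
`X`, and that of the right-hand side on the previous domain. -/
theorem exists_step (hf : f ∈ colourAut c) {l r : Fin 4 → Equiv.Perm M} {F G E : Finset M}
    (hP : IsPosition c k f l r F E) (X : Finset M) :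
    ∃ l' r' F' G' E', IsPosition c k f l' r' F' E' ∧ Refines c X l F l' F' ∧
      Refines c X r G r' G' ∧ X ⊆ E' ∧
      (∀ l'', Agree c F' l' l'' → ∀ x ∈ X, conjProd k l'' x = conjProd k l' x) ∧
      ∀ r'', Agree c G' r' r'' → ∀ x ∈ E, conjProd k r'' x = conjProd k r x := by
  classical
  obtain ⟨l₁, r₁, G₁, E₁, hP₁, hl, hr, hE, lock⟩ :=
    hM.exists_halfStep hk hf (G := G) hP X
  obtain ⟨r₂, l₂, F₂, E₂, hP₂, hr', hl', hE', lock'⟩ :=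
    hM.exists_halfStep hk (inv_mem hf) (G := F) hP₁ X
  rw [inv_inv] at hP₂
  have hX : X ⊆ E₂ := Finset.subset_union_right.trans hE'
  refine ⟨l₂, r₂, F₂, G₁, E₂, hP₂, ⟨?_, hl'.subset, hl'.mem⟩, ⟨?_, hr.subset, fun x hx =>
    ⟨(hr.mem x hx).1, fun i => ?_⟩⟩, hX, ?_, ?_⟩
  · exact hl.trans hl'.agree
  · exact hr.agree.trans (hr'.mono hr.subset)
  · rw [hr'.apply_eq i ((hr.mem x hx).2 i)]
    exact (hr.mem x hx).2 i
  · intro l'' h x hx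
    rw [lock' l'' h x (Finset.mem_union_right _ hx),
      lock' l₂ (.refl _ _) x (Finset.mem_union_right _ hx)]
  · intro r'' h x hx
    exact lock r'' (hr'.trans h) x (Finset.mem_union_left _ hx)

/-- Every automorphism is the quotient of two products of four conjugates of a mover. -/
theorem exists_conjProd_eq_mul [Countable M] [Nonempty M] (hf : f ∈ colourAut c) :
    ∃ l r : Fin 4 → Equiv.Perm M, (∀ i, l i ∈ colourAut c) ∧ (∀ i, r i ∈ colourAut c) ∧
      conjProd k r = f * conjProd k l := by
  classical
  obtain ⟨enum, henum⟩ := exists_surjective_nat M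
  have step : ∀ (n : ℕ) (P : {P : (Fin 4 → Equiv.Perm M) × (Fin 4 → Equiv.Perm M) × Finset M ×
      Finset M × Finset M // IsPosition c k f P.1 P.2.1 P.2.2.1 P.2.2.2.2}),
      ∃ Q : {P : (Fin 4 → Equiv.Perm M) × (Fin 4 → Equiv.Perm M) × Finset M ×
      Finset M × Finset M // IsPosition c k f P.1 P.2.1 P.2.2.1 P.2.2.2.2},
      Refines c {enum n} P.1.1 P.1.2.2.1 Q.1.1 Q.1.2.2.1 ∧
      Refines c {enum n} P.1.2.1 P.1.2.2.2.1 Q.1.2.1 Q.1.2.2.2.1 ∧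
      {enum n} ⊆ Q.1.2.2.2.2 ∧
      (∀ l'', Agree c Q.1.2.2.1 Q.1.1 l'' →
        ∀ x ∈ ({enum n} : Finset M), conjProd k l'' x = conjProd k Q.1.1 x) ∧
      ∀ r'', Agree c Q.1.2.2.2.1 Q.1.2.1 r'' →
        ∀ x ∈ P.1.2.2.2.2, conjProd k r'' x = conjProd k P.1.2.1 x := by
    rintro n ⟨⟨l, r, F, G, E⟩, hP⟩
    obtain ⟨l', r', F', G', E', hP', h⟩ := hM.exists_step hk hf (G := G) hP {enum n}
    exact ⟨⟨⟨l', r', F', G', E'⟩, hP'⟩, h⟩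
  choose next hnext using step
  have hinit : IsPosition c k f 1 1 ∅ ∅ :=
    ⟨fun _ => one_mem _, fun _ => one_mem _, hM.denseOver_empty hk, by simp⟩
  let seq := fun n : ℕ => Nat.rec (motive := fun _ => {P : (Fin 4 → Equiv.Perm M) ×
    (Fin 4 → Equiv.Perm M) × Finset M × Finset M × Finset M //
      IsPosition c k f P.1 P.2.1 P.2.2.1 P.2.2.2.2}) ⟨⟨1, 1, ∅, ∅, ∅⟩, hinit⟩ next n
  have hseq : ∀ n, seq (n + 1) = next n (seq n) := fun n => rfl
  have hstep := fun n => hnext n (seq n)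
  simp only [← hseq] at hstep
  generalize seq = s at hstep
  have limit : ∀ (h : ℕ → Fin 4 → Equiv.Perm M) (F : ℕ → Finset M),
      (∀ n i, h n i ∈ colourAut c) →
      (∀ n, Refines c {enum n} (h n) (F n) (h (n + 1)) (F (n + 1))) →
      ∃ l : Fin 4 → Equiv.Perm M, (∀ i, l i ∈ colourAut c) ∧ ∀ n, Agree c (F n) (h n) l := by
    intro h F hh hR
    have := fun i => exists_limit_mem_colourAut (c := c) (fun n => h n i) F (fun n => hh n i)
      (fun n => (hR n).subset) (fun n x hx => (hR n).agree.inv_apply i hx) (fun x => by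
        obtain ⟨n, rfl⟩ := henum x
        have := (hR n).mem _ (Finset.mem_singleton_self _)
        exact ⟨n + 1, this.1, this.2 i⟩)
    choose l hl hl' using this
    exact ⟨l, hl, fun n => .of_inv_apply (hh n) hl fun i x hx => hl' i n x hx⟩
  obtain ⟨l, hl, hl'⟩ := limit (fun n => (s n).1.1) (fun n => (s n).1.2.2.1)
    (fun n => (s n).2.left_mem) (fun n => (hstep n).1)
  obtain ⟨r, hr, hr'⟩ := limit (fun n => (s n).1.2.1) (fun n => (s n).1.2.2.2.1)
    (fun n => (s n).2.right_mem) (fun n => (hstep n).2.1)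
  refine ⟨l, r, hl, hr, Equiv.ext fun x => ?_⟩
  obtain ⟨n, rfl⟩ := henum x
  have hmem := (hstep n).2.2.1 (Finset.mem_singleton_self _)
  rw [(hstep (n + 1)).2.2.2.2 r (hr' (n + 2)) _ hmem, Equiv.Perm.mul_apply,
    (hstep n).2.2.2.1 l (hl' (n + 1)) _ (Finset.mem_singleton_self _)]
  exact (s (n + 1)).2.eqOn _ hmem

omit hk in
/-- A subgroup that is normalised by the automorphisms and contains a nontrivial automorphism
contains all of them. -/
theorem mem_of_normalised [Countable M] {g : Equiv.Perm M} (hg : g ∈ colourAut c) (hg1 : g ≠ 1)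
    {N : Subgroup (Equiv.Perm M)} (hgN : g ∈ N)
    (hN : ∀ a ∈ colourAut c, ∀ n ∈ N, a * n * a⁻¹ ∈ N) (hf : f ∈ colourAut c) : f ∈ N := by
  cases isEmpty_or_nonempty M
  · rw [Subsingleton.elim f 1]
    exact one_mem _
  obtain ⟨h, hh, hmoves⟩ := hM.exists_moves_redColours hg hg1
  have hk : IsMover c (g⁻¹ * (h * g * h⁻¹)) :=
    ⟨mul_mem (inv_mem hg) (conj_mem_colourAut hh hg), hmoves⟩
  have hkN : g⁻¹ * (h * g * h⁻¹) ∈ N := mul_mem (inv_mem hgN) (hN h hh g hgN)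
  have hprod : ∀ u : Fin 4 → Equiv.Perm M, (∀ i, u i ∈ colourAut c) →
      conjProd (g⁻¹ * (h * g * h⁻¹)) u ∈ N := fun u hu =>
    mul_mem (mul_mem (mul_mem (hN _ (hu 3) _ hkN) (hN _ (hu 2) _ hkN)) (hN _ (hu 1) _ hkN))
      (hN _ (hu 0) _ hkN)
  obtain ⟨l, r, hl, hr, heq⟩ := hM.exists_conjProd_eq_mul hk hf
  rw [eq_mul_inv_of_mul_eq heq.symm]
  exact mul_mem (hprod r hr) (inv_mem (hprod l hl))

end IsGeneric

end

/-! ### Complete structures as colourings -/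

section

open FirstOrder.Language

variable {M N : Type*} [Lang.Structure M] [Lang.Structure N] {ok : Colour → Prop}

open Classical in
/-- The colouring of the pairs of points of a structure: some relation holding between the two points,
if there is one. For complete structures this involves no choice. -/
noncomputable def colour (M : Type*) [Lang.Structure M] (a b : M) : Option Colour :=
  if h : ∃ k : Colour, Rel k a b then some h.choose else none

/-- The structure with the relations given by a colouring. -/
@[reducible]
def ofColouring {α : Type*} (c : α → α → Option Colour) : Lang.Structure α where
  funMap := fun f _ => isEmptyElim f
  RelMap := fun {_} r =>
    match r with
    | EdgeRel.edge k => fun x => c (x 0) (x 1) = some k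

theorem IsComplete.colour_eq_some_iff (hM : IsComplete M) {a b : M} {k : Colour} :
    colour M a b = some k ↔ Rel k a b := by
  have huniq : ∀ k l, Rel k a b → Rel l a b → k = l := fun k l hk hl => by
    have hne : a ≠ b := by
      rintro rfl
      exact hM.irrefl k a hk
    exact (hM.existsUnique a b hne).unique hk hl
  unfold colour
  split_ifs with h
  · rw [Option.some_inj]
    exact ⟨fun e => e ▸ h.choose_spec, fun hk => huniq _ _ h.choose_spec hk⟩
  · exact ⟨fun e => by simp at e, fun hk => absurd ⟨k, hk⟩ h⟩

/-- Directed `G`-paths of length two obey the path rule `ok`. -/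
def ObeysRule (ok : Colour → Prop) (M : Type*) [Lang.Structure M] : Prop :=
  ∀ (x y z : M) (k : Colour), Rel .Gpos x y → Rel .Gpos y z → Rel k x z → ok k

theorem IsComplete.isColouring (hM : IsComplete M) (hok : ObeysRule ok M) :
    IsColouring ok (colour M) where
  eq_none a b := by
    constructor
    · intro h
      by_contra hne
      obtain ⟨k, hk, -⟩ := hM.existsUnique a b hne
      rw [hM.colour_eq_some_iff.2 hk] at h
      cases h
    · rintro rfl
      by_contra h
      obtain ⟨k, hk⟩ := Option.ne_none_iff_exists'.1 h
      exact hM.irrefl k a (hM.colour_eq_some_iff.1 hk)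
  conv a b := by
    ext k
    rw [hM.colour_eq_some_iff, hM.conv, Option.map_eq_some_iff]
    constructor
    · exact fun h => ⟨k.conv, hM.colour_eq_some_iff.2 h, k.conv_conv⟩
    · rintro ⟨l, hl, rfl⟩
      rw [Colour.conv_conv]
      exact hM.colour_eq_some_iff.1 hl
  path x y z k h₁ h₂ h₃ := hok x y z k (hM.colour_eq_some_iff.1 h₁)
    (hM.colour_eq_some_iff.1 h₂) (hM.colour_eq_some_iff.1 h₃)

theorem IsColouring.isComplete_and_obeysRule {α : Type*} {c : α → α → Option Colour}
    (hc : IsColouring ok c) :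
    let _ := ofColouring c
    IsComplete α ∧ ObeysRule ok α ∧ colour α = c := by
  let _ := ofColouring c
  have hrel : ∀ k (a b : α), Rel k a b ↔ c a b = some k := fun k a b => Iff.rfl
  have hcomp : IsComplete α :=
    { irrefl := fun k a => by rw [hrel, hc.self]; simp
      existsUnique := fun a b hne => by
        obtain ⟨k, hk⟩ := hc.exists_eq hne
        exact ⟨k, (hrel _ _ _).2 hk, fun l hl => by
          have hl : c a b = some l := hl
          rw [hk] at hl
          exact (Option.some_inj.1 hl).symm⟩
      conv := fun k a b => by rw [hrel, hrel, hc.swap_iff] }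
  refine ⟨hcomp, fun x y z k h₁ h₂ h₃ => hc.path x y z k h₁ h₂ h₃, ?_⟩
  funext a b
  ext k
  rw [hcomp.colour_eq_some_iff, hrel]

theorem rel_embedding_iff (f : M ↪[Lang] N) (k : Colour) (a b : M) :
    Rel k (f a) (f b) ↔ Rel k a b := by
  have := f.map_rel (EdgeRel.edge k : Lang.Relations 2) ![a, b]
  rwa [show f ∘ ![a, b] = ![f a, f b] by ext i; fin_cases i <;> rfl] at this

theorem colour_embedding (hM : IsComplete M) (hN : IsComplete N) (f : M ↪[Lang] N) (a b : M) :
    colour N (f a) (f b) = colour M a b := by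
  ext k
  rw [hM.colour_eq_some_iff, hN.colour_eq_some_iff, rel_embedding_iff]

theorem IsComplete.of_embedding (hN : IsComplete N) (f : M ↪[Lang] N) : IsComplete M where
  irrefl k a h := hN.irrefl k (f a) ((rel_embedding_iff f k a a).2 h)
  existsUnique a b hne := by
    simp only [← rel_embedding_iff f]
    exact hN.existsUnique _ _ fun h => hne (f.injective h)
  conv k a b := by rw [← rel_embedding_iff f, hN.conv, rel_embedding_iff]

theorem ObeysRule.of_embedding (hN : ObeysRule ok N) (f : M ↪[Lang] N) : ObeysRule ok M :=
  fun x y z k h₁ h₂ h₃ => hN (f x) (f y) (f z) k ((rel_embedding_iff f _ _ _).2 h₁)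
    ((rel_embedding_iff f _ _ _).2 h₂) ((rel_embedding_iff f _ _ _).2 h₃)

theorem relMap_comp_iff (hM : IsComplete M) (hN : IsComplete N) {f : M → N}
    (hf : ∀ a b, colour N (f a) (f b) = colour M a b) {n : ℕ} (r : Lang.Relations n)
    (x : Fin n → M) : Structure.RelMap r (f ∘ x) ↔ Structure.RelMap r x := by
  cases r with
  | edge k =>
    have h₁ : x = ![x 0, x 1] := by ext i; fin_cases i <;> rfl
    have h₂ : f ∘ x = ![f (x 0), f (x 1)] := by ext i; fin_cases i <;> rfl
    rw [h₂]
    nth_rw 3 [h₁]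
    change Rel k _ _ ↔ Rel k _ _
    rw [← hM.colour_eq_some_iff, ← hN.colour_eq_some_iff, hf]

/-- A map between complete structures that preserves colours is an embedding. -/
theorem exists_embedding_of_colour_eq (hM : IsComplete M) (hN : IsComplete N) {f : M → N}
    (hf : ∀ a b, colour N (f a) (f b) = colour M a b) : ∃ g : M ↪[Lang] N, ∀ a, g a = f a := by
  have hcM : IsColouring (fun _ => True) (colour M) := hM.isColouring fun _ _ _ _ _ _ _ => trivial
  have hcN : IsColouring (fun _ => True) (colour N) := hN.isColouring fun _ _ _ _ _ _ _ => trivial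
  have hinj : Function.Injective f := fun a b hab => by
    rw [← hcM.eq_none, ← hf, hcN.eq_none, hab]
  exact ⟨{
    toFun := f
    inj' := hinj
    map_fun' := fun F _ => isEmptyElim F
    map_rel' := fun r x => relMap_comp_iff hM hN hf r x }, fun a => rfl⟩

theorem exists_equiv_of_mem_colourAut (hM : IsComplete M) {g : Equiv.Perm M}
    (hg : g ∈ colourAut (colour M)) : ∃ f : M ≃[Lang] M, f.toEquiv = g :=
  ⟨{ g with
    map_fun' := fun F _ => isEmptyElim F
    map_rel' := fun r x => relMap_comp_iff hM hM (f := g) hg r x }, rfl⟩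

theorem toEquiv_mem_colourAut (hM : IsComplete M) (f : M ≃[Lang] M) :
    f.toEquiv ∈ colourAut (colour M) :=
  fun a b => colour_embedding hM hM f.toEmbedding a b

end

/-! ### The generic structure -/

section

variable {M N : Type*} {ok : Colour → Prop} {c : M → M → Option Colour} {d : N → N → Option Colour}

/-- Every one-point extension of a finite partial map preserving colours is realised in a colouring
with the extension property. -/
theorem HasExtension.exists_extend (hd : HasExtension ok d) (hc : IsColouring ok c) {S : Finset M}
    {f : M → N} (hf : ∀ a ∈ S, ∀ b ∈ S, d (f a) (f b) = c a b)
    (hinj : Set.InjOn f S) (m : M) : ∃ v, ∀ a ∈ S, d v (f a) = c m a := by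
  classical
  by_cases hm : m ∈ S
  · exact ⟨f m, fun a ha => hf m hm a ha⟩
  have : Nonempty M := ⟨m⟩
  set q : M → Colour := fun a => (c m a).getD .Rpos
  have hq : ∀ a ∈ S, c m a = some (q a) := fun a ha => by
    obtain ⟨k, hk⟩ := hc.exists_eq (a := m) (b := a) (by rintro rfl; exact hm ha)
    simp [q, hk]
  have hleft : ∀ a ∈ S, Function.invFunOn f S (f a) = a := hinj.leftInvOn_invFunOn
  have hcons := hc.consistent_of_type (W := S) m hq
  obtain ⟨v, hv⟩ := hd (S.image f) (fun w => q (Function.invFunOn f S w)) (by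
    intro u hu w hw
    obtain ⟨a, ha, rfl⟩ := Finset.mem_image.1 (Finset.mem_coe.1 hu)
    obtain ⟨b, hb, rfl⟩ := Finset.mem_image.1 (Finset.mem_coe.1 hw)
    simp only [hleft a ha, hleft b hb, hf a ha b hb]
    exact hcons a ha b hb)
  exact ⟨v, fun a ha => by rw [hv _ (Finset.mem_image_of_mem f ha), hleft a ha, hq a ha]⟩

theorem IsColouring.injOn (hc : IsColouring ok c) (hd : IsColouring ok d) {S : Finset M}
    {f : M → N} (hf : ∀ a ∈ S, ∀ b ∈ S, d (f a) (f b) = c a b) : Set.InjOn f S :=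
  fun a ha b hb hab => by rw [← hc.eq_none, ← hf a ha b hb, hd.eq_none, hab]

theorem HasExtension.nonempty (hd : HasExtension ok d) : Nonempty N :=
  let ⟨v, _⟩ := hd ∅ (fun _ => .Rpos) fun _ h => by simp at h
  ⟨v⟩

/-- Finite colourings obeying the path rule embed into those with the extension property. -/
theorem HasExtension.exists_embed (hd : HasExtension ok d) (hdc : IsColouring ok d)
    (hc : IsColouring ok c) (S : Finset M) :
    ∃ f : M → N, ∀ a ∈ S, ∀ b ∈ S, d (f a) (f b) = c a b := by
  classical
  induction S using Finset.induction_on with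
  | empty => exact ⟨fun _ => hd.nonempty.some, by simp⟩
  | insert m S hm ih =>
    obtain ⟨f, hf⟩ := ih
    obtain ⟨v, hv⟩ := hd.exists_extend hc hf (hc.injOn hdc hf) m
    have hne : ∀ a ∈ S, a ≠ m := fun a ha h => hm (h ▸ ha)
    refine ⟨Function.update f m v, fun a ha b hb => ?_⟩
    rcases Finset.mem_insert.1 ha with rfl | ha' <;>
      rcases Finset.mem_insert.1 hb with rfl | hb'
    · simp [hc.self, hdc.self]
    · simp [hne b hb', hv b hb']
    · rw [hdc.conv, hc.conv]
      simp [hne a ha', hv a ha']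
    · simp [hne a ha', hne b hb', hf a ha' b hb']

end

section

open FirstOrder.Language

variable {ok : Colour → Prop}

/-- By back-and-forth, a countable structure with the extension property is ultrahomogeneous. -/
theorem isUltrahomogeneous_of_hasExtension {M : Type*} [Lang.Structure M] [Countable M]
    (hM : IsComplete M) (hok : ObeysRule ok M) (hext : HasExtension ok (colour M)) :
    Lang.IsUltrahomogeneous M := by
  classical
  have hc := hM.isColouring hok
  rw [isUltrahomogeneous_iff_IsExtensionPair Structure.cg_of_countable,
    isExtensionPair_iff_exists_embedding_closure_singleton_sup]
  intro S hS f m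
  have : Finite S := hS.finite
  have hmem : ∀ x, x ∈ (Substructure.closure Lang {m} ⊔ S : Lang.Substructure M) →
      x ∉ S → x = m := by
    intro x hx hxS
    rw [← Substructure.closure_eq S, ← Substructure.closure_union,
      Substructure.mem_closure_iff_of_isRelational] at hx
    exact hx.resolve_right hxS
  set φ : M → M := fun x => if h : x ∈ S then f ⟨x, h⟩ else x with hφ
  have hφS : ∀ x (h : x ∈ S), φ x = f ⟨x, h⟩ := fun x h => dif_pos h
  have hcol : ∀ x ∈ S, ∀ y ∈ S, colour M (φ x) (φ y) = colour M x y := fun x hx y hy => by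
    rw [hφS x hx, hφS y hy]
    exact (colour_embedding (hM.of_embedding S.subtype) hM f _ _).trans
      (colour_embedding (hM.of_embedding S.subtype) hM S.subtype ⟨x, hx⟩ ⟨y, hy⟩).symm
  set T : Finset M := (Set.toFinite (S : Set M)).toFinset with hT
  have hTS : ∀ x, x ∈ T ↔ x ∈ S := fun x => by simp [hT]
  have hcolT : ∀ x ∈ T, ∀ y ∈ T, colour M (φ x) (φ y) = colour M x y := fun x hx y hy =>
    hcol x ((hTS x).1 hx) y ((hTS y).1 hy)
  obtain ⟨v, hv⟩ := hext.exists_extend hc hcolT (hc.injOn hc hcolT) m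
  obtain ⟨g, hg⟩ := exists_embedding_of_colour_eq
    (M := (Substructure.closure Lang {m} ⊔ S : Lang.Substructure M)) (N := M)
    (hM.of_embedding (Substructure.subtype _)) hM
    (f := fun x => if (x : M) ∈ S then φ x else v) (by
      rintro ⟨x, hx⟩ ⟨y, hy⟩
      rw [← colour_embedding (hM.of_embedding (Substructure.subtype _)) hM
        (Substructure.subtype _)]
      change colour M (if x ∈ S then φ x else v) (if y ∈ S then φ y else v) = colour M x y
      split_ifs with h₁ h₂ h₂
      · exact hcol x h₁ y h₂
      · rw [hmem y hy h₂, hc.conv v, hv x ((hTS x).2 h₁), ← hc.conv]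
      · rw [hmem x hx h₁, hv y ((hTS y).2 h₂)]
      · rw [hmem x hx h₁, hmem y hy h₂, hc.self, hc.self])
  refine ⟨g, Embedding.ext fun x => ?_⟩
  rw [Embedding.comp_apply, hg]
  have : ((Substructure.inclusion (le_sup_right : S ≤ Substructure.closure Lang {m} ⊔ S) x :
    (Substructure.closure Lang {m} ⊔ S : Lang.Substructure M)) : M) = x := rfl
  rw [this, if_pos x.2, hφS x x.2]

/-- In a relational language homogeneity may be stated for finite partial maps on points. -/
theorem isGeneric_of_isUltrahomogeneous {M : Type*} [Lang.Structure M] (hrule : IsPathRule ok)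
    (hM : IsComplete M) (hok : ObeysRule ok M) (hext : HasExtension ok (colour M))
    (hU : Lang.IsUltrahomogeneous M) : IsGeneric ok (colour M) where
  toIsColouring := hM.isColouring hok
  rule := hrule
  extension := hext
  homogeneous K φ hφ := by
    set S := Substructure.closure Lang (K : Set M)
    have hS : ∀ x : S, (x : M) ∈ K := fun x => by
      simpa using (Substructure.mem_closure_iff_of_isRelational Lang _ _).1 x.2
    have hcS := hM.of_embedding S.subtype
    obtain ⟨f, hf⟩ := exists_embedding_of_colour_eq (M := S) (N := M) hcS hM
      (f := fun x => φ x) (fun x y => by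
        rw [hφ x (hS x) y (hS y)]
        exact colour_embedding hcS hM S.subtype x y)
    obtain ⟨g, hg⟩ := hU S (Substructure.fg_closure K.finite_toSet) f
    refine ⟨g.toEquiv, toEquiv_mem_colourAut hM g, fun a ha => ?_⟩
    have := hf ⟨a, Substructure.subset_closure ha⟩
    rw [hg] at this
    exact this

/-- The countable generic structure obeying the path rule `ok`. -/
noncomputable def limitStructure (ok : Colour → Prop) : Bundled.{0} Lang.Structure :=
  ⟨ℕ, ofColouring (limitColouring ok)⟩

instance : Countable (limitStructure ok) := inferInstanceAs (Countable ℕ)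

/-- A complete structure omits the triangles in `S` exactly if it obeys the path rule `ok`; so
`Forb S` is the class of finite complete structures obeying this rule. -/
def IsForbRule (S : Set (Bundled.{0} Lang.Structure)) (ok : Colour → Prop) : Prop :=
  ∀ (M : Type) [Lang.Structure M], IsComplete M →
    ((∀ T ∈ S, IsEmpty (T ↪[Lang] M)) ↔ ObeysRule ok M)

variable {S : Set (Bundled.{0} Lang.Structure)}

theorem IsForbRule.mem_iff (hS : IsForbRule S ok) {M : Bundled.{0} Lang.Structure} :
    M ∈ Forb S ↔ Finite M ∧ IsComplete M ∧ ObeysRule ok M :=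
  and_congr_right fun _ => and_congr_right fun h => hS M h

theorem limitStructure_spec (hrule : IsPathRule ok) :
    IsComplete (limitStructure ok) ∧ ObeysRule ok (limitStructure ok) ∧
      HasExtension ok (colour (limitStructure ok)) := by
  obtain ⟨h₁, h₂, h₃⟩ := (isColouring_limitColouring hrule).isComplete_and_obeysRule
  refine ⟨h₁, h₂, ?_⟩
  have : colour (limitStructure ok) = limitColouring ok := h₃
  rw [this]
  exact hasExtension_limitColouring

theorem isFraisseLimit_limitStructure (hrule : IsPathRule ok) (hS : IsForbRule S ok) :
    IsFraisseLimit (Forb S) (limitStructure ok) where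
  ultrahomogeneous :=
    let ⟨h₁, h₂, h₃⟩ := limitStructure_spec hrule
    isUltrahomogeneous_of_hasExtension h₁ h₂ h₃
  age := by
    obtain ⟨h₁, h₂, h₃⟩ := limitStructure_spec hrule
    ext N
    rw [hS.mem_iff]
    constructor
    · rintro ⟨hfg, ⟨f⟩⟩
      exact ⟨hfg.finite, h₁.of_embedding f, h₂.of_embedding f⟩
    · rintro ⟨hfin, hN, hok⟩
      have := Fintype.ofFinite N
      obtain ⟨f, hf⟩ := h₃.exists_embed (h₁.isColouring h₂) (hN.isColouring hok) Finset.univ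
      obtain ⟨g, -⟩ := exists_embedding_of_colour_eq hN h₁ fun a b =>
        hf a (Finset.mem_univ _) b (Finset.mem_univ _)
      exact ⟨Structure.FG.of_finite, ⟨g⟩⟩

/-- By uniqueness of Fraïssé limits, each of them inherits the extension property from
`limitStructure ok`. -/
theorem IsForbRule.isGeneric (hrule : IsPathRule ok) (hS : IsForbRule S ok) {M : Type}
    [Lang.Structure M] [Countable M] (hM : IsFraisseLimit (Forb S) M) :
    IsComplete M ∧ ObeysRule ok M ∧ IsGeneric ok (colour M) := by
  obtain ⟨e⟩ := hM.nonempty_equiv (isFraisseLimit_limitStructure hrule hS)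
  obtain ⟨h₁, h₂, h₃⟩ := limitStructure_spec hrule
  have hc : IsComplete M := h₁.of_embedding e.toEmbedding
  have hok : ObeysRule ok M := h₂.of_embedding e.toEmbedding
  have hcol : ∀ a b, colour _ (e a) (e b) = colour M a b := colour_embedding hc h₁ e.toEmbedding
  refine ⟨hc, hok, isGeneric_of_isUltrahomogeneous hrule hc hok (fun W q hq => ?_)
    hM.ultrahomogeneous⟩
  classical
  obtain ⟨v, hv⟩ := h₃ (W.image e) (fun w => q (e.symm w)) (by
    intro u hu w hw
    obtain ⟨a, ha, rfl⟩ := Finset.mem_image.1 (Finset.mem_coe.1 hu)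
    obtain ⟨b, hb, rfl⟩ := Finset.mem_image.1 (Finset.mem_coe.1 hw)
    simp only [FirstOrder.Language.Equiv.symm_apply_apply, hcol]
    exact hq a ha b hb)
  refine ⟨e.symm v, fun w hw => ?_⟩
  rw [← hcol, FirstOrder.Language.Equiv.apply_symm_apply, hv _ (Finset.mem_image_of_mem _ hw),
    FirstOrder.Language.Equiv.symm_apply_apply]

end

/-! ### Triangles -/

section

open FirstOrder.Language

variable {ok : Colour → Prop} {S : Set (Bundled.{0} Lang.Structure)}

theorem rel_triangle_iff {p q s k : Colour} {a b : Fin 3} :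
    Rel (M := triangle p q s) k a b ↔ triangleColour p q s a b = some k := Iff.rfl

theorem isComplete_triangle (p q s : Colour) : IsComplete (triangle p q s) where
  irrefl k := show ∀ a : Fin 3, ¬ Rel (M := triangle p q s) k a a from fun a => by
    rw [rel_triangle_iff]
    fin_cases a <;> simp [triangleColour]
  existsUnique := show ∀ a b : Fin 3, a ≠ b → ∃! k, Rel (M := triangle p q s) k a b from
    fun a b hab => by
      simp only [rel_triangle_iff]
      fin_cases a <;> fin_cases b <;> simp [triangleColour] at hab ⊢
  conv k := show ∀ a b : Fin 3, Rel (M := triangle p q s) k a b ↔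
      Rel (M := triangle p q s) k.conv b a from fun a b => by
    simp only [rel_triangle_iff]
    fin_cases a <;> fin_cases b <;> simp [triangleColour, Colour.conv_eq_iff]

/-- In a complete structure, a copy of the triangle `p q s` is given by its three edges. -/
theorem nonempty_triangle_embedding_iff {M : Type*} [Lang.Structure M] (hM : IsComplete M)
    (p q s : Colour) : Nonempty (triangle p q s ↪[Lang] M) ↔
      ∃ a b c : M, Rel p a b ∧ Rel q a c ∧ Rel s b c := by
  constructor
  · rintro ⟨f⟩
    exact ⟨f (0 : Fin 3), f (1 : Fin 3), f (2 : Fin 3), (rel_embedding_iff f _ _ _).2 rfl,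
      (rel_embedding_iff f _ _ _).2 rfl, (rel_embedding_iff f _ _ _).2 rfl⟩
  · rintro ⟨a, b, c, hab, hac, hbc⟩
    have hcol : colour (triangle p q s) = triangleColour p q s := by
      funext x y
      ext k
      exact (isComplete_triangle p q s).colour_eq_some_iff
    have hc := hM.isColouring (ok := fun _ => True) fun _ _ _ _ _ _ _ => trivial
    have key : ∀ x y : Fin 3, colour M (![a, b, c] x) (![a, b, c] y) = triangleColour p q s x y := by
      rw [← hM.colour_eq_some_iff] at hab hac hbc
      intro x y
      fin_cases x <;> fin_cases y <;>
        simp [triangleColour, hc.self, hab, hac, hbc, hc.swap hab, hc.swap hac, hc.swap hbc]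
    obtain ⟨g, -⟩ := exists_embedding_of_colour_eq (M := triangle p q s)
      (isComplete_triangle p q s) hM (f := (![a, b, c] : Fin 3 → M)) (by rw [hcol]; exact key)
    exact ⟨g⟩

/-- With `R`-colour `k` on the pair `(0, 2)`, the only `G`-paths of length two of the triangle
`p k s` are those through the vertex `1`. -/
theorem obeysRule_triangle_iff {p k s : Colour} (hk : k = .Rpos ∨ k = .Rneg) :
    ObeysRule ok (triangle p k s) ↔
      (p = .Gpos → s = .Gpos → ok k) ∧ (p = .Gneg → s = .Gneg → ok k.conv) := by
  have key : ObeysRule ok (triangle p k s) ↔ ∀ (x y z : Fin 3) (l : Colour),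
      triangleColour p k s x y = some .Gpos → triangleColour p k s y z = some .Gpos →
        triangleColour p k s x z = some l → ok l := Iff.rfl
  rw [key]
  constructor
  · intro h
    refine ⟨?_, ?_⟩
    · rintro rfl rfl
      exact h 0 1 2 k rfl rfl rfl
    · rintro rfl rfl
      exact h 2 1 0 k.conv rfl rfl rfl
  · rintro ⟨h₁, h₂⟩ x y z l
    rcases hk with rfl | rfl <;> fin_cases x <;> fin_cases y <;> fin_cases z <;>
      simp [triangleColour, Colour.conv] at h₁ h₂ ⊢ <;> grind

/-- Every directed `G`-path of length two whose ends have colour `k` is a triangle `G⁺ k G⁺`. -/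
theorem isEmpty_triangle_Gpos_iff {M : Type*} [Lang.Structure M] (hM : IsComplete M) (k : Colour) :
    IsEmpty (triangle .Gpos k .Gpos ↪[Lang] M) ↔
      ∀ x y z : M, Rel .Gpos x y → Rel .Gpos y z → ¬ Rel k x z := by
  rw [← not_nonempty_iff, nonempty_triangle_embedding_iff hM]
  constructor
  · exact fun h x y z h₁ h₂ h₃ => h ⟨x, y, z, h₁, h₃, h₂⟩
  · rintro h ⟨x, y, z, h₁, h₃, h₂⟩
    exact h x y z h₁ h₂ h₃

/-- The triangle `R⁺ G⁻ G⁺` is isomorphic to `G⁺ R⁻ G⁺`. -/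
theorem isEmpty_triangle_Rpos_iff {M : Type*} [Lang.Structure M] (hM : IsComplete M) :
    IsEmpty (triangle .Rpos .Gneg .Gpos ↪[Lang] M) ↔
      ∀ x y z : M, Rel .Gpos x y → Rel .Gpos y z → ¬ Rel .Rneg x z := by
  rw [← not_nonempty_iff, nonempty_triangle_embedding_iff hM]
  constructor
  · exact fun h x y z h₁ h₂ h₃ => h ⟨z, x, y, (hM.conv _ _ _).1 h₃, (hM.conv _ _ _).1 h₂, h₁⟩
  · rintro h ⟨z, x, y, h₃, h₂, h₁⟩
    exact h x y z h₁ ((hM.conv _ _ _).1 h₂) ((hM.conv _ _ _).1 h₃)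

theorem isForbRule_cherlin8 : IsForbRule cherlin8 fun k => k = .Rpos ∨ k = .Gpos := by
  intro M _ hM
  simp only [cherlin8, Set.mem_insert_iff, Set.mem_singleton_iff, forall_eq_or_imp, forall_eq,
    isEmpty_triangle_Gpos_iff hM, isEmpty_triangle_Rpos_iff hM]
  refine ⟨fun ⟨h₁, h₂⟩ x y z k hxy hyz hk => ?_, fun h => ⟨fun x y z hxy hyz hk => ?_,
    fun x y z hxy hyz hk => ?_⟩⟩
  · cases k
    exacts [.inl rfl, (h₂ x y z hxy hyz hk).elim, .inr rfl, (h₁ x y z hxy hyz hk).elim]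
  all_goals simpa using h x y z _ hxy hyz hk

theorem isForbRule_cherlin9 : IsForbRule cherlin9 fun k => k = .Rpos ∨ k = .Gneg := by
  intro M _ hM
  simp only [cherlin9, Set.mem_insert_iff, Set.mem_singleton_iff, forall_eq_or_imp, forall_eq,
    isEmpty_triangle_Gpos_iff hM, isEmpty_triangle_Rpos_iff hM]
  refine ⟨fun ⟨h₁, h₂⟩ x y z k hxy hyz hk => ?_, fun h => ⟨fun x y z hxy hyz hk => ?_,
    fun x y z hxy hyz hk => ?_⟩⟩
  · cases k
    exacts [.inl rfl, (h₂ x y z hxy hyz hk).elim, (h₁ x y z hxy hyz hk).elim, .inr rfl]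
  all_goals simpa using h x y z _ hxy hyz hk

theorem isForbRule_cherlin10 : IsForbRule cherlin10 fun k => k = .Rpos := by
  intro M _ hM
  simp only [cherlin10, Set.mem_insert_iff, Set.mem_singleton_iff, forall_eq_or_imp, forall_eq,
    isEmpty_triangle_Gpos_iff hM, isEmpty_triangle_Rpos_iff hM]
  refine ⟨fun ⟨h₁, h₂, h₃⟩ x y z k hxy hyz hk => ?_, fun h => ⟨fun x y z hxy hyz hk => ?_,
    fun x y z hxy hyz hk => ?_, fun x y z hxy hyz hk => ?_⟩⟩
  · cases k
    exacts [rfl, (h₃ x y z hxy hyz hk).elim, (h₁ x y z hxy hyz hk).elim,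
      (h₂ x y z hxy hyz hk).elim]
  all_goals simpa using h x y z _ hxy hyz hk

theorem exists_isForbRule (hS : S = cherlin8 ∨ S = cherlin9 ∨ S = cherlin10) :
    ∃ ok, IsPathRule ok ∧ IsForbRule S ok ∧ ∀ T ∈ S, ∃ p q s, T = triangle p q s := by
  rcases hS with rfl | rfl | rfl
  · refine ⟨_, ⟨.inl rfl, fun k => ?_⟩, isForbRule_cherlin8, ?_⟩
    · cases k <;> simp [Colour.conv]
    · rintro T (rfl | rfl) <;> exact ⟨_, _, _, rfl⟩
  · refine ⟨_, ⟨.inl rfl, fun k => ?_⟩, isForbRule_cherlin9, ?_⟩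
    · cases k <;> simp [Colour.conv]
    · rintro T (rfl | rfl) <;> exact ⟨_, _, _, rfl⟩
  · refine ⟨fun k => k = .Rpos, ⟨rfl, fun k => ?_⟩, isForbRule_cherlin10, ?_⟩
    · cases k <;> simp [Colour.conv]
    · rintro T (rfl | rfl | rfl) <;> exact ⟨_, _, _, rfl⟩

/-- An embedding between three-point structures is an isomorphism, so a triangle is isomorphic to no
member of `S` exactly if it obeys the path rule. -/
theorem forall_isEmpty_equiv_iff (hS : IsForbRule S ok) (hT : ∀ T ∈ S, ∃ p q s, T = triangle p q s)
    (p k s : Colour) : (∀ T ∈ S, IsEmpty (T ≃[Lang] triangle p k s)) ↔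
      ObeysRule ok (triangle p k s) := by
  rw [← hS _ (isComplete_triangle p k s)]
  refine forall₂_congr fun T hTS => ?_
  obtain ⟨p', q', s', rfl⟩ := hT T hTS
  rw [← not_nonempty_iff, ← not_nonempty_iff, not_iff_not]
  refine ⟨fun ⟨e⟩ => ⟨e.toEmbedding⟩, fun ⟨e⟩ => ⟨?_⟩⟩
  have hbij : Function.Bijective e :=
    (Finite.injective_iff_bijective (α := Fin 3) (f := e)).1 e.injective
  exact
  { _root_.Equiv.ofBijective e hbij with
    map_fun' := fun F _ => isEmptyElim F
    map_rel' := fun r x => e.map_rel r x }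

theorem admissible_Rpos_iff (hrule : IsPathRule ok) (hS : IsForbRule S ok)
    (hT : ∀ T ∈ S, ∃ p q s, T = triangle p q s) {A B C : Bundled.{0} Lang.Structure}
    (f : B ↪[Lang] A) (g : B ↪[Lang] C) (a : A) (c : C) :
    Admissible S f g a c .Rpos ↔ ¬ ∃ b, Rel .Gneg a (f b) ∧ Rel .Gneg (g b) c := by
  simp only [Admissible, forall_isEmpty_equiv_iff hS hT, obeysRule_triangle_iff (.inl rfl)]
  constructor
  · rintro h ⟨b, h₁, h₂⟩
    exact hrule.not_rneg ((h b _ _ h₁ h₂).2 rfl rfl)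
  · refine fun h b p s h₁ h₂ => ⟨fun _ _ => hrule.rpos, ?_⟩
    rintro rfl rfl
    exact absurd ⟨b, h₁, h₂⟩ h

theorem admissible_Rneg_iff (hrule : IsPathRule ok) (hS : IsForbRule S ok)
    (hT : ∀ T ∈ S, ∃ p q s, T = triangle p q s) {A B C : Bundled.{0} Lang.Structure}
    (f : B ↪[Lang] A) (g : B ↪[Lang] C) (a : A) (c : C) :
    Admissible S f g a c .Rneg ↔ ¬ ∃ b, Rel .Gpos a (f b) ∧ Rel .Gpos (g b) c := by
  simp only [Admissible, forall_isEmpty_equiv_iff hS hT, obeysRule_triangle_iff (.inr rfl)]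
  constructor
  · rintro h ⟨b, h₁, h₂⟩
    exact hrule.not_rneg ((h b _ _ h₁ h₂).1 rfl rfl)
  · refine fun h b p s h₁ h₂ => ⟨?_, fun _ _ => hrule.rpos⟩
    rintro rfl rfl
    exact absurd ⟨b, h₁, h₂⟩ h

/-! ### Prioritised amalgamation -/

/-- The two colours `R⁺` and `R⁻` are never both forbidden. -/
theorem not_exists_Gneg_and_exists_Gpos (hrule : IsPathRule ok)
    {A B C : Bundled.{0} Lang.Structure} (f : B ↪[Lang] A) (g : B ↪[Lang] C) (hA : IsComplete A)
    (hC : IsComplete C) (hokA : ObeysRule ok A) (hokC : ObeysRule ok C) {a : A} {c : C}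
    (h : ∃ b, Rel .Gneg a (f b) ∧ Rel .Gneg (g b) c)
    (h' : ∃ b, Rel .Gpos a (f b) ∧ Rel .Gpos (g b) c) : False := by
  obtain ⟨b, h₁, h₂⟩ := h
  obtain ⟨b', h₃, h₄⟩ := h'
  have hne : b ≠ b' := by
    rintro rfl
    have h := (hA.colour_eq_some_iff.2 h₁).symm.trans (hA.colour_eq_some_iff.2 h₃)
    simp at h
  obtain ⟨k, hk, -⟩ := (hA.of_embedding f).existsUnique b b' hne
  refine hrule.asymm k (hokA (f b) a (f b') k ((hA.conv _ _ _).1 h₁) h₃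
    ((rel_embedding_iff f _ _ _).2 hk)) (hokC (g b') c (g b) k.conv h₄
    ((hC.conv _ _ _).1 h₂) ((hC.conv _ _ _).1 ((rel_embedding_iff g _ _ _).2 hk)))

/-- The prioritised amalgam is found inside the generic structure, by moving a copy of `A`, by an
automorphism fixing the copy of `B`, into standard position to a copy of `C`. -/
theorem exists_isPrioritisedAmalgam (hrule : IsPathRule ok) (hS : IsForbRule S ok)
    (hT : ∀ T ∈ S, ∃ p q s, T = triangle p q s) {M : Type} [Lang.Structure M] [Countable M]
    (hM : IsFraisseLimit (Forb S) M) {A B C : Bundled.{0} Lang.Structure}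
    (f : B ↪[Lang] A) (g : B ↪[Lang] C) (hA : A ∈ Forb S) (hB : B ∈ Forb S) (hC : C ∈ Forb S) :
    ∃ (D : Bundled.{0} Lang.Structure) (i : A ↪[Lang] D) (j : C ↪[Lang] D),
      D ∈ Forb S ∧ IsPrioritisedAmalgam S ![.Rpos, .Rneg] f g i j := by
  classical
  obtain ⟨hMc, hMok, hgen⟩ := hS.isGeneric hrule hM
  obtain ⟨i₀⟩ : Nonempty (A ↪[Lang] M) := (hM.age.symm ▸ hA : A ∈ Lang.age M).2
  have : Nonempty (C ↪[Lang] M) := (hM.age.symm ▸ hC : C ∈ Lang.age M).2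
  obtain ⟨hAf, hAc, hAok⟩ := hS.mem_iff.1 hA
  obtain ⟨hBf, hBc, hBok⟩ := hS.mem_iff.1 hB
  obtain ⟨hCf, hCc, hCok⟩ := hS.mem_iff.1 hC
  have := Fintype.ofFinite A
  have := Fintype.ofFinite B
  have := Fintype.ofFinite C
  obtain ⟨j₀, hj₀⟩ := hM.ultrahomogeneous.extend_embedding Structure.FG.of_finite (i₀.comp f) g
  have hfg : ∀ b, i₀ (f b) = j₀ (g b) := fun b => DFunLike.congr_fun hj₀ b
  set K : Finset M := Finset.univ.image (i₀.comp f) with hK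
  have hKA : ∀ a, i₀ a ∈ K ↔ a ∈ Set.range f := fun a => by
    simp [hK, i₀.injective.eq_iff]
  have hKC : ∀ c, j₀ c ∈ K ↔ c ∈ Set.range g := fun c => by
    simp [hK, hfg, j₀.injective.eq_iff]
  obtain ⟨α, hα, hstd⟩ := hgen.exists_fixer_std K (Finset.univ.image i₀) (Finset.univ.image j₀)
  obtain ⟨e, rfl⟩ := exists_equiv_of_mem_colourAut hMc hα.1
  have hfix : ∀ b, e (i₀ (f b)) = j₀ (g b) := fun b => by
    rw [← hfg]
    exact hα.2 _ ((hKA _).2 ⟨b, rfl⟩)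
  have hpath : ∀ a c, (∃ k ∈ K, colour M (j₀ c) k = some .Gpos ∧
      colour M k (i₀ a) = some .Gpos) ↔ ∃ b, Rel .Gneg a (f b) ∧ Rel .Gneg (g b) c := fun a c => by
    have h : ∀ b, (colour M (j₀ c) (i₀ (f b)) = some .Gpos ∧
        colour M (i₀ (f b)) (i₀ a) = some .Gpos) ↔ Rel .Gneg a (f b) ∧ Rel .Gneg (g b) c := fun b => by
      rw [hMc.colour_eq_some_iff, hMc.colour_eq_some_iff, rel_embedding_iff, hfg,
        rel_embedding_iff, hAc.conv, hCc.conv, and_comm]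
      rfl
    constructor
    · rintro ⟨k, hk, hk'⟩
      obtain ⟨b, -, rfl⟩ := Finset.mem_image.1 hk
      exact ⟨b, (h b).1 hk'⟩
    · rintro ⟨b, hb⟩
      exact ⟨_, (hKA _).2 ⟨b, rfl⟩, (h b).2 hb⟩
  have hneg : ∀ a ∉ Set.range f, ∀ c ∉ Set.range g,
      (∃ b, Rel .Gneg a (f b) ∧ Rel .Gneg (g b) c) → Rel .Rneg (e (i₀ a)) (j₀ c) :=
    fun a ha c hc h => hMc.colour_eq_some_iff.1 ((hstd (i₀ a) (by simp) (by rwa [hKA]) (j₀ c)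
      (by simp) (by rwa [hKC])).1 ((hpath a c).2 h))
  have hpos : ∀ a ∉ Set.range f, ∀ c ∉ Set.range g,
      (¬ ∃ b, Rel .Gneg a (f b) ∧ Rel .Gneg (g b) c) → Rel .Rpos (e (i₀ a)) (j₀ c) :=
    fun a ha c hc h => hMc.colour_eq_some_iff.1 ((hstd (i₀ a) (by simp) (by rwa [hKA]) (j₀ c)
      (by simp) (by rwa [hKC])).2 (mt (hpath a c).1 h))
  have hdisj : ∀ a ∉ Set.range f, ∀ c ∉ Set.range g, e (i₀ a) ≠ j₀ c := fun a ha c hc h => by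
    by_cases hb : ∃ b, Rel .Gneg a (f b) ∧ Rel .Gneg (g b) c
    · exact hMc.irrefl .Rneg _ (h ▸ hneg a ha c hc hb)
    · exact hMc.irrefl .Rpos _ (h ▸ hpos a ha c hc hb)
  set i₁ := e.toEmbedding.comp i₀
  set V : Lang.Substructure M := Substructure.closure Lang (Set.range i₁ ∪ Set.range j₀)
  have hV : (V : Set M) = Set.range i₁ ∪ Set.range j₀ :=
    Substructure.closure_eq_of_isRelational Lang _
  have hVA : ∀ a, i₁ a ∈ V := fun a => Substructure.subset_closure (.inl ⟨a, rfl⟩)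
  have hVC : ∀ c, j₀ c ∈ V := fun c => Substructure.subset_closure (.inr ⟨c, rfl⟩)
  have hVfin : Finite V :=
    Set.Finite.to_subtype (hV ▸ (Set.finite_range i₁).union (Set.finite_range j₀))
  refine ⟨⟨V, inferInstance⟩, i₁.codRestrict V hVA, j₀.codRestrict V hVC, hS.mem_iff.2
    ⟨hVfin, hMc.of_embedding V.subtype, hMok.of_embedding V.subtype⟩, ?_⟩
  have hrel : ∀ k a c, Rel (M := V) k (i₁.codRestrict V hVA a) (j₀.codRestrict V hVC c) ↔
      Rel k (e (i₀ a)) (j₀ c) := fun k a c => (rel_embedding_iff V.subtype k _ _).symm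
  refine { comm := ?_, inter := ?_, union := ?_, colour := ?_ }
  · exact Embedding.ext fun b => Subtype.ext (hfix b)
  · refine Set.Subset.antisymm ?_ ?_
    · rintro _ ⟨⟨a, rfl⟩, ⟨c, hc⟩⟩
      have hc : j₀ c = e (i₀ a) := congrArg Subtype.val hc
      by_cases ha : a ∈ Set.range f
      · obtain ⟨b, rfl⟩ := ha
        exact ⟨b, rfl⟩
      · by_cases hc' : c ∈ Set.range g
        · obtain ⟨b, rfl⟩ := hc'
          rw [← hfix] at hc
          exact absurd ⟨b, i₀.injective (e.injective hc)⟩ ha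
        · exact absurd hc.symm (hdisj a ha c hc')
    · rintro _ ⟨b, rfl⟩
      exact ⟨⟨f b, rfl⟩, ⟨g b, Subtype.ext (hfix b).symm⟩⟩
  · refine Set.eq_univ_of_forall ?_
    rintro ⟨x, hx⟩
    rcases (hV ▸ hx : x ∈ Set.range i₁ ∪ Set.range j₀) with ⟨a, rfl⟩ | ⟨c, rfl⟩
    · exact .inl ⟨a, rfl⟩
    · exact .inr ⟨c, rfl⟩
  · intro a ha c hc
    by_cases hb : ∃ b, Rel .Gneg a (f b) ∧ Rel .Gneg (g b) c
    · refine ⟨1, (hrel _ a c).2 (hneg a ha c hc hb), (admissible_Rneg_iff hrule hS hT f g a c).2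
        (not_exists_Gneg_and_exists_Gpos hrule f g hAc hCc hAok hCok hb), fun u hu => ?_⟩
      obtain rfl := (Fin.lt_one_iff u).1 hu
      exact fun h => (admissible_Rpos_iff hrule hS hT f g a c).1 h hb
    · exact ⟨0, (hrel _ a c).2 (hpos a ha c hc hb),
        (admissible_Rpos_iff hrule hS hT f g a c).2 hb, fun u hu => absurd hu (Fin.not_lt_zero u)⟩

theorem isPrioritisedSemiFree (hrule : IsPathRule ok) (hS : IsForbRule S ok)
    (hT : ∀ T ∈ S, ∃ p q s, T = triangle p q s) :
    IsPrioritisedSemiFree S ![.Rpos, .Rneg] := by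
  have hlim := isFraisseLimit_limitStructure hrule hS
  refine ⟨?_, ⟨hlim.isFraisse, ?_, fun A B C f g hA hB hC => ?_⟩,
    fun A B C f g hA hB hC => exists_isPrioritisedAmalgam hrule hS hT hlim f g hA hB hC⟩
  · intro a b
    fin_cases a <;> fin_cases b <;> simp
  · refine Set.ssubset_univ_iff.2 fun h => ?_
    obtain ⟨x, hx⟩ := (h ▸ Set.mem_univ Colour.Gpos : Colour.Gpos ∈ Set.range ![_, _])
    fin_cases x <;> simp at hx
  · obtain ⟨D, i, j, hD, hij⟩ := exists_isPrioritisedAmalgam hrule hS hT hlim f g hA hB hC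
    refine ⟨D, i, j, hD, hij.toIsStrongAmalgam, fun a ha c hc k hk => ?_⟩
    obtain ⟨t, ht, -⟩ := hij.colour a ha c hc
    have hDc := (hS.mem_iff.1 hD).2.1
    exact ⟨t, Option.some_inj.1
      ((hDc.colour_eq_some_iff.2 ht).symm.trans (hDc.colour_eq_some_iff.2 hk))⟩

/-! ### Simplicity of the automorphism group -/

/-- The action of the automorphisms of a structure on its points. -/
def autHom (M : Type*) [Lang.Structure M] : (M ≃[Lang] M) →* Equiv.Perm M where
  toFun g := g.toEquiv
  map_one' := rfl
  map_mul' _ _ := rfl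

theorem autHom_injective (M : Type*) [Lang.Structure M] : Function.Injective (autHom M) :=
  fun _ _ h => FirstOrder.Language.Equiv.ext fun x => DFunLike.congr_fun h x

theorem IsGeneric.isSimpleGroup {M : Type*} [Lang.Structure M] [Countable M] (hMc : IsComplete M)
    (hM : IsGeneric ok (colour M)) : IsSimpleGroup (M ≃[Lang] M) where
  exists_pair_ne := by
    obtain ⟨x⟩ := hM.extension.nonempty
    obtain ⟨y, hy⟩ := hM.extension {x} (fun _ => .Rpos) fun u _ v _ => by simp
    obtain ⟨g, hg, hgx⟩ := hM.homogeneous {x} (fun _ => y) fun a ha b hb => by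
      rw [Finset.mem_singleton.1 ha, Finset.mem_singleton.1 hb, hM.self, hM.self]
    obtain ⟨e, rfl⟩ := exists_equiv_of_mem_colourAut hMc hg
    refine ⟨e, 1, ?_⟩
    rintro rfl
    exact hM.ne (hy x (Finset.mem_singleton_self x)) (hgx x (Finset.mem_singleton_self x)).symm
  eq_bot_or_eq_top_of_normal N hN := by
    refine or_iff_not_imp_left.2 fun hbot => ?_
    obtain ⟨g, hgN, hg1⟩ := N.bot_or_exists_ne_one.resolve_left hbot
    refine (Subgroup.eq_top_iff' N).2 fun f => ?_
    rw [← Subgroup.mem_map_iff_mem (autHom_injective M)]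
    refine hM.mem_of_normalised (toEquiv_mem_colourAut hMc g)
      (fun h => hg1 (autHom_injective M (h.trans (map_one _).symm)))
      (Subgroup.mem_map_of_mem (autHom M) hgN) ?_ (toEquiv_mem_colourAut hMc f)
    rintro a ha _ ⟨n, hn, rfl⟩
    obtain ⟨a, rfl⟩ := exists_equiv_of_mem_colourAut hMc ha
    exact ⟨a * n * a⁻¹, hN.conj_mem n hn a, by rw [map_mul, map_mul, map_inv]; rfl⟩

end

end MultiTournament

theorem mainTheorem8 (S : Set (Bundled.{0} MultiTournament.Lang.Structure))
    (hS : S = MultiTournament.cherlin8 ∨ S = MultiTournament.cherlin9 ∨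
      S = MultiTournament.cherlin10) :
    MultiTournament.IsPrioritisedSemiFree S
        ![MultiTournament.Colour.Rpos, MultiTournament.Colour.Rneg] ∧
      (∃ M : Bundled.{0} MultiTournament.Lang.Structure, ∃ _ : Countable M,
        FirstOrder.Language.IsFraisseLimit (MultiTournament.Forb S) M) ∧
      ∀ (M : Type) [MultiTournament.Lang.Structure M] [Countable M],
        FirstOrder.Language.IsFraisseLimit (MultiTournament.Forb S) M →
          IsSimpleGroup (M ≃[MultiTournament.Lang] M) := by
  obtain ⟨ok, hrule, hforb, htri⟩ := MultiTournament.exists_isForbRule hS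
  refine ⟨MultiTournament.isPrioritisedSemiFree hrule hforb htri,
    ⟨MultiTournament.limitStructure ok, inferInstance,
      MultiTournament.isFraisseLimit_limitStructure hrule hforb⟩, ?_⟩
  intro M _ _ hM
  obtain ⟨hMc, -, hgen⟩ := hforb.isGeneric hrule hM
  exact hgen.isSimpleGroup hMc
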